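/- **Setting.** Let $G=(V,E)$ be a finite undirected graph, $e=(q,p)$ an edge of $G$, and $G^{-e}$ the graph $G$ with $e$ removed. A path between $q$ and $p$ in $G^{-e}$ is *minimal* if it has no chord. Let $\Lambda$ be the set of minimal paths between $q$ and $p$ in $G^{-e}$; for $\lambda\in\Lambda$ let $1_\lambda,2_\lambda,\dots,\ell_\lambda$ be its interior vertices, in the order from $q$ to $p$ (so $\lambda$ has $\ell_\lambda$ interior vertices and length $\ell_\lambda+1$). Let $\Lambda_{2+}=\{\lambda\in\Lambda:\ell_\lambda\ge 2\}$ and let $d$ be the number of $\lambda\in\Lambda$ of length $2$, i.e. with $\ell_\lambda=1$. Assume that $G^{-e}$ is formed by its minimal paths (every vertex other than $q,p$ and every edge of $G^{-e}$ lies on some $\lambda\in\Lambda$), and that distinct paths in $\Lambda$ have no edge in common. Number the vertices as $$1_{\lambda_1},\dots,\ell_{\lambda_1},\,1_{\lambda_2},\dots,\ell_{\lambda_2},\,\dots,\,1_{\lambda_L},\dots,\ell_{\lambda_L},\,q,\,p,$$ where $\lambda_1,\dots,\lambda_L$ is an enumeration of $\Lambda$ in which the paths of length $2$ come last. Let $\delta>2$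 be real. For a graph $\Gamma_0$ on $V$, let $P_{\Gamma_0}$ be the set of positive definite symmetric matrices $K$ with $K_{ij}=0$ whenever $i\neq j$ and $(i,j)$ is not an edge of $\Gamma_0$, and let $$I_{\Gamma_0}=\int_{P_{\Gamma_0}}|K|^{(\delta-2)/2}e^{-\frac12\operatorname{tr}K}\,dK$$ be the $G$-Wishart normalizing constant with scale the identity ($dK$ is Lebesgue measure in the entries $K_{ij}$, $i\le j$, with $i=j$ or $(i,j)$ an edge). Let $\psi$ be the random upper triangular matrix whose entries $\psi_{ii}>0$ ($i\in V$) and $\psi_{ij}$ ($i<j$, $(i,j)$ an edge of $G^{-e}$) are independent, with $\psi_{ij}\sim N(0,1)$ for $i<j$ and $\psi_{ii}^2\sim\chi^2_{\delta+\nu_i}$, where $\nu_i$ is the number of neighbours of $i$ in $G^{-e}$ numbered after $i$; the other entries are determined by $$\psi_{ij}=-\frac{1}{\psi_{ii}}\sum_{r<i}\psi_{ri}\psi_{rj}\qquad(i<j,\ (i,j)\text{ not an edge of }G^{-e}).$$ Put $\psi_e=\psi_{qp}$, and $$S=\sum_{i<j,\ (i,j)\notin E}\psi_{ij}^2,\qquad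 A=\sum_{\lambda\in\Lambda,\ \ell_\lambda=1}\frac{\psi_{1_\lambda q}\,\psi_{\ell_\lambda p}}{\psi_{qq}}.$$ With $$R_x=\frac{\Gamma(\frac x2)}{\sqrt\pi\,\Gamma(\frac{x+1}2)},\qquad r(\delta)=\frac{\Gamma(\frac{\delta+1}2)^2}{\Gamma(\frac\delta2)\Gamma(\frac{\delta+2}2)},\qquad B=\frac{2}{\pi r(\delta)}\,\frac{\delta}{\delta+2}\Big(\sum_{\lambda\in\Lambda_{2+}}R_\delta^{\ell_\lambda}\Big)R_{\delta+d-1},$$ the following hold. **Theorem 1.** 1. $\displaystyle 0\le 1-\frac{\mathbb E\,e^{-\frac12(S+\psi_e^2)}}{\mathbb E\,e^{-\frac12(S+A^2)}}\le B.$ 2. $A$ is independent of $S$. 3. $\displaystyle \mathbb E\big(e^{-A^2/2}\big)=\frac{\Gamma(\frac{\delta+d}2)\,\Gamma(\frac{\delta+1}2)}{\Gamma(\frac\delta2)\,\Gamma(\frac{\delta+d+1}2)}.$ 4. The ratio $I_{G^{-e}}/I_G$ is approximated by $\dfrac1{2\sqrt\pi}\dfrac{\Gamma(\frac{\delta+d}2)}{\Gamma(\frac{\delta+d+1}2)}$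 with the same relative accuracy: $I_{G^{-e}}$ and $I_G$ are positive and finite, and $$0\le 1-\frac{I_{G^{-e}}}{I_G}\Big/\left(\frac1{2\sqrt\pi}\,\frac{\Gamma(\frac{\delta+d}2)}{\Gamma(\frac{\delta+d+1}2)}\right)\le B.$$ -/

import Mathlib

noncomputable section

open MeasureTheory ProbabilityTheory
open scoped Classical

namespace GWishartRatio

/-! ### Graphs and minimal paths -/

section Graphs

variable {V : Type*} [Fintype V]

/-- `G^{-e}` for `e = (q, p)`: the graph `G` with the edge between `q` and `p` removed. -/
def removeEdge (G : SimpleGraph V) (q p : V) : SimpleGraph V :=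
  G.deleteEdges {s(q, p)}

/-- The set `Λ` of minimal paths of `H` between `q` and `p`: the paths without a chord. -/
def minimalPaths (H : SimpleGraph V) (q p : V) : Finset (H.Path q p) :=
  Finset.univ.filter fun w => w.1.IsChordless

/-- The list `1_λ, 2_λ, …, ℓ_λ` of the vertices of a path strictly between its end points
`q` and `p`, in the order in which the path visits them. -/
def interiorVertices {H : SimpleGraph V} {q p : V} (w : H.Path q p) : List V :=
  w.1.support.tail.dropLast

/-- The number `ℓ_λ` of interior vertices of a path. The length of the path is `ℓ_λ + 1`. -/
def ell {H : SimpleGraph V} {q p : V} (w : H.Path q p) : ℕ :=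
  (interiorVertices w).length

/-- The minimal paths of length `2` (one interior vertex). -/
def pathsOfLengthTwo (H : SimpleGraph V) (q p : V) : Finset (H.Path q p) :=
  (minimalPaths H q p).filter fun w => ell w = 1

/-- `Λ_{2+}`: the minimal paths with at least two interior vertices. -/
def pathsTwoPlus (H : SimpleGraph V) (q p : V) : Finset (H.Path q p) :=
  (minimalPaths H q p).filter fun w => 2 ≤ ell w

/-- The minimal paths between `q` and `p` are pairwise disjoint: they have no edge in common. -/
def MinimalPathsDisjoint (H : SimpleGraph V) (q p : V) : Prop :=
  ∀ w ∈ minimalPaths H q p, ∀ w' ∈ minimalPaths H q p, w ≠ w' →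
    ∀ f : Sym2 V, f ∈ w.1.edges → f ∉ w'.1.edges

/-- `H` is the graph formed by its minimal paths between `q` and `p`: every vertex other than
`q, p`, and every edge, lies on one of them. -/
def IsUnionOfMinimalPaths (H : SimpleGraph V) (q p : V) : Prop :=
  (∀ v : V, v = q ∨ v = p ∨ ∃ w ∈ minimalPaths H q p, v ∈ w.1.support) ∧
    ∀ f ∈ H.edgeSet, ∃ w ∈ minimalPaths H q p, f ∈ w.1.edges

/-- The vertices are numbered as
`1_{λ₁}, …, ℓ_{λ₁}, 1_{λ₂}, …, ℓ_{λ₂}, …, 1_{λ_L}, …, ℓ_{λ_L}, q, p`, for some enumeration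
`λ₁, …, λ_L` of the minimal paths in which those of length `2` come last. -/
structure IsPathOrder [LinearOrder V] (H : SimpleGraph V) (q p : V) : Prop where
  /-- `p` is the last vertex and `q` the one before it -/
  q_lt_p : q < p
  le_q : ∀ v : V, v ≠ p → v ≤ q
  /-- inside a path the numbering follows the path -/
  along : ∀ w ∈ minimalPaths H q p, (interiorVertices w).Pairwise (· < ·)
  /-- distinct paths occupy successive blocks -/
  blocks : ∀ w ∈ minimalPaths H q p, ∀ w' ∈ minimalPaths H q p, w ≠ w' →
    (∀ u ∈ interiorVertices w, ∀ v ∈ interiorVertices w', u < v) ∨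
      (∀ u ∈ interiorVertices w, ∀ v ∈ interiorVertices w', v < u)
  /-- the paths of length `2` are listed last -/
  short_last : ∀ w ∈ pathsTwoPlus H q p, ∀ w' ∈ pathsOfLengthTwo H q p,
    ∀ u ∈ interiorVertices w, ∀ v ∈ interiorVertices w', u < v

end Graphs

/-! ### The `G`-Wishart normalizing constant and the Cholesky entries -/

section Wishart

variable {V : Type*} [Fintype V] [LinearOrder V]

/-- Positions of the free entries of a matrix of the model given by `G`: the diagonal positions
and the positions `(i, j)` with `i < j` and `{i, j}` an edge of `G`. -/
def FreeIdx (G : SimpleGraph V) : Type _ :=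
  {ij : V × V // ij.1 = ij.2 ∨ (ij.1 < ij.2 ∧ G.Adj ij.1 ij.2)}

instance (G : SimpleGraph V) : Fintype (FreeIdx G) :=
  Subtype.fintype _

/-- The symmetric matrix with the given free entries and with zeros at the missing edges. -/
def symMatrix (G : SimpleGraph V) (k : FreeIdx G → ℝ) : Matrix V V ℝ :=
  Matrix.of fun i j =>
    if h : i = j ∨ (i < j ∧ G.Adj i j) then k ⟨(i, j), h⟩
    else if h' : j < i ∧ G.Adj j i then k ⟨(j, i), Or.inr h'⟩
    else 0

/-- The normalizing constant `I_G(δ, D) = ∫_{P_G} |K|^{(δ-2)/2} exp(-tr(K D)/2) dK` of the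
`G`-Wishart distribution, where `dK` is Lebesgue measure in the free entries of `K`. -/
def normConst (G : SimpleGraph V) (δ : ℝ) (D : Matrix V V ℝ) : ℝ :=
  ∫ k in {k : FreeIdx G → ℝ | (symMatrix G k).PosDef},
    (symMatrix G k).det ^ ((δ - 2) / 2) * Real.exp (-(1 / 2) * (symMatrix G k * D).trace)

/-- `ν_i`: the number of neighbours of `i` which are numbered after `i`. -/
def nu (G : SimpleGraph V) (i : V) : ℕ :=
  (Finset.univ.filter fun j => i < j ∧ G.Adj i j).card

/-- The law of the positive square root of a chi-square variable with `k` degrees of freedom. -/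
def chiLaw (k : ℝ) : Measure ℝ :=
  (gammaMeasure (k / 2) (1 / 2)).map Real.sqrt

/-- The law of the free entries `ψ_ij` of the Cholesky factor: they are independent, `ψ_ij` is
standard normal for `i ≠ j` and `ψ_ii ^ 2` is chi-square with `δ + ν_i` degrees of freedom
(`ψ_ii > 0`). -/
def psiLaw (G : SimpleGraph V) (δ : ℝ) : Measure (FreeIdx G → ℝ) :=
  Measure.pi fun ij =>
    if ij.1.1 = ij.1.2 then chiLaw (δ + nu G ij.1.1) else gaussianReal 0 1

/-- The upper triangular matrix `ψ` completed from its free entries: for a missing edge `(i, j)`,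
`i < j`, one has `ψ_ij = -(∑_{r < i} ψ_ri ψ_rj) / ψ_ii`, which expresses that the entry `(i, j)`
of `ψᵗ ψ` vanishes. -/
def psi (G : SimpleGraph V) (x : FreeIdx G → ℝ) (i j : V) : ℝ :=
  if h : i = j ∨ (i < j ∧ G.Adj i j) then x ⟨(i, j), h⟩
  else if i < j then
    -(∑ r : {r : V // r < i}, psi G x r.1 i * psi G x r.1 j) / x ⟨(i, i), Or.inl rfl⟩
  else 0
termination_by (wellFounded_lt (α := V)).wrap i
decreasing_by all_goals exact r.2

/-- `∑ ψ_ij ^ 2` over the missing edges `(i, j)`, `i < j`, of `G`, where `ψ` is the matrix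
completed from the free entries for `G^{-e}`, `e = (q, p)`. -/
def missingSum (G : SimpleGraph V) (q p : V) (x : FreeIdx (removeEdge G q p) → ℝ) : ℝ :=
  ∑ ij ∈ Finset.univ.filter fun ij : V × V => ij.1 < ij.2 ∧ ¬ G.Adj ij.1 ij.2,
    psi (removeEdge G q p) x ij.1 ij.2 ^ 2

/-- `A`: the sum of `ψ_{1_λ, q} ψ_{ℓ_λ, p} / ψ_qq` over the minimal paths of length `2`, for
which `1_λ` and `ℓ_λ` are the single interior vertex. -/
def termA (H : SimpleGraph V) (q p : V) (x : FreeIdx H → ℝ) : ℝ :=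
  ∑ w ∈ pathsOfLengthTwo H q p,
    psi H x (w.1.getVert 1) q * psi H x (w.1.getVert (ell w)) p / psi H x q q

end Wishart

/-! ### The constants -/

/-- `R_δ = Γ(δ/2) / (√π Γ((δ+1)/2))`. -/
def bigR (δ : ℝ) : ℝ :=
  Real.Gamma (δ / 2) / (√Real.pi * Real.Gamma ((δ + 1) / 2))

/-- `r(δ) = Γ((δ+1)/2)² / (Γ(δ/2) Γ((δ+2)/2))`. -/
def smallR (δ : ℝ) : ℝ :=
  Real.Gamma ((δ + 1) / 2) ^ 2 / (Real.Gamma (δ / 2) * Real.Gamma ((δ + 2) / 2))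

/-- The bound `B`. -/
def boundB {V : Type*} [Fintype V] (H : SimpleGraph V) (q p : V) (δ : ℝ) : ℝ :=
  2 / (Real.pi * smallR δ) * (δ / (δ + 2)) * (∑ w ∈ pathsTwoPlus H q p, bigR δ ^ ell w) *
    bigR (δ + (pathsOfLengthTwo H q p).card - 1)

/-- The approximation `(1 / (2√π)) Γ((δ+d)/2) / Γ((δ+d+1)/2)` of the ratio of constants. -/
def approxRatio (δ : ℝ) (d : ℕ) : ℝ :=
  1 / (2 * √Real.pi) * (Real.Gamma ((δ + d) / 2) / Real.Gamma ((δ + d + 1) / 2))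

end GWishartRatio

end

open MeasureTheory ProbabilityTheory GWishartRatio

noncomputable section

open MeasureTheory ProbabilityTheory
open scoped Classical ENNReal

set_option linter.unusedSectionVars false

namespace GWishartRatio

/-! ### Chi, normal and Student laws -/

/-! Under the path numbering the completion of ψ creates almost no new entries: a vertex before q
has at most one later neighbour other than q, so a missing entry ψ_ij with i < q and j ≠ q vanishes
(`psi_eq_zero`). What remains is the column of q. Along a path λ its entries c_k = ψ_{kq} form a
Markov chain, c_{k+1} = -ψ_{k,k+1} c_k / ψ_{k+1,k+1}, started at a standard normal variable. Hence S
is the sum of the squares of all terms but the first of these chains, and ψ_e = -∑_λ c_λ ψ_{ℓp} /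
ψ_qq, where c_λ is the last term. Distinct paths use disjoint sets of independent free entries
(`isChainSystem_minimalPaths`). The paths of length 2 are chains of one term, contribute nothing to
S, and make up A; this gives the independence.

Integrating out the normal variables ψ_{ℓp} turns exp(-ψ_e²/2) into 1/√(1 + ∑ c_λ²/ψ_qq²). The
one-term chains are normal, so their squares can be absorbed into ψ_qq²: this replaces a chi
variable with δ degrees of freedom by one, r, with D = δ + d, at the price of the constant E
exp(-A²/2) (`lintegral_mul_inv_sqrt`). With γ the sum of c_λ² over the long paths and gap(y) = 1 -
1/√(1+y), the relative error is therefore exactly E[e^{-S/2} gap(γ/r²)] / E[e^{-S/2}], which is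
nonnegative. The function gap is subadditive, and independence cancels all chains but one, so each
long path is estimated separately.

For one chain both expectations are iterates of the positive operator T f(c) = E[exp(-(ct)²/2)
f(-ct)], with t a normal over chi ratio (`IsChain.lintegral_exp_mul`). The denominator is at least
r(δ), because T has an explicit fixed point below 1 whose Gaussian mean is r(δ) (`stepOp_stepFix`,
`lintegral_stepFix`). For the numerator, T|c| ≤ R_δ |c|, and the first step, taken from the Gaussian
start, is computed exactly and yields δ/(δ+2). When δ ≤ 31/10, the linear bound gap(u²) ≤ (2/π) R_δ
u suffices. For larger δ half of it is combined with a quadratic term, which is shown to cost no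
more than the other half (`IsChain.lintegral_exp_mul_gapMean_le`).

For the normalizing constants, the Cholesky map from the free entries of ψ to those of K = ψᵗψ is a
bijection with triangular Jacobian, so I_G is an explicit product of Gamma factors times E exp(-½ ∑
ψ_ij²) over the missing edges (`normConst_one_eq`). Passing from G to G^{-e} changes only the factor
of q and adds ψ_e² to the sum, since the missing entries of G lie in rows before q. The ratio of
constants thus reduces to the ratio of expectations already treated. -/

/-- The density of `chiLaw k`. -/
def chiPDF (k z : ℝ) : ℝ :=
  if 0 < z then 2 ^ (1 - k / 2) / Real.Gamma (k / 2) * z ^ (k - 1) * Real.exp (-z ^ 2 / 2) else 0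

/-- The density of the quotient of a standard normal variable by an independent variable of law
`chiLaw k`. -/
def studentPDF (k t : ℝ) : ℝ :=
  Real.Gamma ((k + 1) / 2) / (√Real.pi * Real.Gamma (k / 2)) * (1 + t ^ 2) ^ (-(k + 1) / 2)

/-- The moment of order `a` of `chiLaw k`. -/
def chiMoment (a k : ℝ) : ℝ :=
  2 ^ (a / 2) * Real.Gamma ((k + a) / 2) / Real.Gamma (k / 2)

@[fun_prop]
lemma measurable_chiPDF (k : ℝ) : Measurable (chiPDF k) := by
  unfold chiPDF
  exact Measurable.ite measurableSet_Ioi (by fun_prop) measurable_const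

@[fun_prop]
lemma measurable_studentPDF (k : ℝ) : Measurable (studentPDF k) := by
  unfold studentPDF; fun_prop

lemma chiPDF_nonneg {k : ℝ} (hk : 0 < k) (z : ℝ) : 0 ≤ chiPDF k z := by
  unfold chiPDF
  split_ifs with h
  · have := Real.Gamma_pos_of_pos (half_pos hk)
    positivity
  · rfl

lemma studentPDF_nonneg {k : ℝ} (hk : 0 < k) (t : ℝ) : 0 ≤ studentPDF k t := by
  have := Real.Gamma_pos_of_pos (half_pos hk)
  have := Real.Gamma_pos_of_pos (half_pos (by linarith : 0 < k + 1))
  unfold studentPDF; positivity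

lemma chiMoment_pos {a k : ℝ} (hk : 0 < k) (hak : 0 < k + a) : 0 < chiMoment a k := by
  have := Real.Gamma_pos_of_pos (half_pos hk)
  have := Real.Gamma_pos_of_pos (half_pos hak)
  unfold chiMoment; positivity

lemma chiLaw_eq_withDensity {k : ℝ} :
    chiLaw k = volume.withDensity fun z => ENNReal.ofReal (chiPDF k z) := by
  refine Measure.ext_of_lintegral _ fun f hf => ?_
  have hG : Measurable (gammaPDF (k / 2) (1 / 2)) :=
    (measurable_gammaPDFReal _ _).ennreal_ofReal
  rw [chiLaw, lintegral_map hf (by fun_prop), gammaMeasure,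
    lintegral_withDensity_eq_lintegral_mul _ hG (by fun_prop),
    lintegral_withDensity_eq_lintegral_mul _ (measurable_chiPDF k).ennreal_ofReal hf]
  have himg : (fun z : ℝ => z ^ 2) '' Set.Ioi 0 = Set.Ioi 0 := by
    ext y
    constructor
    · rintro ⟨z, hz, rfl⟩
      exact pow_pos (Set.mem_Ioi.1 hz) 2
    · intro hy
      exact ⟨√y, Real.sqrt_pos.2 hy, Real.sq_sqrt (le_of_lt hy)⟩
  have hinj : Set.InjOn (fun z : ℝ => z ^ 2) (Set.Ioi 0) := by
    intro a ha b hb hab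
    exact (pow_left_inj₀ (le_of_lt ha) (le_of_lt hb) two_ne_zero).1 hab
  have hcv := lintegral_image_eq_lintegral_abs_deriv_mul (s := Set.Ioi (0 : ℝ))
    (f := fun z : ℝ => z ^ 2) (f' := fun z => 2 * z) measurableSet_Ioi
    (fun z _ => by simpa using (hasDerivAt_pow 2 z).hasDerivWithinAt) hinj
    (fun y => gammaPDF (k / 2) (1 / 2) y * f √y)
  rw [himg] at hcv
  have h1 : ∫⁻ y, (gammaPDF (k / 2) (1 / 2) * fun a => f √a) y
      = ∫⁻ y in Set.Ioi 0, gammaPDF (k / 2) (1 / 2) y * f √y := by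
    rw [← lintegral_add_compl _ (measurableSet_Ioi (a := (0 : ℝ)))]
    have : ∫⁻ y in (Set.Ioi (0 : ℝ))ᶜ, (gammaPDF (k / 2) (1 / 2) * fun a => f √a) y = 0 := by
      rw [Set.compl_Ioi, setLIntegral_congr Iio_ae_eq_Iic.symm]
      refine (setLIntegral_congr_fun measurableSet_Iio (g := 0) fun y hy => ?_).trans (by simp)
      simp [gammaPDF_of_neg hy]
    rw [this, add_zero]
    rfl
  have h2 : ∫⁻ z, ((fun z => ENNReal.ofReal (chiPDF k z)) * f) z
      = ∫⁻ z in Set.Ioi 0, ENNReal.ofReal (chiPDF k z) * f z := by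
    rw [← lintegral_add_compl _ (measurableSet_Ioi (a := (0 : ℝ)))]
    have : ∫⁻ y in (Set.Ioi (0 : ℝ))ᶜ, ((fun z => ENNReal.ofReal (chiPDF k z)) * f) y = 0 := by
      refine (setLIntegral_congr_fun measurableSet_Ioi.compl (g := 0) fun y hy => ?_).trans
        (by simp)
      have : ¬ 0 < y := hy
      simp [chiPDF, this]
    rw [this, add_zero]
    rfl
  rw [h1, h2, hcv]
  refine setLIntegral_congr_fun measurableSet_Ioi fun z hz => ?_
  have hz : 0 < z := hz
  rw [gammaPDF_of_nonneg (by positivity), Real.sqrt_sq hz.le, ← mul_assoc,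
    ← ENNReal.ofReal_mul (abs_nonneg _), abs_of_pos (by positivity)]
  congr 2
  rw [chiPDF, if_pos hz]
  have e1 : (z ^ 2) ^ (k / 2 - 1) = z ^ (k - 2) := by
    rw [← Real.rpow_natCast, ← Real.rpow_mul hz.le]; congr 1; push_cast; ring
  have e2 : z ^ (k - 1) = z ^ (k - 2) * z := by
    rw [← Real.rpow_add_one hz.ne']; congr 1; ring
  have e3 : (2 : ℝ) ^ (1 - k / 2) = 2 * (1 / 2) ^ (k / 2) := by
    rw [Real.rpow_sub two_pos, Real.rpow_one, one_div, Real.inv_rpow two_pos.le]; rfl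
  rw [e1, e2, e3, show -(1 / 2 * z ^ 2) = -z ^ 2 / 2 by ring]
  ring

lemma isProbabilityMeasure_chiLaw {k : ℝ} (hk : 0 < k) : IsProbabilityMeasure (chiLaw k) := by
  have := isProbabilityMeasure_gammaMeasure (half_pos hk) (one_half_pos (α := ℝ))
  exact Measure.isProbabilityMeasure_map (by fun_prop)

lemma lintegral_chiLaw {k : ℝ} (hk : 0 < k) {f : ℝ → ℝ≥0∞} (hf : Measurable f) :
    ∫⁻ z, f z ∂chiLaw k = ∫⁻ z, ENNReal.ofReal (chiPDF k z) * f z := by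
  rw [chiLaw_eq_withDensity,
    lintegral_withDensity_eq_lintegral_mul _ (measurable_chiPDF k).ennreal_ofReal hf]
  rfl

lemma ae_pos_chiLaw {k : ℝ} (hk : 0 < k) : ∀ᵐ z ∂chiLaw k, 0 < z := by
  rw [chiLaw_eq_withDensity, ae_withDensity_iff (measurable_chiPDF k).ennreal_ofReal]
  refine Filter.Eventually.of_forall fun z hz => ?_
  by_contra h
  simp [chiPDF, h] at hz

/-- Tilting a chi law by a power gives another chi law. -/
lemma lintegral_chiLaw_rpow_mul {a k : ℝ} (hk : 0 < k) (hak : 0 < k + a) {f : ℝ → ℝ≥0∞}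
    (hf : Measurable f) :
    ∫⁻ z, ENNReal.ofReal (z ^ a) * f z ∂chiLaw k =
      ENNReal.ofReal (chiMoment a k) * ∫⁻ z, f z ∂chiLaw (k + a) := by
  rw [lintegral_chiLaw hk (by fun_prop), lintegral_chiLaw hak hf,
    ← lintegral_const_mul _ (by fun_prop)]
  refine lintegral_congr fun z => ?_
  rw [← mul_assoc, ← mul_assoc, ← ENNReal.ofReal_mul (chiPDF_nonneg hk z),
    ← ENNReal.ofReal_mul (chiMoment_pos hk hak).le]
  congr 2
  unfold chiPDF chiMoment
  split_ifs with hz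
  · have h1 := (Real.Gamma_pos_of_pos (half_pos hk)).ne'
    have h2 := (Real.Gamma_pos_of_pos (half_pos hak)).ne'
    have e1 : z ^ (k + a - 1) = z ^ (k - 1) * z ^ a := by
      rw [← Real.rpow_add hz]; congr 1; ring
    have e2 : (2 : ℝ) ^ (1 - k / 2) = 2 ^ (a / 2) * 2 ^ (1 - (k + a) / 2) := by
      rw [← Real.rpow_add two_pos]; congr 1; ring
    rw [e1, e2]
    field_simp
  · simp

lemma lintegral_chiLaw_rpow {a k : ℝ} (hk : 0 < k) (hak : 0 < k + a) :
    ∫⁻ z, ENNReal.ofReal (z ^ a) ∂chiLaw k = ENNReal.ofReal (chiMoment a k) := by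
  have := isProbabilityMeasure_chiLaw hak
  simpa using lintegral_chiLaw_rpow_mul hk hak (f := 1) measurable_const

lemma lintegral_gaussianReal {v : NNReal} (hv : v ≠ 0) {f : ℝ → ℝ≥0∞} (hf : Measurable f) :
    ∫⁻ x, f x ∂gaussianReal 0 v = ∫⁻ x, gaussianPDF 0 v x * f x := by
  rw [gaussianReal_of_var_ne_zero _ hv,
    lintegral_withDensity_eq_lintegral_mul _ (measurable_gaussianPDF 0 v) hf]
  rfl

lemma lintegral_eq_lintegral_mul_left {a : ℝ} (ha : 0 < a) {f : ℝ → ℝ≥0∞} (hf : Measurable f) :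
    ∫⁻ x, f x = ∫⁻ x, ENNReal.ofReal a * f (a * x) := by
  conv_lhs => rw [← Real.smul_map_volume_mul_left ha.ne']
  rw [lintegral_smul_measure, lintegral_map hf (by fun_prop), abs_of_pos ha,
    lintegral_const_mul _ (by fun_prop)]
  rfl

/-- Polar coordinates for a pair of independent chi and standard normal variables. -/
lemma lintegral_chiLaw_gaussianReal {k : ℝ} (hk : 0 < k) {F : ℝ → ℝ → ℝ≥0∞}
    (hF : Measurable (Function.uncurry F)) :
    ∫⁻ z, ∫⁻ n, F z n ∂gaussianReal 0 1 ∂chiLaw k =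
      ∫⁻ t, ENNReal.ofReal (studentPDF k t) *
        ∫⁻ s, F (s / √(1 + t ^ 2)) (s * t / √(1 + t ^ 2)) ∂chiLaw (k + 1) := by
  have hk1 : 0 < k + 1 := by linarith
  have hFz : ∀ z, Measurable (F z) := fun z => hF.of_uncurry_left
  have hF2 : ∀ {α : Type} [MeasurableSpace α] {f g : α → ℝ}, Measurable f → Measurable g →
      Measurable fun x => F (f x) (g x) := fun hf hg => hF.comp (hf.prodMk hg)
  have mchi := fun k => (measurable_chiPDF k).ennreal_ofReal
  have mg := measurable_gaussianPDF 0 1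
  have mchi' : ∀ k, Measurable fun x : ℝ × ℝ => ENNReal.ofReal (chiPDF k x.1) :=
    fun k => (mchi k).comp measurable_fst
  have step1 : ∫⁻ z, ∫⁻ n, F z n ∂gaussianReal 0 1 ∂chiLaw k
      = ∫⁻ z, ∫⁻ t, ENNReal.ofReal (chiPDF k z) * (ENNReal.ofReal z *
          (gaussianPDF 0 1 (z * t) * F z (z * t))) := by
    have hm : Measurable fun z => ∫⁻ n, F z n ∂gaussianReal 0 1 := hF.lintegral_prod_right
    rw [lintegral_chiLaw hk hm]
    refine lintegral_congr fun z => ?_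
    rw [lintegral_const_mul]
    · by_cases hz : 0 < z
      · rw [lintegral_gaussianReal one_ne_zero (hFz z),
          lintegral_eq_lintegral_mul_left (f := fun x => gaussianPDF 0 1 x * F z x) hz
            (mg.mul (hFz z))]
      · simp [chiPDF, hz]
    · have := hF2 (f := fun _ : ℝ => z) (g := fun t => z * t) (by fun_prop) (by fun_prop)
      have := mg.comp (f := fun t : ℝ => z * t) (by fun_prop)
      simp only [Function.comp_def] at this
      fun_prop
  rw [step1, lintegral_lintegral_swap]
  · refine lintegral_congr fun t => ?_
    have ha : 0 < √(1 + t ^ 2) := by positivity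
    have hm1 := hF2 (f := fun s : ℝ => s / √(1 + t ^ 2)) (g := fun s => s * t / √(1 + t ^ 2))
      (by fun_prop) (by fun_prop)
    rw [lintegral_chiLaw hk1 hm1, ← lintegral_const_mul _ (by fun_prop),
      lintegral_eq_lintegral_mul_left (f := fun x => ENNReal.ofReal (chiPDF k x) *
        (ENNReal.ofReal x * (gaussianPDF 0 1 (x * t) * F x (x * t)))) (inv_pos.2 ha)]
    · refine lintegral_congr fun s => ?_
      have e1 : (√(1 + t ^ 2))⁻¹ * s = s / √(1 + t ^ 2) := by ring
      have e2 : s / √(1 + t ^ 2) * t = s * t / √(1 + t ^ 2) := by ring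
      rw [e1, e2]
      simp only [← mul_assoc]
      congr 1
      by_cases hs : 0 < s
      · rw [gaussianPDF, ← ENNReal.ofReal_mul (by positivity),
          ← ENNReal.ofReal_mul (mul_nonneg (by positivity) (chiPDF_nonneg hk _)),
          ← ENNReal.ofReal_mul
            (mul_nonneg (mul_nonneg (by positivity) (chiPDF_nonneg hk _)) (by positivity)),
          ← ENNReal.ofReal_mul (studentPDF_nonneg hk _)]
        congr 1
        rw [chiPDF, if_pos (by positivity), chiPDF, if_pos hs, studentPDF, gaussianPDFReal]
        set a := √(1 + t ^ 2) with ha_def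
        have ha2 : 1 + t ^ 2 = a ^ 2 := by rw [ha_def, Real.sq_sqrt (by positivity)]
        rw [ha2]
        have g1 := (Real.Gamma_pos_of_pos (half_pos hk)).ne'
        have g2 := (Real.Gamma_pos_of_pos (half_pos hk1)).ne'
        have p1 : (a ^ 2 : ℝ) ^ (-(k + 1) / 2) = a ^ (-(k + 1)) := by
          rw [← Real.rpow_natCast, ← Real.rpow_mul ha.le]; congr 1; push_cast; ring
        have p2 : (s / a) ^ (k - 1) = s ^ (k - 1) * (a ^ (-(k + 1)) * a ^ 2) := by
          rw [Real.div_rpow hs.le ha.le, div_eq_mul_inv, ← Real.rpow_neg ha.le,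
            ← Real.rpow_natCast a 2, ← Real.rpow_add ha]
          congr 2; push_cast; ring
        have p3 : s ^ (k + 1 - 1) = s ^ (k - 1) * s := by
          rw [← Real.rpow_add_one hs.ne']; congr 1; ring
        have p4 : (2 : ℝ) ^ (1 - k / 2) = 2 ^ (1 - (k + 1) / 2) * √2 := by
          rw [Real.sqrt_eq_rpow, ← Real.rpow_add two_pos]; congr 1; ring
        have p5 : Real.exp (-s ^ 2 / 2)
            = Real.exp (-(s / a) ^ 2 / 2) * Real.exp (-(s * t / a - 0) ^ 2 / (2 * ((1 : NNReal) : ℝ))) := by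
          rw [← Real.exp_add]; congr 1
          have : t ^ 2 = a ^ 2 - 1 := by linarith
          push_cast
          rw [sub_zero, div_pow, div_pow, mul_pow, this]
          field_simp
          ring
        have p6 : √(2 * Real.pi * ((1 : NNReal) : ℝ)) = √2 * √Real.pi := by
          rw [← Real.sqrt_mul two_pos.le]; simp
        rw [p1, p2, p3, p4, p5, p6]
        have : √2 ≠ 0 := by positivity
        have : √Real.pi ≠ 0 := by positivity
        field_simp
      · have : ¬ 0 < s / √(1 + t ^ 2) := by
          rw [not_lt]; exact div_nonpos_of_nonpos_of_nonneg (not_lt.1 hs) ha.le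
        simp [chiPDF, hs, this]
    · have := hF2 (f := fun s : ℝ => s) (g := fun s => s * t) (by fun_prop) (by fun_prop)
      have := mg.comp (f := fun s : ℝ => s * t) (by fun_prop)
      have := mchi k
      simp only [Function.comp_def] at *
      fun_prop
  · have h1 := hF2 (f := fun x : ℝ × ℝ => x.1) (g := fun x => x.1 * x.2) (by fun_prop) (by fun_prop)
    have h2 := mg.comp (f := fun x : ℝ × ℝ => x.1 * x.2) (by fun_prop)
    have h3 := mchi' k
    simp only [Function.comp_def] at *
    unfold Function.uncurry
    fun_prop

/-- In polar coordinates the integrand depends on the radius only, and the radius is independent of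
the ratio. Adding the square of a normal variable adds one degree of freedom. -/
lemma lintegral_sqrt_sq_add_sq {k : ℝ} (hk : 0 < k) {f : ℝ → ℝ≥0∞} (hf : Measurable f) :
    ∫⁻ z, ∫⁻ n, f √(z ^ 2 + n ^ 2) ∂gaussianReal 0 1 ∂chiLaw k = ∫⁻ s, f s ∂chiLaw (k + 1) := by
  have hk1 : 0 < k + 1 := by linarith
  have key : ∀ g : ℝ → ℝ≥0∞, Measurable g →
      ∫⁻ z, ∫⁻ n, g √(z ^ 2 + n ^ 2) ∂gaussianReal 0 1 ∂chiLaw k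
        = (∫⁻ t, ENNReal.ofReal (studentPDF k t)) * ∫⁻ s, g s ∂chiLaw (k + 1) := by
    intro g hg
    rw [lintegral_chiLaw_gaussianReal hk (F := fun z n => g √(z ^ 2 + n ^ 2))
        (by unfold Function.uncurry; fun_prop),
      ← lintegral_mul_const _ (measurable_studentPDF k).ennreal_ofReal]
    refine lintegral_congr fun t => ?_
    congr 1
    refine lintegral_congr_ae ((ae_pos_chiLaw hk1).mono fun s hs => ?_)
    have : (s / √(1 + t ^ 2)) ^ 2 + (s * t / √(1 + t ^ 2)) ^ 2 = s ^ 2 := by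
      rw [div_pow, div_pow, Real.sq_sqrt (by positivity)]
      field_simp
    simp only [this, Real.sqrt_sq hs.le]
  -- Testing with the constant 1 shows that the Student density has total mass one, since both chi
  -- laws are probability measures.
  have h1 := key 1 measurable_const
  have := isProbabilityMeasure_chiLaw hk
  have := isProbabilityMeasure_chiLaw hk1
  simp only [Pi.one_apply, lintegral_const, measure_univ, mul_one] at h1
  rw [key f hf, ← h1, one_mul]

lemma lintegral_div_chiLaw {k : ℝ} (hk : 0 < k) {f : ℝ → ℝ≥0∞} (hf : Measurable f) :
    ∫⁻ z, ∫⁻ n, f (n / z) ∂gaussianReal 0 1 ∂chiLaw k =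
      ∫⁻ t, ENNReal.ofReal (studentPDF k t) * f t := by
  have hk1 : 0 < k + 1 := by linarith
  have := isProbabilityMeasure_chiLaw hk1
  rw [lintegral_chiLaw_gaussianReal hk (F := fun z n => f (n / z))
    (by unfold Function.uncurry; fun_prop)]
  refine lintegral_congr fun t => ?_
  congr 1
  rw [lintegral_congr_ae (g := fun _ => f t), lintegral_const, measure_univ, mul_one]
  refine (ae_pos_chiLaw hk1).mono fun s hs => ?_
  simp only
  congr 1
  have : √(1 + t ^ 2) ≠ 0 := by positivity
  field_simp

lemma lintegral_studentPDF {k : ℝ} (hk : 0 < k) :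
    ∫⁻ t, ENNReal.ofReal (studentPDF k t) = 1 := by
  have := isProbabilityMeasure_chiLaw hk
  simpa using (lintegral_div_chiLaw hk (f := 1) measurable_const).symm

/-! ### The constants `bigR` and `smallR` -/

lemma bigR_pos {x : ℝ} (hx : 0 < x) : 0 < bigR x := by
  have := Real.Gamma_pos_of_pos (half_pos hx)
  have := Real.Gamma_pos_of_pos (half_pos (by linarith : 0 < x + 1))
  unfold bigR; positivity

lemma Gamma_add_two_div_two {x : ℝ} (hx : 0 < x) :
    Real.Gamma ((x + 2) / 2) = x / 2 * Real.Gamma (x / 2) := by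
  rw [← Real.Gamma_add_one (half_pos hx).ne']; congr 1; ring

lemma bigR_mul_bigR_add_one {x : ℝ} (hx : 0 < x) : bigR x * bigR (x + 1) = 2 / (Real.pi * x) := by
  have h1 := (Real.Gamma_pos_of_pos (half_pos hx)).ne'
  have h2 := (Real.Gamma_pos_of_pos (half_pos (by linarith : 0 < x + 1))).ne'
  have h3 : √Real.pi * √Real.pi = Real.pi := Real.mul_self_sqrt Real.pi_pos.le
  unfold bigR
  rw [show x + 1 + 1 = x + 2 by ring, Gamma_add_two_div_two hx]
  have : √Real.pi ≠ 0 := by positivity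
  have := Real.pi_ne_zero
  field_simp
  rw [sq, h3]

lemma bigR_add_two {x : ℝ} (hx : 0 < x) : bigR (x + 2) = x / (x + 1) * bigR x := by
  have h1 := (Real.Gamma_pos_of_pos (half_pos hx)).ne'
  have h2 := (Real.Gamma_pos_of_pos (half_pos (by linarith : 0 < x + 1))).ne'
  unfold bigR
  rw [show x + 2 + 1 = x + 1 + 2 by ring, Gamma_add_two_div_two hx,
    Gamma_add_two_div_two (by linarith)]
  have : √Real.pi ≠ 0 := by positivity
  field_simp

lemma smallR_eq {x : ℝ} (hx : 0 < x) : smallR x = bigR (x + 1) / bigR x := by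
  have h1 := (Real.Gamma_pos_of_pos (half_pos hx)).ne'
  have h2 := (Real.Gamma_pos_of_pos (half_pos (by linarith : 0 < x + 1))).ne'
  have h3 := (Real.Gamma_pos_of_pos (half_pos (by linarith : 0 < x + 2))).ne'
  unfold bigR smallR
  rw [show x + 1 + 1 = x + 2 by ring]
  have : √Real.pi ≠ 0 := by positivity
  field_simp

lemma smallR_pos {x : ℝ} (hx : 0 < x) : 0 < smallR x := by
  rw [smallR_eq hx]
  exact div_pos (bigR_pos (by linarith)) (bigR_pos hx)

/-- Log-convexity of Γ at the midpoint of x/2 and (x+2)/2. -/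
lemma smallR_le_one {x : ℝ} (hx : 0 < x) : smallR x ≤ 1 := by
  have h1 := Real.Gamma_pos_of_pos (half_pos hx)
  have h3 := Real.Gamma_pos_of_pos (half_pos (by linarith : 0 < x + 2))
  unfold smallR
  rw [div_le_one (by positivity)]
  have h := Real.Gamma_mul_add_mul_le_rpow_Gamma_mul_rpow_Gamma (half_pos hx)
    (half_pos (by linarith : 0 < x + 2)) one_half_pos one_half_pos (by norm_num)
  rw [show (1 : ℝ) / 2 * (x / 2) + 1 / 2 * ((x + 2) / 2) = (x + 1) / 2 by ring,
    ← Real.sqrt_eq_rpow, ← Real.sqrt_eq_rpow, ← Real.sqrt_mul h1.le] at h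
  have h2 := Real.Gamma_pos_of_pos (half_pos (by linarith : 0 < x + 1))
  calc _ ≤ (√(Real.Gamma (x / 2) * Real.Gamma ((x + 2) / 2))) ^ 2 := by gcongr
    _ = _ := Real.sq_sqrt (by positivity)

lemma bigR_add_one_le {x : ℝ} (hx : 0 < x) : bigR (x + 1) ≤ bigR x := by
  have := smallR_le_one hx
  rwa [smallR_eq hx, div_le_one (bigR_pos hx)] at this

/-- The quantity (x - 2/5) R_x² does not increase under x ↦ x + 2, and along x + 2n it is bounded
below by a sequence tending to 2/π. All numerical bounds on R below come from this one. -/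
lemma le_bigR_sq {x : ℝ} (hx : 2 ≤ x) : 2 / Real.pi / (x - 2 / 5) ≤ bigR x ^ 2 := by
  have hpi := Real.pi_pos
  have crude : ∀ y : ℝ, 0 < y → 2 / Real.pi / y ≤ bigR y ^ 2 := by
    intro y hy
    have h1 := bigR_mul_bigR_add_one hy
    have h2 := mul_le_mul_of_nonneg_left (bigR_add_one_le hy) (bigR_pos hy).le
    rw [h1] at h2
    calc _ = 2 / (Real.pi * y) := by rw [div_div]
      _ ≤ _ := by rw [sq]; exact h2
  -- After clearing denominators the difference of the two sides is proportional to y/5 - 2/5; the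
  -- shift 2/5 is the largest one that works down to y = 2.
  have step : ∀ y : ℝ, 2 ≤ y → (y + 2 - 2 / 5) * bigR (y + 2) ^ 2 ≤ (y - 2 / 5) * bigR y ^ 2 := by
    intro y hy
    rw [bigR_add_two (by linarith), mul_pow, ← mul_assoc]
    refine mul_le_mul_of_nonneg_right ?_ (sq_nonneg _)
    rw [div_pow, ← mul_div_assoc, div_le_iff₀ (by positivity)]
    nlinarith
  have iter : ∀ n : ℕ, (x + 2 * n - 2 / 5) * bigR (x + 2 * n) ^ 2 ≤ (x - 2 / 5) * bigR x ^ 2 := by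
    intro n
    induction n with
    | zero => simp
    | succ n ih =>
      refine le_trans ?_ ih
      have := step (x + 2 * n) (by have : (0 : ℝ) ≤ n := n.cast_nonneg; linarith)
      push_cast
      rwa [show x + 2 * (n + 1 : ℝ) = x + 2 * n + 2 by ring]
  have low : ∀ n : ℕ, 2 / Real.pi * (1 - 2 / 5 / (x + 2 * n)) ≤ (x - 2 / 5) * bigR x ^ 2 := by
    intro n
    have hn : (0 : ℝ) ≤ n := n.cast_nonneg
    have hy : 0 < x + 2 * n := by linarith
    refine le_trans ?_ (iter n)
    have := mul_le_mul_of_nonneg_left (crude _ hy) (by linarith : 0 ≤ x + 2 * n - 2 / 5)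
    refine le_trans (le_of_eq ?_) this
    field_simp
  have lim : Filter.Tendsto (fun n : ℕ => 2 / Real.pi * (1 - 2 / 5 / (x + 2 * (n : ℝ))))
      Filter.atTop (nhds (2 / Real.pi * (1 - 0))) := by
    refine Filter.Tendsto.const_mul _ (Filter.Tendsto.const_sub _ ?_)
    refine Filter.Tendsto.div_atTop tendsto_const_nhds ?_
    refine Filter.tendsto_atTop_add_const_left _ _ ?_
    exact Filter.Tendsto.const_mul_atTop two_pos tendsto_natCast_atTop_atTop
  have := le_of_tendsto' lim low
  rw [div_le_iff₀ (by linarith)]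
  linarith

/-! ### The function `1 - 1 / √(1 + u ^ 2)` -/

/-- `1 - 1 / √(1 + y)`. -/
def gapFun (y : ℝ) : ℝ := 1 - 1 / √(1 + y)

lemma gapFun_nonneg {y : ℝ} (hy : 0 ≤ y) : 0 ≤ gapFun y := by
  unfold gapFun
  rw [sub_nonneg, div_le_one (by positivity)]
  exact Real.one_le_sqrt.2 (by linarith)

@[fun_prop]
lemma measurable_gapFun : Measurable gapFun := by unfold gapFun; fun_prop

/-- The function is concave and vanishes at 0, hence is subadditive. The proof is algebraic, in the
roots a, b, c of 1+x, 1+y, 1+x+y, for which a² + b² = c² + 1 and ab ≥ c. -/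
lemma gapFun_add_le {x y : ℝ} (hx : 0 ≤ x) (hy : 0 ≤ y) :
    gapFun (x + y) ≤ gapFun x + gapFun y := by
  unfold gapFun
  set a := √(1 + x)
  set b := √(1 + y)
  have ha : 1 ≤ a := Real.one_le_sqrt.2 (by linarith)
  have hb : 1 ≤ b := Real.one_le_sqrt.2 (by linarith)
  have ha2 : a ^ 2 = 1 + x := Real.sq_sqrt (by linarith)
  have hb2 : b ^ 2 = 1 + y := Real.sq_sqrt (by linarith)
  set c := √(1 + (x + y))
  have hc2 : c ^ 2 = 1 + (x + y) := Real.sq_sqrt (by linarith)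
  have hcpos : 0 < c := by positivity
  have hca : a ≤ c := Real.sqrt_le_sqrt (by linarith)
  have hcb : b ≤ c := Real.sqrt_le_sqrt (by linarith)
  have key : c * (a + b) ≤ a * b * (1 + c) := by
    have h : a ^ 2 + b ^ 2 = c ^ 2 + 1 := by linarith
    have h1 : a * b ≥ c := by
      have : c ^ 2 ≤ (a * b) ^ 2 := by
        have : (a * b) ^ 2 = (1 + x) * (1 + y) := by rw [mul_pow, ha2, hb2]
        rw [this, hc2]; nlinarith
      exact (pow_le_pow_iff_left₀ hcpos.le (by positivity) two_ne_zero).1 this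
    have h2 : a + b ≤ a * b + 1 := by nlinarith
    have h3 : (a + b) ^ 2 = (c ^ 2 + 1) + 2 * (a * b) := by nlinarith
    have h4 : (c * (a + b)) ^ 2 ≤ (a * b * (1 + c)) ^ 2 := by
      rw [mul_pow, h3, mul_pow]
      have : 0 ≤ (a * b - c) := by linarith
      -- This product is exactly the difference of the two squares being compared.
      have : 0 ≤ (a * b - c) * ((a*b) * (1 + c) ^2 + c * (c^2 + 1)) := by positivity
      nlinarith
    exact (pow_le_pow_iff_left₀ (by positivity) (by positivity) two_ne_zero).1 h4
  have : 1 / a + 1 / b ≤ 1 + 1 / c := by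
    rw [div_add_div _ _ (by positivity) (by positivity), div_le_iff₀ (by positivity)]
    have : (1 + 1 / c) * (a * b) = a * b * (1 + c) / c := by field_simp; ring
    rw [this, le_div_iff₀ hcpos]
    linarith
  linarith

lemma gapFun_sum_le {ι : Type*} (s : Finset ι) (f : ι → ℝ) (hf : ∀ i ∈ s, 0 ≤ f i) :
    gapFun (∑ i ∈ s, f i) ≤ ∑ i ∈ s, gapFun (f i) := by
  induction s using Finset.induction_on with
  | empty => simp [gapFun]
  | insert a s ha ih =>
    rw [Finset.sum_insert ha, Finset.sum_insert ha]
    have h1 := gapFun_add_le (hf a (Finset.mem_insert_self _ _))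
      (Finset.sum_nonneg fun i hi => hf i (Finset.mem_insert_of_mem hi))
    have h2 := ih fun i hi => hf i (Finset.mem_insert_of_mem hi)
    linarith

/-- With a = √(1+u²) the quotient gap²/u² equals (a-1)/(a²(a+1)). It is largest at the golden ratio,
where it is about 0.0902; this explains the 1.6 in the hints. -/
lemma gapFun_sq_le_linear (u : ℝ) : gapFun (u ^ 2) ^ 2 ≤ 93 / 1000 * u ^ 2 := by
  unfold gapFun
  set a := √(1 + u ^ 2)
  have ha : 1 ≤ a := Real.one_le_sqrt.2 (by nlinarith)
  have hu2 : u ^ 2 = a ^ 2 - 1 := by rw [Real.sq_sqrt (by positivity)]; ring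
  have : (1 - 1 / a) ^ 2 = (a - 1) ^ 2 / a ^ 2 := by field_simp
  rw [this, hu2, div_le_iff₀ (by positivity)]
  have h : a - 1 ≤ 93 / 1000 * (a + 1) * a ^ 2 := by
    nlinarith [mul_nonneg (by linarith : 0 ≤ a) (sq_nonneg (a - 1.6)), sq_nonneg (a - 1.6)]
  nlinarith [mul_le_mul_of_nonneg_left h (by linarith : 0 ≤ a - 1)]

/-- An intermediate power, to be split by the arithmetic-geometric inequality into a linear and a
quadratic term. After squaring it reads 100(a-1) ≤ (a+1)³a⁴ with a = √(1+u²); the tightest point is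
near a = 1 + 2/9. -/
lemma gapFun_sq_le_cubic {u : ℝ} (hu : 0 ≤ u) : gapFun (u ^ 2) ^ 2 ≤ 1 / 10 * u ^ 3 := by
  have h0 : 0 ≤ gapFun (u ^ 2) := gapFun_nonneg (sq_nonneg u)
  refine (pow_le_pow_iff_left₀ (sq_nonneg _) (by positivity) two_ne_zero).1 ?_
  unfold gapFun
  set a := √(1 + u ^ 2)
  have ha : 1 ≤ a := Real.one_le_sqrt.2 (by nlinarith)
  have hu2 : u ^ 2 = a ^ 2 - 1 := by rw [Real.sq_sqrt (by positivity)]; ring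
  have e1 : ((1 - 1 / a) ^ 2) ^ 2 = (a - 1) ^ 4 / a ^ 4 := by field_simp
  have e2 : (1 / 10 * u ^ 3) ^ 2 = 1 / 100 * (a ^ 2 - 1) ^ 3 := by rw [← hu2]; ring
  rw [e1, e2, div_le_iff₀ (by positivity)]
  have h : a - 1 ≤ 1 / 100 * (a + 1) ^ 3 * a ^ 4 := by
    generalize a = a at ha
    obtain ⟨t, rfl⟩ : ∃ t, a = 1 + t := ⟨a - 1, by ring⟩
    have ht : 0 ≤ t := by linarith
    have : 1 / 100 * (1 + t + 1) ^ 3 * (1 + t) ^ 4 - t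
        = 1 / 100 * (t^7 + 10*t^6+42*t^5+96*t^4 + 129*t^3 + 102*t^2 + 44 * t + 8) - t := by ring
    nlinarith [mul_nonneg ht (sq_nonneg (t - 2/9)), sq_nonneg (t - 2/9),
      mul_nonneg (mul_nonneg ht ht) (sq_nonneg (t - 2/9)), pow_nonneg ht 5, pow_nonneg ht 6,
      pow_nonneg ht 7]
  have h3 : 0 ≤ (a - 1) ^ 3 := pow_nonneg (by linarith) 3
  calc (a - 1) ^ 4 = (a - 1) ^ 3 * (a - 1) := by ring
    _ ≤ (a - 1) ^ 3 * (1 / 100 * (a + 1) ^ 3 * a ^ 4) := by gcongr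
    _ = _ := by ring

/-- By `le_bigR_sq`, (2/π)² R_δ² is at least (2/π)³/(δ - 2/5), which still exceeds 93/1000 at δ =
31/10. This fixes the threshold between the two regimes. -/
lemma gapFun_le_two_div_pi_mul_bigR {δ u : ℝ} (h2 : 2 ≤ δ) (h3 : δ ≤ 31 / 10) (hu : 0 ≤ u) :
    gapFun (u ^ 2) ≤ 2 / Real.pi * bigR δ * u := by
  have hR := bigR_pos (by linarith : 0 < δ)
  have hpi := Real.pi_pos
  refine (pow_le_pow_iff_left₀ (gapFun_nonneg (sq_nonneg u)) (by positivity) two_ne_zero).1 ?_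
  refine (gapFun_sq_le_linear u).trans ?_
  rw [mul_pow]
  refine mul_le_mul_of_nonneg_right ?_ (sq_nonneg u)
  rw [mul_pow]
  have hp : (6366 / 10000 : ℝ) ≤ 2 / Real.pi := by
    rw [le_div_iff₀ hpi]; have := Real.pi_lt_d6; linarith
  have := le_bigR_sq h2
  calc (93 / 1000 : ℝ) ≤ (6366 / 10000) ^ 2 * (6366 / 10000 / (31 / 10 - 2 / 5)) := by norm_num
    _ ≤ (2 / Real.pi) ^ 2 * (2 / Real.pi / (δ - 2 / 5)) := by
      have : 0 < δ - 2 / 5 := by linarith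
      gcongr
    _ ≤ _ := by gcongr

/-- Arithmetic-geometric inequality: the square of the right side is at least four times the product
of its terms, which is u³/10 for every ε. -/
lemma gapFun_le_mixed {u ε : ℝ} (hε : 0 < ε) (hu : 0 ≤ u) :
    gapFun (u ^ 2) ≤ ε / 2 * u + 1 / (20 * ε) * u ^ 2 := by
  refine (pow_le_pow_iff_left₀ (gapFun_nonneg (sq_nonneg u)) (by positivity) two_ne_zero).1 ?_
  refine (gapFun_sq_le_cubic hu).trans ?_
  have : (ε / 2 * u + 1 / (20 * ε) * u ^ 2) ^ 2
      = (ε / 2 * u - 1 / (20 * ε) * u ^ 2) ^ 2 + 1 / 10 * u ^ 3 := by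
    field_simp; ring
  rw [this]
  nlinarith [sq_nonneg (ε / 2 * u - 1 / (20 * ε) * u ^ 2)]

/-- Used to see that c² decays along a chain, at rate 1/(δ-1), at least as fast as the rate R_δ of
|c|. The inequality fails at δ = 2. -/
lemma one_le_bigR_mul {δ : ℝ} (hδ : 31 / 10 ≤ δ) : 1 ≤ bigR δ * (δ - 1) := by
  have hR := bigR_pos (by linarith : 0 < δ)
  have hp : (6366 / 10000 : ℝ) ≤ 2 / Real.pi := by
    rw [le_div_iff₀ Real.pi_pos]; have := Real.pi_lt_d6; linarith
  refine (pow_le_pow_iff_left₀ zero_le_one (mul_nonneg hR.le (by linarith)) two_ne_zero).1 ?_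
  rw [mul_pow]
  have h0 : 0 < δ - 2 / 5 := by linarith
  have h1 : 6366 / 10000 / (δ - 2 / 5) ≤ bigR δ ^ 2 :=
    le_trans (by gcongr) (le_bigR_sq (by linarith))
  refine le_trans ?_ (mul_le_mul_of_nonneg_right h1 (sq_nonneg _))
  rw [div_mul_eq_mul_div, le_div_iff₀ h0]
  nlinarith

/-- The numerical inequality that makes the quadratic term affordable. It is squared, so that only
R² appears, and `le_bigR_sq` reduces it to polynomials. -/
lemma second_order_bound {δ D : ℝ} (hδ : 31 / 10 ≤ δ) (hD : δ ≤ D) :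
    1 / 10 / ((δ + 3) * (D - 2)) ≤
      (2 / Real.pi) ^ 2 * (δ / (δ + 2)) * bigR δ ^ 3 * bigR (D - 1) := by
  have hR := bigR_pos (by linarith : 0 < δ)
  have hRD := bigR_pos (by linarith : 0 < D - 1)
  have hp : (6366 / 10000 : ℝ) ≤ 2 / Real.pi := by
    rw [le_div_iff₀ Real.pi_pos]; have := Real.pi_lt_d6; linarith
  have hδ0 : 0 < δ := by linarith
  have hD2 : 0 < D - 2 := by linarith
  refine (pow_le_pow_iff_left₀ (by positivity) (by positivity) two_ne_zero).1 ?_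
  have h0 : 0 < δ - 2 / 5 := by linarith
  have h0' : 0 < D - 1 - 2 / 5 := by linarith
  have h1 : 6366 / 10000 / (δ - 2 / 5) ≤ bigR δ ^ 2 :=
    le_trans (by gcongr) (le_bigR_sq (by linarith))
  have h2 : 6366 / 10000 / (D - 1 - 2 / 5) ≤ bigR (D - 1) ^ 2 :=
    le_trans (by gcongr) (le_bigR_sq (by linarith))
  have e : ((2 / Real.pi) ^ 2 * (δ / (δ + 2)) * bigR δ ^ 3 * bigR (D - 1)) ^ 2
      = (2 / Real.pi) ^ 4 * (δ / (δ + 2)) ^ 2 * (bigR δ ^ 2) ^ 3 * bigR (D - 1) ^ 2 := by ring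
  rw [e]
  calc (1 / 10 / ((δ + 3) * (D - 2))) ^ 2 ≤ (6366 / 10000) ^ 4 * (δ / (δ + 2)) ^ 2 *
        (6366 / 10000 / (δ - 2 / 5)) ^ 3 * (6366 / 10000 / (D - 1 - 2 / 5)) := by
        have e1 : (1 / 10 / ((δ + 3) * (D - 2))) ^ 2 = 1 / 100 / ((δ + 3) ^ 2 * (D - 2) ^ 2) := by
          field_simp; norm_num
        have e2 : (6366 / 10000 : ℝ) ^ 4 * (δ / (δ + 2)) ^ 2 *
            (6366 / 10000 / (δ - 2 / 5)) ^ 3 * (6366 / 10000 / (D - 1 - 2 / 5))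
            = (6366 / 10000) ^ 8 * δ ^ 2 / ((δ + 2) ^ 2 * (δ - 2 / 5) ^ 3 * (D - 1 - 2 / 5)) := by
          field_simp
        rw [e1, e2, div_le_div_iff₀ (by positivity) (by positivity)]
        -- The quotient (D - 7/5)/(D - 2)² decreases in D, so the worst case is D = δ, which `m2`
        -- settles.
        have m1 : (δ - 2) ^ 2 * (D - 1 - 2 / 5) ≤ (δ - 1 - 2 / 5) * (D - 2) ^ 2 := by
          have h := mul_nonneg (mul_nonneg (by linarith : 0 ≤ δ - 2) hD2.le)
            (by linarith : 0 ≤ D - δ)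
          nlinarith [mul_nonneg (by linarith : 0 ≤ D - δ) (by linarith : 0 ≤ D + δ - 4)]
        have m2 : (δ + 2) ^ 2 * (δ - 2 / 5) ^ 3 * (δ - 1 - 2 / 5)
            ≤ 100 * (6366 / 10000) ^ 8 * δ ^ 2 * (δ + 3) ^ 2 * (δ - 2) ^ 2 := by
          obtain ⟨t, rfl⟩ : ∃ t, δ = 31 / 10 + t := ⟨δ - 31 / 10, by ring⟩
          have ht : 0 ≤ t := by linarith
          have := pow_nonneg ht 2
          have := pow_nonneg ht 3
          have := pow_nonneg ht 4
          have := pow_nonneg ht 5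
          have := pow_nonneg ht 6
          ring_nf
          nlinarith
        have hq : 0 < (δ - 2) ^ 2 := by have : 0 < δ - 2 := by linarith
                                        positivity
        refine le_of_mul_le_mul_right ?_ hq
        calc 1 / 100 * ((δ + 2) ^ 2 * (δ - 2 / 5) ^ 3 * (D - 1 - 2 / 5)) * (δ - 2) ^ 2
            = 1 / 100 * ((δ + 2) ^ 2 * (δ - 2 / 5) ^ 3) * ((δ - 2) ^ 2 * (D - 1 - 2 / 5)) := by ring
          _ ≤ 1 / 100 * ((δ + 2) ^ 2 * (δ - 2 / 5) ^ 3) * ((δ - 1 - 2 / 5) * (D - 2) ^ 2) := by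
            gcongr
          _ = 1 / 100 * ((δ + 2) ^ 2 * (δ - 2 / 5) ^ 3 * (δ - 1 - 2 / 5)) * (D - 2) ^ 2 := by ring
          _ ≤ 1 / 100 * (100 * (6366 / 10000) ^ 8 * δ ^ 2 * (δ + 3) ^ 2 * (δ - 2) ^ 2)
                * (D - 2) ^ 2 := by gcongr
          _ = _ := by ring
    _ ≤ _ := by gcongr

/-! ### Gaussian and Student integrals -/

lemma chiMoment_neg_one {k : ℝ} (hk : 1 < k) : chiMoment (-1) k = √(Real.pi / 2) * bigR (k - 1) := by
  have h1 := (Real.Gamma_pos_of_pos (half_pos (by linarith : 0 < k))).ne'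
  unfold chiMoment bigR
  rw [← sub_eq_add_neg, show k - 1 + 1 = k by ring, Real.sqrt_div Real.pi_pos.le,
    show (-1 : ℝ) / 2 = -(1 / 2) by ring, Real.rpow_neg two_pos.le, ← Real.sqrt_eq_rpow]
  have : √Real.pi ≠ 0 := by positivity
  field_simp

lemma chiMoment_neg_two {k : ℝ} (hk : 2 < k) : chiMoment (-2) k = 1 / (k - 2) := by
  have h1 := (Real.Gamma_pos_of_pos (half_pos (by linarith : 0 < k - 2))).ne'
  have h2 := Gamma_add_two_div_two (by linarith : 0 < k - 2)
  rw [sub_add_cancel] at h2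
  have h3 : k - 2 ≠ 0 := by linarith
  unfold chiMoment
  rw [h2, ← sub_eq_add_neg, show (-2 : ℝ) / 2 = -1 by norm_num, Real.rpow_neg_one]
  field_simp

/-- The absolute value of a standard normal variable has the chi law with one degree of freedom. -/
lemma lintegral_abs_gaussianReal {f : ℝ → ℝ≥0∞} (hf : Measurable f) :
    ∫⁻ n, f |n| ∂gaussianReal 0 1 = ∫⁻ z, f z ∂chiLaw 1 := by
  rw [lintegral_gaussianReal one_ne_zero (by fun_prop : Measurable fun n => f |n|),
    lintegral_chiLaw one_pos hf]
  set h : ℝ → ℝ≥0∞ := fun x => gaussianPDF 0 1 x * f |x| with hh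
  have hneg : ∀ x, h (-x) = h x := by
    intro x; simp [hh, gaussianPDF, gaussianPDFReal]
  have hm : Measurable h := by
    have := measurable_gaussianPDF 0 1
    fun_prop
  have e1 : ∫⁻ x, h x = ∫⁻ x in Set.Ioi 0, 2 * h x := by
    rw [← lintegral_add_compl _ (measurableSet_Ioi (a := (0 : ℝ))), Set.compl_Ioi,
      setLIntegral_congr Iio_ae_eq_Iic.symm, lintegral_const_mul _ hm, two_mul]
    congr 1
    rw [← lintegral_indicator measurableSet_Iio, ← lintegral_indicator measurableSet_Ioi,
      ← lintegral_neg_eq_self]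
    refine lintegral_congr fun x => ?_
    by_cases hx : 0 < x
    · rw [Set.indicator_of_mem (by simpa using hx), Set.indicator_of_mem (by simpa using hx), hneg]
    · rw [Set.indicator_of_notMem (by simpa using hx), Set.indicator_of_notMem (by simpa using hx)]
  rw [e1, ← lintegral_indicator measurableSet_Ioi]
  refine lintegral_congr fun x => ?_
  by_cases hx : 0 < x
  · rw [Set.indicator_of_mem (by simpa using hx), hh]
    simp only
    rw [abs_of_pos hx, ← mul_assoc]
    congr 1
    rw [gaussianPDF, show (2 : ℝ≥0∞) = ENNReal.ofReal 2 by simp, ← ENNReal.ofReal_mul two_pos.le]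
    congr 1
    rw [chiPDF, if_pos hx, gaussianPDFReal, Real.Gamma_one_half_eq]
    have e3 : (2 : ℝ) ^ (1 - 1 / 2 : ℝ) = √2 := by rw [Real.sqrt_eq_rpow]; norm_num
    rw [e3, sub_self, Real.rpow_zero]
    have p6 : √(2 * Real.pi * ((1 : NNReal) : ℝ)) = √2 * √Real.pi := by
      rw [← Real.sqrt_mul two_pos.le]; simp
    rw [p6]
    have : √Real.pi ≠ 0 := by positivity
    simp only [sub_zero, NNReal.coe_one, mul_one]
    have h2 : √2 * √2 = (2 : ℝ) := Real.mul_self_sqrt two_pos.le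
    field_simp
    rw [sq, h2]
  · rw [Set.indicator_of_notMem (by simpa using hx)]
    simp [chiPDF, hx]

lemma lintegral_abs_gaussianReal_one :
    ∫⁻ n, ENNReal.ofReal |n| ∂gaussianReal 0 1 = ENNReal.ofReal √(2 / Real.pi) := by
  rw [lintegral_abs_gaussianReal (f := fun x => ENNReal.ofReal x) (by fun_prop)]
  have := lintegral_chiLaw_rpow (a := 1) (k := 1) one_pos (by norm_num)
  simp only [Real.rpow_one] at this
  rw [this]
  congr 1
  rw [chiMoment, Real.Gamma_one_half_eq, show ((1 : ℝ) + 1) / 2 = 1 by norm_num, Real.Gamma_one,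
    Real.sqrt_div two_pos.le, Real.sqrt_eq_rpow 2, mul_one]

lemma lintegral_sq_gaussianReal_one :
    ∫⁻ n, ENNReal.ofReal (n ^ 2) ∂gaussianReal 0 1 = 1 := by
  have h := lintegral_abs_gaussianReal (f := fun x => ENNReal.ofReal (x ^ 2)) (by fun_prop)
  simp only [sq_abs] at h
  rw [h]
  have := lintegral_chiLaw_rpow (a := 2) (k := 1) one_pos (by norm_num)
  simp only [Real.rpow_two] at this
  rw [this, chiMoment, Gamma_add_two_div_two one_pos]
  have h1 := (Real.Gamma_pos_of_pos (one_half_pos (α := ℝ))).ne'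
  rw [div_self two_ne_zero, Real.rpow_one, ← ENNReal.ofReal_one]
  congr 1
  field_simp

/-- Tilting a standard normal law by a Gaussian factor rescales it. -/
lemma lintegral_exp_mul_gaussianReal {v : ℝ} (hv : 0 ≤ v) {f : ℝ → ℝ≥0∞} (hf : Measurable f) :
    ∫⁻ n, ENNReal.ofReal (Real.exp (-(v * n ^ 2) / 2)) * f n ∂gaussianReal 0 1 =
      ENNReal.ofReal (1 / √(1 + v)) * ∫⁻ n, f (n / √(1 + v)) ∂gaussianReal 0 1 := by
  have mg := measurable_gaussianPDF 0 1
  have ha : 0 < √(1 + v) := by positivity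
  rw [lintegral_gaussianReal one_ne_zero (by fun_prop),
    lintegral_gaussianReal one_ne_zero (by fun_prop), ← lintegral_const_mul _ (by fun_prop),
    lintegral_eq_lintegral_mul_left (f := fun n => gaussianPDF 0 1 n *
      (ENNReal.ofReal (Real.exp (-(v * n ^ 2) / 2)) * f n)) (inv_pos.2 ha) (by fun_prop)]
  refine lintegral_congr fun n => ?_
  rw [show (√(1 + v))⁻¹ * n = n / √(1 + v) by ring, one_div]
  simp only [← mul_assoc]
  congr 1
  rw [mul_assoc]
  congr 1
  rw [gaussianPDF, gaussianPDF, ← ENNReal.ofReal_mul (gaussianPDFReal_nonneg _ _ _)]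
  congr 1
  rw [gaussianPDFReal, gaussianPDFReal, mul_assoc, ← Real.exp_add]
  congr 2
  simp only [sub_zero, NNReal.coe_one, mul_one]
  rw [div_pow, Real.sq_sqrt (by positivity)]
  field_simp
  ring

lemma lintegral_exp_gaussianReal {v : ℝ} (hv : 0 ≤ v) :
    ∫⁻ n, ENNReal.ofReal (Real.exp (-(v * n ^ 2) / 2)) ∂gaussianReal 0 1 =
      ENNReal.ofReal (1 / √(1 + v)) := by
  simpa using lintegral_exp_mul_gaussianReal hv (f := 1) measurable_const

lemma studentPDF_eq (k t : ℝ) :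
    studentPDF k t = 1 / (Real.pi * bigR k) * (1 + t ^ 2) ^ (-(k + 1) / 2) := by
  unfold studentPDF bigR
  congr 1
  have h3 : √Real.pi * √Real.pi = Real.pi := Real.mul_self_sqrt Real.pi_pos.le
  have : √Real.pi ≠ 0 := by positivity
  have := Real.pi_ne_zero
  field_simp
  rw [sq, h3]

/-- Powers of 1 + t² only shift the degrees of freedom. Below, Gaussian integration over the start
of a chain produces such a factor with m = 1, 2 or 3. -/
lemma studentPDF_mul_rpow {k m : ℝ} (hkm : 0 < k + m) (t : ℝ) :
    studentPDF k t * (1 + t ^ 2) ^ (-m / 2) = bigR (k + m) / bigR k * studentPDF (k + m) t := by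
  rw [studentPDF_eq, studentPDF_eq, show -(k + m + 1) / 2 = -(k + 1) / 2 + -m / 2 by ring,
    Real.rpow_add (by positivity)]
  have := (bigR_pos hkm).ne'
  field_simp

lemma lintegral_studentPDF_abs {k : ℝ} (hk : 1 < k) :
    ∫⁻ t, ENNReal.ofReal (studentPDF k t) * ENNReal.ofReal |t| = ENNReal.ofReal (bigR (k - 1)) := by
  have hk0 : 0 < k := by linarith
  rw [← lintegral_div_chiLaw hk0 (f := fun t => ENNReal.ofReal |t|) (by fun_prop)]
  have e : ∫⁻ z, ∫⁻ n, ENNReal.ofReal |n / z| ∂gaussianReal 0 1 ∂chiLaw k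
      = ∫⁻ z, ENNReal.ofReal (z ^ (-1 : ℝ)) * ENNReal.ofReal √(2 / Real.pi) ∂chiLaw k := by
    refine lintegral_congr_ae ((ae_pos_chiLaw hk0).mono fun z hz => ?_)
    simp only
    rw [← lintegral_abs_gaussianReal_one, ← lintegral_const_mul _ (by fun_prop)]
    refine lintegral_congr fun n => ?_
    rw [← ENNReal.ofReal_mul (by positivity), abs_div, abs_of_pos hz, Real.rpow_neg_one]
    congr 1; ring
  rw [e, lintegral_mul_const _ (by fun_prop), lintegral_chiLaw_rpow hk0 (by linarith),
    chiMoment_neg_one hk, ← ENNReal.ofReal_mul (mul_nonneg (by positivity)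
      (bigR_pos (by linarith)).le)]
  congr 1
  rw [mul_right_comm, ← Real.sqrt_mul (by positivity)]
  have : Real.pi / 2 * (2 / Real.pi) = 1 := by have := Real.pi_ne_zero; field_simp
  rw [this, Real.sqrt_one, one_mul]

lemma lintegral_studentPDF_sq {k : ℝ} (hk : 2 < k) :
    ∫⁻ t, ENNReal.ofReal (studentPDF k t) * ENNReal.ofReal (t ^ 2) =
      ENNReal.ofReal (1 / (k - 2)) := by
  have hk0 : 0 < k := by linarith
  rw [← lintegral_div_chiLaw hk0 (f := fun t => ENNReal.ofReal (t ^ 2)) (by fun_prop)]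
  have e : ∫⁻ z, ∫⁻ n, ENNReal.ofReal ((n / z) ^ 2) ∂gaussianReal 0 1 ∂chiLaw k
      = ∫⁻ z, ENNReal.ofReal (z ^ (-2 : ℝ)) ∂chiLaw k := by
    refine lintegral_congr_ae ((ae_pos_chiLaw hk0).mono fun z hz => ?_)
    simp only
    rw [← mul_one (ENNReal.ofReal (z ^ (-2 : ℝ))), ← lintegral_sq_gaussianReal_one,
      ← lintegral_const_mul _ (by fun_prop)]
    refine lintegral_congr fun n => ?_
    rw [← ENNReal.ofReal_mul (by positivity), Real.rpow_neg hz.le, Real.rpow_two]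
    congr 1; ring
  rw [e, lintegral_chiLaw_rpow hk0 (by linarith), chiMoment_neg_two hk]

/-! ### The transition operator along a path -/

/-- `f ↦ E[exp (-(c t) ^ 2 / 2) f (-(c t))]`, where `t` is the quotient of a standard normal variable
and an independent variable of law `chiLaw (δ + 1)`. -/
def stepOp (δ : ℝ) (f : ℝ → ℝ≥0∞) (c : ℝ) : ℝ≥0∞ :=
  ∫⁻ t, ENNReal.ofReal (studentPDF (δ + 1) t) *
    (ENNReal.ofReal (Real.exp (-(c * t) ^ 2 / 2)) * f (-(c * t)))

/-- A fixed point of `stepOp`. -/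
def stepFix (δ c : ℝ) : ℝ≥0∞ :=
  ∫⁻ y, ENNReal.ofReal (studentPDF δ y) * ENNReal.ofReal (Real.exp (-(c * y) ^ 2 / 2))

@[fun_prop]
lemma measurable_stepOp {δ : ℝ} {f : ℝ → ℝ≥0∞} (hf : Measurable f) : Measurable (stepOp δ f) := by
  refine Measurable.lintegral_prod_right' (f := fun x : ℝ × ℝ => ENNReal.ofReal
    (studentPDF (δ + 1) x.2) * (ENNReal.ofReal (Real.exp (-(x.1 * x.2) ^ 2 / 2)) *
    f (-(x.1 * x.2)))) ?_
  fun_prop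

lemma stepOp_mono {δ : ℝ} {f g : ℝ → ℝ≥0∞} (h : ∀ c, f c ≤ g c) (c : ℝ) :
    stepOp δ f c ≤ stepOp δ g c := by
  refine lintegral_mono fun t => ?_
  gcongr
  exact h _

lemma lintegral_step {δ : ℝ} (hδ : 0 < δ) {f : ℝ → ℝ≥0∞} (hf : Measurable f) (c : ℝ) :
    ∫⁻ w, ∫⁻ n, ENNReal.ofReal (Real.exp (-(-(n * c) / w) ^ 2 / 2)) * f (-(n * c) / w)
      ∂gaussianReal 0 1 ∂chiLaw (δ + 1) = stepOp δ f c := by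
  have e : ∀ w n : ℝ, -(n * c) / w = -(c * (n / w)) := fun w n => by ring
  simp only [e]
  rw [lintegral_div_chiLaw (by linarith : 0 < δ + 1) (f := fun t => ENNReal.ofReal
    (Real.exp (-(-(c * t)) ^ 2 / 2)) * f (-(c * t))) (by fun_prop)]
  simp only [neg_sq]
  rfl

lemma stepFix_le_one {δ : ℝ} (hδ : 0 < δ) (c : ℝ) : stepFix δ c ≤ 1 := by
  rw [← lintegral_studentPDF hδ]
  refine lintegral_mono fun y => mul_le_of_le_one_right' ?_
  rw [ENNReal.ofReal_le_one, Real.exp_le_one_iff]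
  nlinarith [sq_nonneg (c * y)]

lemma stepFix_neg (δ c : ℝ) : stepFix δ (-c) = stepFix δ c := by
  simp [stepFix]

/-- If t and y are independent Student variables with parameters δ+1 and δ, then t√(1+y²) is again
Student with parameter δ. The substitution y = √(1+x²) u factors the integrand into the density at x
times a Student density in u. -/
lemma lintegral_student_convolution {δ : ℝ} (hδ : 0 < δ) (x : ℝ) :
    ∫⁻ y, ENNReal.ofReal (√(1 + y ^ 2))⁻¹ * (ENNReal.ofReal (studentPDF δ y) *
      ENNReal.ofReal (studentPDF (δ + 1) (x / √(1 + y ^ 2)))) = ENNReal.ofReal (studentPDF δ x) := by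
  have hb : 0 < √(1 + x ^ 2) := by positivity
  have hδ1 : 0 < δ + 1 := by linarith
  rw [lintegral_eq_lintegral_mul_left (f := fun y => ENNReal.ofReal (√(1 + y ^ 2))⁻¹ *
    (ENNReal.ofReal (studentPDF δ y) * ENNReal.ofReal (studentPDF (δ + 1) (x / √(1 + y ^ 2)))))
    hb (by fun_prop), ← mul_one (ENNReal.ofReal (studentPDF δ x)), ← lintegral_studentPDF hδ1,
    ← lintegral_const_mul _ (by fun_prop)]
  refine lintegral_congr fun u => ?_
  set b := √(1 + x ^ 2) with hbdef
  have hb2 : b ^ 2 = 1 + x ^ 2 := Real.sq_sqrt (by positivity)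
  set a := √(1 + (b * u) ^ 2) with hadef
  have ha2 : a ^ 2 = 1 + (b * u) ^ 2 := Real.sq_sqrt (by positivity)
  have ha : 0 < a := by positivity
  have n1 := studentPDF_nonneg hδ (b * u)
  have n2 := studentPDF_nonneg hδ1 (x / a)
  rw [← ENNReal.ofReal_mul n1, ← ENNReal.ofReal_mul (by positivity),
    ← ENNReal.ofReal_mul (by positivity), ← ENNReal.ofReal_mul (studentPDF_nonneg hδ x)]
  congr 1
  unfold studentPDF
  rw [← hb2, ← ha2]
  have key : 1 + (x / a) ^ 2 = b ^ 2 * (1 + u ^ 2) / a ^ 2 := by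
    have : x ^ 2 = b ^ 2 - 1 := by linarith
    field_simp
    rw [ha2, this]; ring
  have p : ∀ (y : ℝ) (r : ℝ), 0 < y → (y ^ 2) ^ (r / 2) = y ^ r := by
    intro y r hy
    rw [← Real.rpow_natCast, ← Real.rpow_mul hy.le]; congr 1; push_cast; ring
  rw [key, Real.div_rpow (by positivity) (by positivity),
    Real.mul_rpow (by positivity) (by positivity), p _ _ ha, p _ _ ha, p _ _ hb, p _ _ hb]
  have q1 : a ^ (-(δ + 1 + 1)) = a ^ (-(δ + 1)) * a⁻¹ := by
    rw [← Real.rpow_neg_one, ← Real.rpow_add ha]; congr 1; ring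
  have q2 : b ^ (-(δ + 1 + 1)) = b ^ (-(δ + 1)) * b⁻¹ := by
    rw [← Real.rpow_neg_one, ← Real.rpow_add hb]; congr 1; ring
  rw [q1, q2]
  have : a ^ (-(δ + 1)) ≠ 0 := by positivity
  field_simp

/-- The exponents of the two layers add up, (ct)² + (cty)² = (c t√(1+y²))², and t√(1+y²) has the
same law as y. -/
lemma stepOp_stepFix {δ : ℝ} (hδ : 0 < δ) (c : ℝ) : stepOp δ (stepFix δ) c = stepFix δ c := by
  have hδ1 : 0 < δ + 1 := by linarith
  have e1 : stepOp δ (stepFix δ) c = ∫⁻ t, ∫⁻ y, ENNReal.ofReal (studentPDF δ y) *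
      (ENNReal.ofReal (studentPDF (δ + 1) t) *
        ENNReal.ofReal (Real.exp (-(c * (t * √(1 + y ^ 2))) ^ 2 / 2))) := by
    refine lintegral_congr fun t => ?_
    rw [stepFix_neg, stepFix, ← lintegral_const_mul _ (by fun_prop),
      ← lintegral_const_mul _ (by fun_prop)]
    refine lintegral_congr fun y => ?_
    have : Real.exp (-(c * (t * √(1 + y ^ 2))) ^ 2 / 2)
        = Real.exp (-(c * t) ^ 2 / 2) * Real.exp (-(c * t * y) ^ 2 / 2) := by
      rw [← Real.exp_add]; congr 1
      rw [mul_pow, mul_pow, Real.sq_sqrt (by positivity)]; ring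
    rw [this, ENNReal.ofReal_mul (Real.exp_pos _).le]
    ring
  have e2 : ∀ y, ∫⁻ t, ENNReal.ofReal (studentPDF δ y) * (ENNReal.ofReal (studentPDF (δ + 1) t) *
        ENNReal.ofReal (Real.exp (-(c * (t * √(1 + y ^ 2))) ^ 2 / 2)))
      = ∫⁻ x, ENNReal.ofReal (Real.exp (-(c * x) ^ 2 / 2)) * (ENNReal.ofReal (√(1 + y ^ 2))⁻¹ *
        (ENNReal.ofReal (studentPDF δ y) *
          ENNReal.ofReal (studentPDF (δ + 1) (x / √(1 + y ^ 2))))) := by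
    intro y
    have ha : 0 < √(1 + y ^ 2) := by positivity
    rw [lintegral_eq_lintegral_mul_left (f := fun t => ENNReal.ofReal (studentPDF δ y) *
      (ENNReal.ofReal (studentPDF (δ + 1) t) *
        ENNReal.ofReal (Real.exp (-(c * (t * √(1 + y ^ 2))) ^ 2 / 2)))) (inv_pos.2 ha)
      (by fun_prop)]
    refine lintegral_congr fun x => ?_
    rw [show (√(1 + y ^ 2))⁻¹ * x * √(1 + y ^ 2) = x by field_simp,
      show (√(1 + y ^ 2))⁻¹ * x = x / √(1 + y ^ 2) by ring]
    ring
  rw [e1, lintegral_lintegral_swap, lintegral_congr e2, lintegral_lintegral_swap]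
  · refine lintegral_congr fun x => ?_
    rw [lintegral_const_mul _ (by fun_prop), lintegral_student_convolution hδ x]
    ring
  · unfold Function.uncurry; fun_prop
  · unfold Function.uncurry; fun_prop

/-- The exponential factor is dropped, and E|t| = R_δ for the Student law with parameter δ+1. -/
lemma stepOp_abs_le {δ : ℝ} (hδ : 0 < δ) (c : ℝ) :
    stepOp δ (fun c => ENNReal.ofReal |c|) c ≤ ENNReal.ofReal (bigR δ) * ENNReal.ofReal |c| := by
  have h := lintegral_studentPDF_abs (by linarith : 1 < δ + 1)
  rw [add_sub_cancel_right] at h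
  rw [← h, ← lintegral_mul_const _ (by fun_prop)]
  refine lintegral_mono fun t => ?_
  simp only
  rw [abs_neg, abs_mul, mul_comm |c|, ENNReal.ofReal_mul (abs_nonneg _), mul_assoc]
  have : ENNReal.ofReal (Real.exp (-(c * t) ^ 2 / 2)) ≤ 1 := by
    rw [ENNReal.ofReal_le_one, Real.exp_le_one_iff]
    nlinarith [sq_nonneg (c * t)]
  exact mul_le_mul_right (by simpa using mul_le_mul_left this _) _

lemma stepOp_sq_le {δ : ℝ} (hδ : 1 < δ) (c : ℝ) :
    stepOp δ (fun c => ENNReal.ofReal (c ^ 2)) c ≤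
      ENNReal.ofReal (1 / (δ - 1)) * ENNReal.ofReal (c ^ 2) := by
  have h := lintegral_studentPDF_sq (by linarith : 2 < δ + 1)
  rw [show δ + 1 - 2 = δ - 1 by ring] at h
  rw [← h, ← lintegral_mul_const _ (by fun_prop)]
  refine lintegral_mono fun t => ?_
  simp only
  have : ENNReal.ofReal (Real.exp (-(c * t) ^ 2 / 2)) ≤ 1 := by
    rw [ENNReal.ofReal_le_one, Real.exp_le_one_iff]
    nlinarith [sq_nonneg (c * t)]
  rw [neg_sq, mul_pow c t, mul_comm (c ^ 2), ENNReal.ofReal_mul (sq_nonneg _), mul_assoc,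
    ← mul_pow, mul_comm t c]
  exact mul_le_mul_right (by simpa using mul_le_mul_left this _) _

/-- Integrating the Gaussian first leaves (1+y²)^(-1/2) against the Student density, that is
R_{δ+1}/R_δ. -/
lemma lintegral_stepFix {δ : ℝ} (hδ : 0 < δ) :
    ∫⁻ n, stepFix δ n ∂gaussianReal 0 1 = ENNReal.ofReal (smallR δ) := by
  unfold stepFix
  rw [lintegral_lintegral_swap (by unfold Function.uncurry; fun_prop)]
  have hδ1 : 0 < δ + 1 := by linarith
  have e : ∀ y, ∫⁻ n, ENNReal.ofReal (studentPDF δ y) *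
      ENNReal.ofReal (Real.exp (-(n * y) ^ 2 / 2)) ∂gaussianReal 0 1
      = ENNReal.ofReal (bigR (δ + 1) / bigR δ) * ENNReal.ofReal (studentPDF (δ + 1) y) := by
    intro y
    rw [lintegral_const_mul _ (by fun_prop)]
    have : ∀ n : ℝ, -(n * y) ^ 2 / 2 = -(y ^ 2 * n ^ 2) / 2 := fun n => by ring
    simp only [this]
    rw [lintegral_exp_gaussianReal (sq_nonneg y), ← ENNReal.ofReal_mul (studentPDF_nonneg hδ y),
      ← ENNReal.ofReal_mul (div_pos (bigR_pos hδ1) (bigR_pos hδ)).le, ← studentPDF_mul_rpow hδ1,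
      Real.sqrt_eq_rpow, one_div, ← Real.rpow_neg (by positivity)]
    congr 3; ring
  rw [lintegral_congr e, lintegral_const_mul _ (by fun_prop), lintegral_studentPDF hδ1, mul_one,
    smallR_eq hδ]

/-- Here the exponential is kept. It rescales the Gaussian start by 1/√(1+t²), which gives a factor
1/(1+t²) and two more degrees of freedom. The gain over the crude bound R_δ is
R_{δ+3}R_{δ+2}/(R_{δ+1}R_δ) = δ/(δ+2), the factor in B. -/
lemma lintegral_stepOp_abs {δ : ℝ} (hδ : 0 < δ) :
    ∫⁻ n, stepOp δ (fun c => ENNReal.ofReal |c|) n ∂gaussianReal 0 1 =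
      ENNReal.ofReal (√(2 / Real.pi) * (δ / (δ + 2) * bigR δ)) := by
  unfold stepOp
  rw [lintegral_lintegral_swap (by unfold Function.uncurry; fun_prop)]
  have h1 : 0 < δ + 1 := by linarith
  have h3 : 0 < δ + 1 + 2 := by linarith
  have e : ∀ t, ∫⁻ n, ENNReal.ofReal (studentPDF (δ + 1) t) *
      (ENNReal.ofReal (Real.exp (-(n * t) ^ 2 / 2)) * ENNReal.ofReal |-(n * t)|) ∂gaussianReal 0 1
      = ENNReal.ofReal (√(2 / Real.pi) * (bigR (δ + 1 + 2) / bigR (δ + 1))) *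
        (ENNReal.ofReal (studentPDF (δ + 1 + 2) t) * ENNReal.ofReal |t|) := by
    intro t
    rw [lintegral_const_mul _ (by fun_prop)]
    have : ∀ n : ℝ, -(n * t) ^ 2 / 2 = -(t ^ 2 * n ^ 2) / 2 := fun n => by ring
    simp only [this]
    rw [lintegral_exp_mul_gaussianReal (sq_nonneg t) (f := fun n => ENNReal.ofReal |-(n * t)|)
      (by fun_prop)]
    have : ∀ n : ℝ, ENNReal.ofReal |-(n / √(1 + t ^ 2) * t)|
        = ENNReal.ofReal (|t| / √(1 + t ^ 2)) * ENNReal.ofReal |n| := by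
      intro n
      rw [← ENNReal.ofReal_mul (by positivity), abs_neg, abs_mul, abs_div,
        abs_of_pos (by positivity : 0 < √(1 + t ^ 2))]
      congr 1; ring
    simp only [this]
    rw [lintegral_const_mul _ (by fun_prop), lintegral_abs_gaussianReal_one,
      ← ENNReal.ofReal_mul (by positivity), ← ENNReal.ofReal_mul (by positivity),
      ← ENNReal.ofReal_mul (studentPDF_nonneg h1 t),
      ← ENNReal.ofReal_mul (studentPDF_nonneg h3 t),
      ← ENNReal.ofReal_mul (mul_pos (by positivity) (div_pos (bigR_pos h3) (bigR_pos h1))).le]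
    congr 1
    have h := studentPDF_mul_rpow h3 t
    rw [show (-2 : ℝ) / 2 = -1 by norm_num, Real.rpow_neg_one] at h
    have h2 : 1 / √(1 + t ^ 2) * (|t| / √(1 + t ^ 2) * √(2 / Real.pi))
        = (1 + t ^ 2)⁻¹ * (|t| * √(2 / Real.pi)) := by
      rw [← Real.sq_sqrt (by positivity : 0 ≤ 1 + t ^ 2), Real.sqrt_sq (Real.sqrt_nonneg _)]
      field_simp
    rw [h2, ← mul_assoc, h]; ring
  rw [lintegral_congr e, lintegral_const_mul _ (by fun_prop),
    lintegral_studentPDF_abs (by linarith), ← ENNReal.ofReal_mul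
      (mul_pos (by positivity) (div_pos (bigR_pos h3) (bigR_pos h1))).le]
  congr 1
  rw [show δ + 1 + 2 - 1 = δ + 2 by ring, bigR_add_two hδ, bigR_add_two h1]
  have := (bigR_pos h1).ne'
  field_simp
  ring

/-- The same computation with the square; one more factor 1/√(1+t²) now shifts the degrees of
freedom by three. -/
lemma lintegral_stepOp_sq {δ : ℝ} (hδ : 0 < δ) :
    ∫⁻ n, stepOp δ (fun c => ENNReal.ofReal (c ^ 2)) n ∂gaussianReal 0 1 =
      ENNReal.ofReal (smallR (δ + 1) / (δ + 3)) := by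
  unfold stepOp
  rw [lintegral_lintegral_swap (by unfold Function.uncurry; fun_prop)]
  have h1 : 0 < δ + 1 := by linarith
  have h3 : 0 < δ + 1 + 3 := by linarith
  have e : ∀ t, ∫⁻ n, ENNReal.ofReal (studentPDF (δ + 1) t) *
      (ENNReal.ofReal (Real.exp (-(n * t) ^ 2 / 2)) * ENNReal.ofReal ((-(n * t)) ^ 2))
        ∂gaussianReal 0 1
      = ENNReal.ofReal (bigR (δ + 1 + 3) / bigR (δ + 1)) *
        (ENNReal.ofReal (studentPDF (δ + 1 + 3) t) * ENNReal.ofReal (t ^ 2)) := by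
    intro t
    rw [lintegral_const_mul _ (by fun_prop)]
    have : ∀ n : ℝ, -(n * t) ^ 2 / 2 = -(t ^ 2 * n ^ 2) / 2 := fun n => by ring
    simp only [this]
    rw [lintegral_exp_mul_gaussianReal (sq_nonneg t) (f := fun n => ENNReal.ofReal ((-(n * t)) ^ 2))
      (by fun_prop)]
    have : ∀ n : ℝ, ENNReal.ofReal ((-(n / √(1 + t ^ 2) * t)) ^ 2)
        = ENNReal.ofReal (t ^ 2 / √(1 + t ^ 2) ^ 2) * ENNReal.ofReal (n ^ 2) := by
      intro n
      rw [← ENNReal.ofReal_mul (by positivity)]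
      congr 1; ring
    simp only [this]
    rw [lintegral_const_mul _ (by fun_prop), lintegral_sq_gaussianReal_one, mul_one,
      ← ENNReal.ofReal_mul (by positivity), ← ENNReal.ofReal_mul (studentPDF_nonneg h1 t),
      ← ENNReal.ofReal_mul (studentPDF_nonneg h3 t),
      ← ENNReal.ofReal_mul (div_pos (bigR_pos h3) (bigR_pos h1)).le,
      ← mul_assoc (bigR (δ + 1 + 3) / bigR (δ + 1)), ← studentPDF_mul_rpow h3, mul_assoc]
    congr 2
    have : (1 + t ^ 2) ^ ((-3 : ℝ) / 2) = (√(1 + t ^ 2))⁻¹ * (√(1 + t ^ 2) ^ 2)⁻¹ := by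
      rw [Real.sq_sqrt (by positivity), Real.sqrt_eq_rpow, ← Real.rpow_neg (by positivity),
        ← Real.rpow_neg_one, ← Real.rpow_add (by positivity)]
      norm_num
    rw [this]; ring
  rw [lintegral_congr e, lintegral_const_mul _ (by fun_prop),
    lintegral_studentPDF_sq (by linarith), ← ENNReal.ofReal_mul
      (div_pos (bigR_pos h3) (bigR_pos h1)).le]
  congr 1
  rw [show δ + 1 + 3 = δ + 2 + 2 by ring, bigR_add_two (by linarith), smallR_eq h1,
    show δ + 1 + 1 = δ + 2 by ring]
  have := (bigR_pos h1).ne'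
  have : δ + 2 + 2 - 2 ≠ 0 := by linarith
  field_simp
  ring

/-! ### Functions of disjoint sets of coordinates -/

section Product

variable {ι : Type*} [Fintype ι] {ν : ι → Measure ℝ} [∀ i, IsProbabilityMeasure (ν i)]

lemma exists_measurable_comp_restrict {α : Type*} [MeasurableSpace α] {f : (ι → ℝ) → α}
    {s : Finset ι} (hf : Measurable f) (hs : DependsOn f s) :
    ∃ g : (s → ℝ) → α, Measurable g ∧ ∀ x, f x = g fun i => x i := by
  -- Coordinates outside s are filled with 0, a value that f does not see.
  refine ⟨fun y => f fun i => if h : i ∈ s then y ⟨i, h⟩ else 0, hf.comp ?_, fun x => hs ?_⟩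
  · refine measurable_pi_lambda _ fun i => ?_
    split_ifs with h
    · exact measurable_pi_apply _
    · exact measurable_const
  · intro i hi
    have : i ∈ s := hi
    simp [this]

lemma indepFun_of_dependsOn {α β : Type*} [MeasurableSpace α] [MeasurableSpace β]
    {f : (ι → ℝ) → α} {g : (ι → ℝ) → β} (hf : Measurable f) (hg : Measurable g) {s t : Set ι}
    (hfs : DependsOn f s) (hgt : DependsOn g t) (hst : Disjoint s t) :
    IndepFun f g (Measure.pi ν) := by
  have hi : iIndepFun (fun i (x : ι → ℝ) => x i) (Measure.pi ν) :=
    iIndepFun_pi (X := fun _ x => x) fun i => aemeasurable_id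
  have h := hi.indepFun_finset s.toFinset t.toFinset (by simpa using hst)
    fun i => measurable_pi_apply i
  obtain ⟨f', hf', ef⟩ := exists_measurable_comp_restrict (s := s.toFinset) hf (by simpa using hfs)
  obtain ⟨g', hg', eg⟩ := exists_measurable_comp_restrict (s := t.toFinset) hg (by simpa using hgt)
  have := h.comp hf' hg'
  convert this using 1
  · ext x; exact ef x
  · ext x; exact eg x

lemma lintegral_comp_of_indepFun {Ω α β : Type*} [MeasurableSpace Ω] [MeasurableSpace α]
    [MeasurableSpace β] {μ : Measure Ω} [IsProbabilityMeasure μ]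
    {f : Ω → α} {g : Ω → β} (hf : Measurable f) (hg : Measurable g) (h : IndepFun f g μ)
    {F : α → β → ℝ≥0∞} (hF : Measurable (Function.uncurry F)) :
    ∫⁻ x, F (f x) (g x) ∂μ = ∫⁻ y, ∫⁻ x, F (f x) (g y) ∂μ ∂μ := by
  have hm := (indepFun_iff_map_prod_eq_prod_map_map hf.aemeasurable hg.aemeasurable).1 h
  have : IsProbabilityMeasure (μ.map f) := Measure.isProbabilityMeasure_map hf.aemeasurable
  have : IsProbabilityMeasure (μ.map g) := Measure.isProbabilityMeasure_map hg.aemeasurable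
  calc ∫⁻ x, F (f x) (g x) ∂μ = ∫⁻ z, Function.uncurry F z ∂(μ.map fun x => (f x, g x)) := by
        rw [lintegral_map hF (hf.prodMk hg)]; rfl
    _ = _ := by
      rw [hm, lintegral_prod_symm' _ hF, lintegral_map _ hg]
      · refine lintegral_congr fun y => ?_
        rw [lintegral_map _ hf]
        · rfl
        · exact hF.comp (measurable_id.prodMk measurable_const)
      · exact hF.lintegral_prod_left'

/-- Fubini for two disjoint blocks of coordinates. Both integrals run over the whole product space,
so that the index type never has to be split. -/
lemma lintegral_comp_of_dependsOn {α β : Type*} [MeasurableSpace α] [MeasurableSpace β]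
    {f : (ι → ℝ) → α} {g : (ι → ℝ) → β} (hf : Measurable f) (hg : Measurable g) {s t : Set ι}
    (hfs : DependsOn f s) (hgt : DependsOn g t) (hst : Disjoint s t)
    {F : α → β → ℝ≥0∞} (hF : Measurable (Function.uncurry F)) :
    ∫⁻ x, F (f x) (g x) ∂Measure.pi ν = ∫⁻ y, ∫⁻ x, F (f x) (g y) ∂Measure.pi ν ∂Measure.pi ν :=
  lintegral_comp_of_indepFun hf hg (indepFun_of_dependsOn hf hg hfs hgt hst) hF

lemma lintegral_eval (i : ι) {f : ℝ → ℝ≥0∞} (hf : Measurable f) :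
    ∫⁻ x, f (x i) ∂Measure.pi ν = ∫⁻ z, f z ∂ν i := by
  rw [← (measurePreserving_eval ν i).map_eq, lintegral_map hf (measurable_pi_apply i)]

lemma dependsOn_eval (i : ι) : DependsOn (fun x : ι → ℝ => x i) {i} := fun _ _ h => h i rfl

lemma lintegral_eval_pair {i j : ι} (hij : i ≠ j) {F : ℝ → ℝ → ℝ≥0∞}
    (hF : Measurable (Function.uncurry F)) :
    ∫⁻ x, F (x i) (x j) ∂Measure.pi ν = ∫⁻ w, ∫⁻ n, F n w ∂ν i ∂ν j := by
  rw [lintegral_comp_of_dependsOn (f := fun x => x i) (g := fun x => x j) (measurable_pi_apply i)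
    (measurable_pi_apply j) (dependsOn_eval i) (dependsOn_eval j) (by simpa using hij) hF]
  have h1 : Measurable fun w => ∫⁻ n, F n w ∂ν i := hF.lintegral_prod_left'
  rw [← lintegral_eval (ν := ν) j h1]
  refine lintegral_congr fun y => ?_
  exact lintegral_eval (f := fun n => F n (y j)) i (hF.comp (measurable_id.prodMk measurable_const))

/-! ### Sums of independent variables -/

lemma dependsOn_sum_eval {κ : Type*} (s : Finset κ) (b : κ → ι) (F : κ → ℝ → ℝ) :
    DependsOn (fun x : ι → ℝ => ∑ k ∈ s, F k (x (b k))) (b '' s) := by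
  intro x y h
  exact Finset.sum_congr rfl fun k hk => by rw [h _ ⟨k, hk, rfl⟩]

lemma map_sum_mul_eval {κ : Type*} (s : Finset κ) (b : κ → ι) (hb : Set.InjOn b s)
    (hν : ∀ k ∈ s, ν (b k) = gaussianReal 0 1) (v : κ → ℝ) :
    (Measure.pi ν).map (fun x => ∑ k ∈ s, v k * x (b k)) =
      gaussianReal 0 (∑ k ∈ s, v k ^ 2).toNNReal := by
  induction s using Finset.induction_on with
  | empty => simp [gaussianReal_zero_var]
  | insert a s ha ih =>
    have ih' := ih (hb.mono (by simp)) fun k hk => hν k (Finset.mem_insert_of_mem hk)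
    have h1 : (Measure.pi ν).map (fun x => v a * x (b a))
        = gaussianReal 0 (v a ^ 2).toNNReal := by
      have : (fun x : ι → ℝ => v a * x (b a)) = (fun z => v a * z) ∘ fun x => x (b a) := rfl
      rw [this, ← Measure.map_map (by fun_prop) (by fun_prop),
        (measurePreserving_eval ν (b a)).map_eq, hν a (Finset.mem_insert_self _ _),
        gaussianReal_map_const_mul, mul_zero, mul_one]
      congr 1
      ext
      simp [sq_nonneg]
    have hind : IndepFun (fun x : ι → ℝ => v a * x (b a)) (fun x => ∑ k ∈ s, v k * x (b k))
        (Measure.pi ν) := by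
      refine indepFun_of_dependsOn (by fun_prop) (by fun_prop) (s := {b a}) (t := b '' s)
        (fun x y h => by rw [h _ rfl]) (dependsOn_sum_eval s b fun k z => v k * z) ?_
      rw [Set.disjoint_singleton_left]
      rintro ⟨k, hk, e⟩
      have := hb (by simp [Finset.mem_coe.1 hk]) (by simp) e
      exact ha (this ▸ hk)
    have := gaussianReal_add_gaussianReal_of_indepFun hind h1 ih'
    rw [Finset.sum_insert ha, Real.toNNReal_add (sq_nonneg _) (Finset.sum_nonneg fun _ _ => sq_nonneg _)]
    rw [add_zero] at this
    rw [← this]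
    congr 1
    ext x
    simp [Finset.sum_insert ha]

lemma lintegral_exp_gaussianReal_var (v : ℝ) (hv : 0 ≤ v) :
    ∫⁻ x, ENNReal.ofReal (Real.exp (-x ^ 2 / 2)) ∂gaussianReal 0 v.toNNReal =
      ENNReal.ofReal (1 / √(1 + v)) := by
  have h : gaussianReal 0 v.toNNReal = (gaussianReal 0 1).map (√v * ·) := by
    rw [gaussianReal_map_const_mul, mul_zero, mul_one]
    congr 1
    ext
    simp [hv]
  rw [h, lintegral_map (by fun_prop) (by fun_prop), ← lintegral_exp_gaussianReal hv]
  refine lintegral_congr fun n => ?_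
  rw [mul_pow, Real.sq_sqrt hv]

/-- The Gaussian expectation of `exp (-T ^ 2 / 2)` for a linear form `T` with standard normal
variables. -/
lemma lintegral_exp_sum_mul_eval {κ : Type*} (s : Finset κ) (b : κ → ι) (hb : Set.InjOn b s)
    (hν : ∀ k ∈ s, ν (b k) = gaussianReal 0 1) (v : κ → ℝ) :
    ∫⁻ x, ENNReal.ofReal (Real.exp (-(∑ k ∈ s, v k * x (b k)) ^ 2 / 2)) ∂Measure.pi ν =
      ENNReal.ofReal (1 / √(1 + ∑ k ∈ s, v k ^ 2)) := by
  rw [← lintegral_exp_gaussianReal_var _ (Finset.sum_nonneg fun _ _ => sq_nonneg _),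
    ← map_sum_mul_eval s b hb hν v, lintegral_map (by fun_prop) (by fun_prop)]

/-- The chi law as the law of the norm of independent variables. -/
lemma lintegral_sqrt_sq_add_sum_sq {κ : Type*} {k : ℝ} (hk : 0 < k) (s : Finset κ) (b : κ → ι)
    (hb : Set.InjOn b s) (hν : ∀ j ∈ s, ν (b j) = gaussianReal 0 1) {f : ℝ → ℝ≥0∞}
    (hf : Measurable f) :
    ∫⁻ z, ∫⁻ x, f √(z ^ 2 + ∑ j ∈ s, x (b j) ^ 2) ∂Measure.pi ν ∂chiLaw k =
      ∫⁻ r, f r ∂chiLaw (k + s.card) := by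
  induction s using Finset.induction_on generalizing f with
  | empty =>
    simp only [Finset.sum_empty, add_zero, Finset.card_empty, Nat.cast_zero, lintegral_const,
      measure_univ, mul_one]
    refine lintegral_congr_ae ((ae_pos_chiLaw hk).mono fun z hz => ?_)
    simp only [Real.sqrt_sq hz.le]
  | insert a s ha ih =>
    have hks : 0 < k + s.card := by positivity
    have ih' := fun (f : ℝ → ℝ≥0∞) hf => ih (hb.mono (by simp))
      (fun j hj => hν j (Finset.mem_insert_of_mem hj)) (f := f) hf
    have hm : Measurable fun r : ℝ => ∫⁻ n, f √(r ^ 2 + n ^ 2) ∂gaussianReal 0 1 :=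
      Measurable.lintegral_prod_right' (f := fun x : ℝ × ℝ => f √(x.1 ^ 2 + x.2 ^ 2))
        (by fun_prop)
    have e : ∀ z : ℝ, ∫⁻ x, f √(z ^ 2 + ∑ j ∈ insert a s, x (b j) ^ 2) ∂Measure.pi ν
        = ∫⁻ y, (fun r => ∫⁻ n, f √(r ^ 2 + n ^ 2) ∂gaussianReal 0 1)
            √(z ^ 2 + ∑ j ∈ s, y (b j) ^ 2) ∂Measure.pi ν := by
      intro z
      have e : ∀ x : ι → ℝ, √(z ^ 2 + ∑ j ∈ insert a s, x (b j) ^ 2)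
          = √(√(z ^ 2 + ∑ j ∈ s, x (b j) ^ 2) ^ 2 + x (b a) ^ 2) := by
        intro x
        rw [Real.sq_sqrt (add_nonneg (sq_nonneg _) (Finset.sum_nonneg fun _ _ => sq_nonneg _)),
          Finset.sum_insert ha]
        congr 1; ring
      simp only [e]
      have hdep : DependsOn (fun x : ι → ℝ => √(z ^ 2 + ∑ j ∈ s, x (b j) ^ 2)) (b '' s) := by
        intro x y h
        have := dependsOn_sum_eval s b (fun _ t => t ^ 2) h
        simp only at this ⊢
        rw [this]
      rw [lintegral_comp_of_dependsOn (f := fun x => x (b a))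
        (g := fun x : ι → ℝ => √(z ^ 2 + ∑ j ∈ s, x (b j) ^ 2))
        (F := fun n r => f √(r ^ 2 + n ^ 2)) (by fun_prop) (by fun_prop) (dependsOn_eval _) hdep ?_
        (by unfold Function.uncurry; fun_prop)]
      · refine lintegral_congr fun y => ?_
        rw [lintegral_eval (f := fun n => f √(√(z ^ 2 + ∑ j ∈ s, y (b j) ^ 2) ^ 2 + n ^ 2)) (b a)
          (by fun_prop), hν a (Finset.mem_insert_self _ _)]
      · rw [Set.disjoint_singleton_left]
        rintro ⟨j, hj, h⟩
        have := hb (by simp [Finset.mem_coe.1 hj]) (by simp) h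
        exact ha (this ▸ hj)
    rw [lintegral_congr e, ih' _ hm, lintegral_sqrt_sq_add_sq hks hf,
      Finset.card_insert_of_notMem ha]
    congr 2; push_cast; ring

/-! ### Markov chains of ratios along a path -/

/-- The sequence `c_0 = x_a`, `c_{k+1} = -(x_{n k} c_k) / x_{w k}`. -/
def chain (a : ι) (n w : ℕ → ι) (x : ι → ℝ) : ℕ → ℝ
  | 0 => x a
  | k + 1 => -(x (n k) * chain a n w x k) / x (w k)

/-- `∑ c_k ^ 2` for `1 ≤ k ≤ m`. -/
def chainSum (a : ι) (n w : ℕ → ι) (m : ℕ) (x : ι → ℝ) : ℝ :=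
  ∑ k ∈ Finset.range m, chain a n w x (k + 1) ^ 2

/-- The coordinates on which the first `m + 1` terms of a chain depend. -/
def chainIdx (a : ι) (n w : ℕ → ι) (m : ℕ) : Set ι :=
  {a} ∪ {i | ∃ k < m, i = n k ∨ i = w k}

lemma chainIdx_mono (a : ι) (n w : ℕ → ι) {m m' : ℕ} (h : m ≤ m') :
    chainIdx a n w m ⊆ chainIdx a n w m' := by
  rintro i (hi | ⟨k, hk, hi⟩)
  · exact Or.inl hi
  · exact Or.inr ⟨k, hk.trans_le h, hi⟩

@[fun_prop]
lemma measurable_chain (a : ι) (n w : ℕ → ι) (m : ℕ) :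
    Measurable fun x => chain a n w x m := by
  induction m with
  | zero => exact measurable_pi_apply a
  | succ m ih => simp only [chain]; fun_prop

@[fun_prop]
lemma measurable_chainSum (a : ι) (n w : ℕ → ι) (m : ℕ) : Measurable (chainSum a n w m) := by
  unfold chainSum; fun_prop

lemma dependsOn_chain (a : ι) (n w : ℕ → ι) (m : ℕ) :
    DependsOn (fun x => chain a n w x m) (chainIdx a n w m) := by
  induction m with
  | zero => exact fun x y h => h a (Or.inl rfl)
  | succ m ih =>
    intro x y h
    simp only [chain]
    have := ih fun i hi => h i (chainIdx_mono a n w m.le_succ hi)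
    simp only at this
    rw [this, h (n m) (Or.inr ⟨m, m.lt_succ_self, Or.inl rfl⟩),
      h (w m) (Or.inr ⟨m, m.lt_succ_self, Or.inr rfl⟩)]

lemma dependsOn_chainSum (a : ι) (n w : ℕ → ι) (m : ℕ) :
    DependsOn (chainSum a n w m) (chainIdx a n w m) := by
  intro x y h
  refine Finset.sum_congr rfl fun k hk => ?_
  have := dependsOn_chain a n w (k + 1)
    fun i hi => h i (chainIdx_mono a n w (Finset.mem_range.1 hk) hi)
  simp only at this
  rw [this]

/-- The coordinates of a chain have the right laws and do not repeat. -/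
structure IsChain (ν : ι → Measure ℝ) (δ : ℝ) (a : ι) (n w : ℕ → ι) (M : ℕ) : Prop where
  law_a : ν a = gaussianReal 0 1
  law_n : ∀ k < M, ν (n k) = gaussianReal 0 1
  law_w : ∀ k < M, ν (w k) = chiLaw (δ + 1)
  n_ne_w : ∀ k < M, n k ≠ w k
  n_fresh : ∀ k < M, n k ∉ chainIdx a n w k
  w_fresh : ∀ k < M, w k ∉ chainIdx a n w k

/-- A Feynman–Kac formula. The last step of the chain uses two fresh coordinates; integrating them
out replaces f by `stepOp δ f` and shortens the chain by one, whence the induction with f free. -/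
lemma IsChain.lintegral_exp_mul {δ : ℝ} (hδ : 0 < δ) {a : ι} {n w : ℕ → ι} {M : ℕ}
    (h : IsChain ν δ a n w M) {m : ℕ} (hm : m ≤ M) {f : ℝ → ℝ≥0∞} (hf : Measurable f) :
    ∫⁻ x, ENNReal.ofReal (Real.exp (-chainSum a n w m x / 2)) * f (chain a n w x m) ∂Measure.pi ν =
      ∫⁻ c, (stepOp δ)^[m] f c ∂gaussianReal 0 1 := by
  induction m generalizing f with
  | zero =>
    simp only [chainSum, Finset.range_zero, Finset.sum_empty, neg_zero, zero_div, Real.exp_zero,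
      ENNReal.ofReal_one, one_mul, Function.iterate_zero, id_eq, chain]
    rw [lintegral_eval a hf, h.law_a]
  | succ m ih =>
    have hmM : m < M := hm
    rw [Function.iterate_succ_apply, ← ih hmM.le (measurable_stepOp hf)]
    set G : ℝ × ℝ → ℝ × ℝ → ℝ≥0∞ := fun p q =>
      ENNReal.ofReal (Real.exp (-q.1 / 2)) * (ENNReal.ofReal
        (Real.exp (-(-(p.1 * q.2) / p.2) ^ 2 / 2)) * f (-(p.1 * q.2) / p.2)) with hG
    have hGm : Measurable (Function.uncurry G) := by
      unfold Function.uncurry; simp only [hG]; fun_prop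
    have e1 : ∀ x : ι → ℝ, ENNReal.ofReal (Real.exp (-chainSum a n w (m + 1) x / 2)) *
        f (chain a n w x (m + 1)) = G (x (n m), x (w m)) (chainSum a n w m x, chain a n w x m) := by
      intro x
      simp only [hG]
      rw [← mul_assoc, ← ENNReal.ofReal_mul (Real.exp_pos _).le, ← Real.exp_add, chainSum,
        Finset.sum_range_succ, ← chainSum]
      simp only [chain]
      congr 3; ring
    rw [lintegral_congr e1, lintegral_comp_of_dependsOn (f := fun x => (x (n m), x (w m)))
      (g := fun x => (chainSum a n w m x, chain a n w x m)) (s := {n m, w m})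
      (t := chainIdx a n w m) (by fun_prop) (by fun_prop) ?_ ?_ ?_ hGm]
    · refine lintegral_congr fun y => ?_
      rw [lintegral_eval_pair (F := fun u v => G (u, v) (chainSum a n w m y, chain a n w y m))
        (h.n_ne_w m hmM) (by unfold Function.uncurry; simp only [hG]; fun_prop), h.law_n m hmM,
        h.law_w m hmM]
      simp only [hG]
      rw [← lintegral_step hδ hf, ← lintegral_const_mul]
      · refine lintegral_congr fun v => ?_
        rw [← lintegral_const_mul _ (by fun_prop)]
      · refine Measurable.lintegral_prod_right' (f := fun z : ℝ × ℝ => ENNReal.ofReal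
          (Real.exp (-(-(z.2 * chain a n w y m) / z.1) ^ 2 / 2)) *
            f (-(z.2 * chain a n w y m) / z.1)) ?_
        fun_prop
    · intro x y hxy
      simp only [Prod.mk.injEq]
      exact ⟨hxy _ (by simp), hxy _ (by simp)⟩
    · intro x y hxy
      simp only [Prod.mk.injEq]
      exact ⟨dependsOn_chainSum a n w m hxy, dependsOn_chain a n w m hxy⟩
    · rw [Set.disjoint_left]
      rintro i (rfl | hi)
      · exact h.n_fresh m hmM
      · rw [Set.mem_singleton_iff.1 hi]; exact h.w_fresh m hmM

end Product

/-! ### Estimates for a single path -/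

/-- The expectation of `gapFun (c ^ 2 / s ^ 2)`, where `s` has law `chiLaw D`. -/
def gapMean (D c : ℝ) : ℝ≥0∞ := ∫⁻ s, ENNReal.ofReal (gapFun (c ^ 2 / s ^ 2)) ∂chiLaw D

lemma measurable_gapMean (D : ℝ) (hD : 0 < D) : Measurable (gapMean D) := by
  have := isProbabilityMeasure_chiLaw hD
  exact Measurable.lintegral_prod_right'
    (f := fun x : ℝ × ℝ => ENNReal.ofReal (gapFun (x.1 ^ 2 / x.2 ^ 2))) (by fun_prop)

lemma lintegral_abs_div_chiLaw {D : ℝ} (hD : 1 < D) (c : ℝ) :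
    ∫⁻ s, ENNReal.ofReal (|c| / s) ∂chiLaw D =
      ENNReal.ofReal (√(Real.pi / 2) * bigR (D - 1)) * ENNReal.ofReal |c| := by
  rw [← chiMoment_neg_one hD, ← lintegral_chiLaw_rpow (by linarith) (by linarith),
    ← lintegral_mul_const _ (by fun_prop)]
  refine lintegral_congr_ae ((ae_pos_chiLaw (by linarith)).mono fun s hs => ?_)
  simp only
  rw [← ENNReal.ofReal_mul (by positivity), Real.rpow_neg_one]
  congr 1; ring

lemma lintegral_sq_div_chiLaw {D : ℝ} (hD : 2 < D) (c : ℝ) :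
    ∫⁻ s, ENNReal.ofReal ((|c| / s) ^ 2) ∂chiLaw D =
      ENNReal.ofReal (1 / (D - 2)) * ENNReal.ofReal (c ^ 2) := by
  rw [← chiMoment_neg_two hD, ← lintegral_chiLaw_rpow (by linarith) (by linarith),
    ← lintegral_mul_const _ (by fun_prop)]
  refine lintegral_congr_ae ((ae_pos_chiLaw (by linarith)).mono fun s hs => ?_)
  simp only
  rw [← ENNReal.ofReal_mul (by positivity), Real.rpow_neg hs.le, Real.rpow_two, div_pow, sq_abs]
  congr 1; ring

lemma gapMean_le_linear {δ D : ℝ} (h2 : 2 < δ) (h3 : δ ≤ 31 / 10) (hD : δ ≤ D) (c : ℝ) :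
    gapMean D c ≤ ENNReal.ofReal (2 / Real.pi * bigR δ * (√(Real.pi / 2) * bigR (D - 1))) *
      ENNReal.ofReal |c| := by
  have hR := bigR_pos (by linarith : 0 < δ)
  rw [ENNReal.ofReal_mul (by positivity), mul_assoc, ← lintegral_abs_div_chiLaw (by linarith),
    ← lintegral_const_mul _ (by fun_prop)]
  refine lintegral_mono_ae ((ae_pos_chiLaw (by linarith)).mono fun s hs => ?_)
  rw [← ENNReal.ofReal_mul (by positivity)]
  refine ENNReal.ofReal_le_ofReal ?_
  have := gapFun_le_two_div_pi_mul_bigR h2.le h3 (by positivity : 0 ≤ |c| / s)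
  rwa [div_pow, sq_abs] at this

lemma gapMean_le_mixed {ε D : ℝ} (hε : 0 < ε) (hD : 2 < D) (c : ℝ) :
    gapMean D c ≤ ENNReal.ofReal (ε / 2 * (√(Real.pi / 2) * bigR (D - 1))) * ENNReal.ofReal |c| +
      ENNReal.ofReal (1 / (20 * ε) * (1 / (D - 2))) * ENNReal.ofReal (c ^ 2) := by
  rw [ENNReal.ofReal_mul (by positivity), mul_assoc, ← lintegral_abs_div_chiLaw (by linarith),
    ENNReal.ofReal_mul (by positivity), mul_assoc, ← lintegral_sq_div_chiLaw hD,
    ← lintegral_const_mul _ (by fun_prop), ← lintegral_const_mul _ (by fun_prop),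
    ← lintegral_add_left (by fun_prop)]
  refine lintegral_mono_ae ((ae_pos_chiLaw (by linarith)).mono fun s hs => ?_)
  rw [← ENNReal.ofReal_mul (by positivity), ← ENNReal.ofReal_mul (by positivity),
    ← ENNReal.ofReal_add (by positivity) (by positivity)]
  refine ENNReal.ofReal_le_ofReal ?_
  have := gapFun_le_mixed hε (by positivity : 0 ≤ |c| / s)
  rwa [show c ^ 2 / s ^ 2 = (|c| / s) ^ 2 by rw [div_pow, sq_abs]]

lemma stepOp_const_mul {δ : ℝ} (a : ℝ≥0∞) {f : ℝ → ℝ≥0∞} (hf : Measurable f) (c : ℝ) :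
    stepOp δ (fun c => a * f c) c = a * stepOp δ f c := by
  unfold stepOp
  rw [← lintegral_const_mul _ (by fun_prop)]
  refine lintegral_congr fun t => ?_
  ring

lemma iterate_stepOp_le {δ : ℝ} {a : ℝ≥0∞} {f : ℝ → ℝ≥0∞} (hf : Measurable f)
    (h : ∀ c, stepOp δ f c ≤ a * f c) (m : ℕ) (c : ℝ) : (stepOp δ)^[m] f c ≤ a ^ m * f c := by
  induction m generalizing c with
  | zero => simp
  | succ m ih =>
    rw [Function.iterate_succ_apply']
    calc _ ≤ stepOp δ (fun c => a ^ m * f c) c := stepOp_mono ih c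
      _ = a ^ m * stepOp δ f c := stepOp_const_mul _ hf c
      _ ≤ a ^ m * (a * f c) := by gcongr; exact h c
      _ = _ := by rw [pow_succ, mul_assoc]

/-- The operator is monotone and its fixed point lies below the constant 1, so all iterates of 1
stay above the fixed point. -/
lemma stepFix_le_iterate {δ : ℝ} (hδ : 0 < δ) (m : ℕ) (c : ℝ) :
    stepFix δ c ≤ (stepOp δ)^[m] 1 c := by
  induction m generalizing c with
  | zero => exact stepFix_le_one hδ c
  | succ m ih =>
    rw [Function.iterate_succ_apply', ← stepOp_stepFix hδ]
    exact stepOp_mono ih c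

section Product

variable {ι : Type*} [Fintype ι] {ν : ι → Measure ℝ} [∀ i, IsProbabilityMeasure (ν i)]
  {δ : ℝ} {a : ι} {n w : ℕ → ι} {m : ℕ}

lemma IsChain.smallR_le (hδ : 0 < δ) (h : IsChain ν δ a n w m) :
    ENNReal.ofReal (smallR δ) ≤
      ∫⁻ x, ENNReal.ofReal (Real.exp (-chainSum a n w m x / 2)) ∂Measure.pi ν := by
  have := h.lintegral_exp_mul hδ le_rfl (f := 1) measurable_const
  simp only [Pi.one_apply, mul_one] at this
  rw [this, ← lintegral_stepFix hδ]
  exact lintegral_mono fun c => stepFix_le_iterate hδ m c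

/-- Only m of the m+1 steps are bounded by the rate r. The outermost operator, the step from the
Gaussian start, is kept so that it can be integrated exactly. -/
lemma IsChain.lintegral_exp_mul_le (hδ : 0 < δ) (h : IsChain ν δ a n w (m + 1)) {r : ℝ≥0∞}
    {f : ℝ → ℝ≥0∞} (hf : Measurable f) (hr : ∀ c, stepOp δ f c ≤ r * f c) :
    ∫⁻ x, ENNReal.ofReal (Real.exp (-chainSum a n w (m + 1) x / 2)) * f (chain a n w x (m + 1))
      ∂Measure.pi ν ≤ r ^ m * ∫⁻ c, stepOp δ f c ∂gaussianReal 0 1 := by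
  rw [h.lintegral_exp_mul hδ le_rfl hf, ← lintegral_const_mul _ (measurable_stepOp hf)]
  refine lintegral_mono fun c => ?_
  rw [Function.iterate_succ_apply', ← stepOp_const_mul _ hf]
  exact stepOp_mono (iterate_stepOp_le hf hr m) c

/-- The estimate of one path with m + 2 interior vertices. The powers of R_δ come from m crude
steps, one exact step and the linear bound on gap; R_{D-1} is the inverse moment of the chi
variable, and the factors √(π/2) and √(2/π) cancel. -/
lemma IsChain.lintegral_exp_mul_gapMean_le (hδ : 2 < δ) (h : IsChain ν δ a n w (m + 1)) {D : ℝ}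
    (hD : δ ≤ D) :
    ∫⁻ x, ENNReal.ofReal (Real.exp (-chainSum a n w (m + 1) x / 2)) *
        gapMean D (chain a n w x (m + 1)) ∂Measure.pi ν ≤
      ENNReal.ofReal (2 / Real.pi * (δ / (δ + 2)) * bigR δ ^ (m + 2) * bigR (D - 1)) := by
  have hδ0 : 0 < δ := by linarith
  have hR := bigR_pos hδ0
  have hRD := bigR_pos (by linarith : 0 < D - 1)
  have hpi := Real.pi_pos
  have hroot : √(Real.pi / 2) * √(2 / Real.pi) = 1 := by
    rw [← Real.sqrt_mul (by positivity)]
    have : Real.pi / 2 * (2 / Real.pi) = 1 := by field_simp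
    rw [this, Real.sqrt_one]
  have X1 := h.lintegral_exp_mul_le hδ0 (f := fun c => ENNReal.ofReal |c|) (by fun_prop)
    (stepOp_abs_le hδ0)
  rw [lintegral_stepOp_abs hδ0, ← ENNReal.ofReal_pow hR.le, ← ENNReal.ofReal_mul (by positivity)]
    at X1
  rcases le_total δ (31 / 10) with h3 | h3
  · calc _ ≤ ∫⁻ x, ENNReal.ofReal (2 / Real.pi * bigR δ * (√(Real.pi / 2) * bigR (D - 1))) *
          (ENNReal.ofReal (Real.exp (-chainSum a n w (m + 1) x / 2)) *
            ENNReal.ofReal |chain a n w x (m + 1)|) ∂Measure.pi ν := by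
          refine lintegral_mono fun x => ?_
          rw [mul_left_comm]
          gcongr
          exact gapMean_le_linear hδ h3 hD _
      _ ≤ _ := by
        rw [lintegral_const_mul _ (by fun_prop)]
        refine (mul_le_mul_right X1 _).trans ?_
        rw [← ENNReal.ofReal_mul (by positivity)]
        refine ENNReal.ofReal_le_ofReal (le_of_eq ?_)
        linear_combination (2 / Real.pi * (δ / (δ + 2)) * bigR δ ^ (m + 2) * bigR (D - 1)) * hroot
  · have X2 := h.lintegral_exp_mul_le hδ0 (f := fun c => ENNReal.ofReal (c ^ 2)) (by fun_prop)
      (stepOp_sq_le (by linarith))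
    have hδ1 : 0 < δ - 1 := by linarith
    have hr1 := smallR_pos (by linarith : 0 < δ + 1)
    rw [lintegral_stepOp_sq hδ0, ← ENNReal.ofReal_pow (by positivity),
      ← ENNReal.ofReal_mul (by positivity)] at X2
    -- With this ε the linear term of the mixed bound is half of the one used for δ ≤ 31/10, so it
    -- yields exactly half of the claim (`e1`); the quadratic term has to fit into the other half
    -- (`e2`).
    set ε := 2 / Real.pi * bigR δ with hε
    have hε0 : 0 < ε := by positivity
    have hD2 : 0 < D - 2 := by linarith
    calc _ ≤ ∫⁻ x, (ENNReal.ofReal (ε / 2 * (√(Real.pi / 2) * bigR (D - 1))) *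
          (ENNReal.ofReal (Real.exp (-chainSum a n w (m + 1) x / 2)) *
            ENNReal.ofReal |chain a n w x (m + 1)|) +
          ENNReal.ofReal (1 / (20 * ε) * (1 / (D - 2))) *
          (ENNReal.ofReal (Real.exp (-chainSum a n w (m + 1) x / 2)) *
            ENNReal.ofReal (chain a n w x (m + 1) ^ 2))) ∂Measure.pi ν := by
          refine lintegral_mono fun x => ?_
          rw [mul_left_comm, mul_left_comm (ENNReal.ofReal (1 / (20 * ε) * (1 / (D - 2)))),
            ← mul_add]
          gcongr
          exact gapMean_le_mixed hε0 (by linarith) _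
      _ ≤ _ := by
        rw [lintegral_add_left (by fun_prop), lintegral_const_mul _ (by fun_prop),
          lintegral_const_mul _ (by fun_prop)]
        refine (add_le_add (mul_le_mul_right X1 _) (mul_le_mul_right X2 _)).trans ?_
        rw [← ENNReal.ofReal_mul (by positivity), ← ENNReal.ofReal_mul (by positivity),
          ← ENNReal.ofReal_add (by positivity) (by positivity)]
        refine ENNReal.ofReal_le_ofReal ?_
        have e1 : ε / 2 * (√(Real.pi / 2) * bigR (D - 1)) *
            (bigR δ ^ m * (√(2 / Real.pi) * (δ / (δ + 2) * bigR δ)))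
            = 1 / 2 * (2 / Real.pi * (δ / (δ + 2)) * bigR δ ^ (m + 2) * bigR (D - 1)) := by
          rw [hε]
          linear_combination (1 / Real.pi * (δ / (δ + 2)) * bigR δ ^ (m + 2) * bigR (D - 1)) * hroot
        have e2 : 1 / (20 * ε) * (1 / (D - 2)) * ((1 / (δ - 1)) ^ m * (smallR (δ + 1) / (δ + 3)))
            ≤ 1 / 2 * (2 / Real.pi * (δ / (δ + 2)) * bigR δ ^ (m + 2) * bigR (D - 1)) := by
          have b1 : smallR (δ + 1) ≤ 1 := smallR_le_one (by linarith)
          have b2 : 1 / (δ - 1) ≤ bigR δ := by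
            rw [div_le_iff₀ hδ1]; exact one_le_bigR_mul h3
          calc _ ≤ 1 / (20 * ε) * (1 / (D - 2)) * (bigR δ ^ m * (1 / (δ + 3))) := by gcongr
            _ = bigR δ ^ m / (2 * ε) * (1 / 10 / ((δ + 3) * (D - 2))) := by field_simp; norm_num
            _ ≤ bigR δ ^ m / (2 * ε) *
              ((2 / Real.pi) ^ 2 * (δ / (δ + 2)) * bigR δ ^ 3 * bigR (D - 1)) := by
                gcongr
                exact second_order_bound h3 hD
            _ = _ := by rw [hε]; field_simp; ring
        linarith

end Product

/-! ### Systems of independent chains -/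

section System

variable {ι κ : Type*} [Fintype ι] {ν : ι → Measure ℝ} [∀ i, IsProbabilityMeasure (ν i)] {δ : ℝ}
  {Λ : Finset κ} {m : κ → ℕ} {a b : κ → ι} {n w : κ → ℕ → ι} {z : ι}

/-- A family of chains with pairwise disjoint coordinates, together with further standard normal
coordinates `b j` and a coordinate `z` of law `chiLaw δ`. -/
structure IsChainSystem (ν : ι → Measure ℝ) (δ : ℝ) (Λ : Finset κ) (m : κ → ℕ) (a b : κ → ι)
    (n w : κ → ℕ → ι) (z : ι) : Prop where
  isChain : ∀ j ∈ Λ, IsChain ν δ (a j) (n j) (w j) (m j)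
  disj : ∀ j ∈ Λ, ∀ j' ∈ Λ, j ≠ j' →
    Disjoint (chainIdx (a j) (n j) (w j) (m j)) (chainIdx (a j') (n j') (w j') (m j'))
  law_b : ∀ j ∈ Λ, ν (b j) = gaussianReal 0 1
  b_inj : Set.InjOn b Λ
  b_notMem : ∀ j ∈ Λ, ∀ j' ∈ Λ, b j ∉ chainIdx (a j') (n j') (w j') (m j')
  law_z : ν z = chiLaw δ
  z_notMem : ∀ j ∈ Λ, z ∉ chainIdx (a j) (n j) (w j) (m j)
  z_ne_b : ∀ j ∈ Λ, b j ≠ z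

/-- The coordinates of the chains in `s`. -/
def chainsIdx (m : κ → ℕ) (a : κ → ι) (n w : κ → ℕ → ι) (s : Finset κ) : Set ι :=
  {i | ∃ j ∈ s, i ∈ chainIdx (a j) (n j) (w j) (m j)}

/-- The sum of the squares of all the terms but the first of the chains in `s`. -/
def chainsSum (m : κ → ℕ) (a : κ → ι) (n w : κ → ℕ → ι) (s : Finset κ) (x : ι → ℝ) : ℝ :=
  ∑ j ∈ s, chainSum (a j) (n j) (w j) (m j) x

/-- The sum of the squares of the last terms of the chains in `s`. -/
def chainsEnd (m : κ → ℕ) (a : κ → ι) (n w : κ → ℕ → ι) (s : Finset κ) (x : ι → ℝ) : ℝ :=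
  ∑ j ∈ s, chain (a j) (n j) (w j) x (m j) ^ 2

/-- The linear form in the coordinates `b j / z` with the last terms of the chains as
coefficients. -/
def chainsForm (m : κ → ℕ) (a b : κ → ι) (n w : κ → ℕ → ι) (z : ι) (s : Finset κ) (x : ι → ℝ) : ℝ :=
  ∑ j ∈ s, chain (a j) (n j) (w j) x (m j) * x (b j) / x z

@[fun_prop]
lemma measurable_chainsSum (s : Finset κ) : Measurable (chainsSum m a n w s) := by
  unfold chainsSum; fun_prop

@[fun_prop]
lemma measurable_chainsEnd (s : Finset κ) : Measurable (chainsEnd m a n w s) := by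
  unfold chainsEnd; fun_prop

@[fun_prop]
lemma measurable_chainsForm (s : Finset κ) : Measurable (chainsForm m a b n w z s) := by
  unfold chainsForm; fun_prop

lemma chainsSum_nonneg (s : Finset κ) (x : ι → ℝ) : 0 ≤ chainsSum m a n w s x :=
  Finset.sum_nonneg fun _ _ => Finset.sum_nonneg fun _ _ => sq_nonneg _

lemma chainsEnd_nonneg (s : Finset κ) (x : ι → ℝ) : 0 ≤ chainsEnd m a n w s x :=
  Finset.sum_nonneg fun _ _ => sq_nonneg _

lemma chainsIdx_mono {s t : Finset κ} (h : s ⊆ t) :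
    chainsIdx m a n w s ⊆ chainsIdx m a n w t := fun _ ⟨j, hj, hi⟩ => ⟨j, h hj, hi⟩

lemma dependsOn_chainsSum (s : Finset κ) :
    DependsOn (chainsSum m a n w s) (chainsIdx m a n w s) := fun _ _ h =>
  Finset.sum_congr rfl fun j hj => dependsOn_chainSum _ _ _ _ fun i hi => h i ⟨j, hj, hi⟩

lemma dependsOn_chains {s : Finset κ} {j : κ} (hj : j ∈ s) :
    DependsOn (fun x => chain (a j) (n j) (w j) x (m j)) (chainsIdx m a n w s) :=
  (dependsOn_chain (a j) (n j) (w j) (m j)).mono fun _ hi => ⟨j, hj, hi⟩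

lemma dependsOn_chainsEnd (s : Finset κ) :
    DependsOn (chainsEnd m a n w s) (chainsIdx m a n w s) := fun _ _ h =>
  Finset.sum_congr rfl fun j hj => by
    have := dependsOn_chains hj h
    simp only at this
    rw [this]

lemma dependsOn_chainsForm (s : Finset κ) :
    DependsOn (chainsForm m a b n w z s) (chainsIdx m a n w s ∪ (b '' s ∪ {z})) := fun _ _ h =>
  Finset.sum_congr rfl fun j hj => by
    have := dependsOn_chains hj fun i hi => h i (Or.inl hi)
    simp only at this
    rw [this, h (b j) (Or.inr (Or.inl ⟨j, hj, rfl⟩)), h z (Or.inr (Or.inr rfl))]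

namespace IsChainSystem

lemma disjoint_chainsIdx (h : IsChainSystem ν δ Λ m a b n w z) {s t : Finset κ} (hs : s ⊆ Λ)
    (ht : t ⊆ Λ) (hst : Disjoint s t) :
    Disjoint (chainsIdx m a n w s) (chainsIdx m a n w t) := by
  rw [Set.disjoint_left]
  rintro i ⟨j, hj, hi⟩ ⟨j', hj', hi'⟩
  refine Set.disjoint_left.1 (h.disj j (hs hj) j' (ht hj') ?_) hi hi'
  rintro rfl
  exact Finset.disjoint_left.1 hst hj hj'

/-- Integrating out the coordinates `b j`. -/
lemma lintegral_mul_exp_chainsForm (h : IsChainSystem ν δ Λ m a b n w z) {s : Finset κ}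
    (hs : s ⊆ Λ) {g : (ι → ℝ) → ℝ≥0∞} (hg : Measurable g) (hgd : DependsOn g (chainsIdx m a n w Λ)) :
    ∫⁻ x, g x * ENNReal.ofReal (Real.exp (-chainsForm m a b n w z s x ^ 2 / 2)) ∂Measure.pi ν =
      ∫⁻ x, g x * ENNReal.ofReal (1 / √(1 + chainsEnd m a n w s x / x z ^ 2)) ∂Measure.pi ν := by
  set F : (s → ℝ) → (ℝ≥0∞ × (s → ℝ)) → ℝ≥0∞ := fun y v =>
    v.1 * ENNReal.ofReal (Real.exp (-(∑ j, v.2 j * y j) ^ 2 / 2)) with hF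
  have e : ∀ x : ι → ℝ, g x * ENNReal.ofReal (Real.exp (-chainsForm m a b n w z s x ^ 2 / 2))
      = F (fun j => x (b j)) (g x, fun j : s => chain (a j) (n j) (w j) x (m j) / x z) := by
    intro x
    have : chainsForm m a b n w z s x
        = ∑ j : s, chain (a j) (n j) (w j) x (m j) / x z * x (b j) := by
      rw [chainsForm, ← Finset.sum_coe_sort s]
      exact Finset.sum_congr rfl fun j _ => by ring
    simp only [hF, this]
  rw [lintegral_congr e, lintegral_comp_of_dependsOn (f := fun x => fun j : s => x (b j))
    (g := fun x => (g x, fun j : s => chain (a j) (n j) (w j) x (m j) / x z))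
    (s := b '' s) (t := chainsIdx m a n w Λ ∪ {z}) (F := F)]
  · refine lintegral_congr fun y => ?_
    simp only [hF]
    rw [lintegral_const_mul _ (by fun_prop), lintegral_exp_sum_mul_eval Finset.univ
      (fun j : s => b j)
      (fun j _ j' _ e => Subtype.ext (h.b_inj (hs j.2) (hs j'.2) e))
      (fun j _ => h.law_b j (hs j.2))]
    congr 4
    rw [Finset.sum_coe_sort s (fun j => (chain (a j) (n j) (w j) y (m j) / y z) ^ 2), chainsEnd,
      Finset.sum_div]
    congr 1
    exact Finset.sum_congr rfl fun j _ => div_pow _ _ _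
  · fun_prop
  · refine hg.prodMk (measurable_pi_lambda _ fun j => ?_)
    fun_prop
  · intro x y hxy
    ext j
    exact hxy _ ⟨j, j.2, rfl⟩
  · intro x y hxy
    simp only [Prod.mk.injEq]
    refine ⟨hgd fun i hi => hxy i (Or.inl hi), ?_⟩
    ext j
    have := dependsOn_chains (m := m) (a := a) (n := n) (w := w) (hs j.2)
      fun i hi => hxy i (Or.inl hi)
    simp only at this
    rw [this, hxy z (Or.inr rfl)]
  · rw [Set.disjoint_left]
    rintro i ⟨j, hj, rfl⟩ (⟨j', hj', hi⟩ | hi)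
    · exact h.b_notMem j (hs hj) j' hj' hi
    · exact h.z_ne_b j (hs hj) hi
  · unfold Function.uncurry
    simp only [hF]
    fun_prop

/-- The number of chains that consist of a single term. -/
def single (Λ : Finset κ) (m : κ → ℕ) : Finset κ := Λ.filter fun j => m j = 0

/-- The chains with at least two terms. -/
def long (Λ : Finset κ) (m : κ → ℕ) : Finset κ := Λ.filter fun j => m j ≠ 0

lemma single_subset : single Λ m ⊆ Λ := Finset.filter_subset _ _

lemma long_subset : long Λ m ⊆ Λ := Finset.filter_subset _ _

lemma disjoint_single_long : Disjoint (single Λ m) (long Λ m) :=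
  Finset.disjoint_filter_filter_not _ _ _

/-- Writing 1/√(1+γ/r²) = r/√(r²+γ) exposes a factor r, which tilts the chi law by one degree of
freedom. -/
lemma lintegral_inv_sqrt_chiLaw {k : ℝ} (hk : 0 < k) {γ : ℝ} (hγ : 0 ≤ γ) :
    ∫⁻ r, ENNReal.ofReal (1 / √(1 + γ / r ^ 2)) ∂chiLaw k =
      ENNReal.ofReal (chiMoment 1 k) *
        ∫⁻ r, ENNReal.ofReal (1 / √(r ^ 2 + γ)) ∂chiLaw (k + 1) := by
  rw [← lintegral_chiLaw_rpow_mul hk (by linarith) (by fun_prop)]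
  refine lintegral_congr_ae ((ae_pos_chiLaw hk).mono fun r hr => ?_)
  simp only [Real.rpow_one]
  rw [← ENNReal.ofReal_mul hr.le]
  congr 1
  have : 1 + γ / r ^ 2 = (r ^ 2 + γ) / r ^ 2 := by field_simp
  rw [this, Real.sqrt_div (by positivity), Real.sqrt_sq hr.le]
  field_simp

/-- Integrating out the single chains and the coordinate `z`. -/
lemma lintegral_mul_inv_sqrt (hδ : 0 < δ) (h : IsChainSystem ν δ Λ m a b n w z)
    {g : (ι → ℝ) → ℝ≥0∞} (hg : Measurable g) {γ : (ι → ℝ) → ℝ} (hγ : Measurable γ)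
    (hγ0 : ∀ x, 0 ≤ γ x)
    (hgd : DependsOn g (chainsIdx m a n w (long Λ m)))
    (hγd : DependsOn γ (chainsIdx m a n w (long Λ m))) :
    ∫⁻ x, g x * ENNReal.ofReal (1 / √(1 + (chainsEnd m a n w (single Λ m) x + γ x) / x z ^ 2))
        ∂Measure.pi ν =
      ENNReal.ofReal (chiMoment 1 δ / chiMoment 1 (δ + (single Λ m).card)) *
        ∫⁻ x, g x * ∫⁻ r, ENNReal.ofReal (1 / √(1 + γ x / r ^ 2))
          ∂chiLaw (δ + (single Λ m).card) ∂Measure.pi ν := by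
  have hD : 0 < δ + (single Λ m).card := by positivity
  have := isProbabilityMeasure_chiLaw hD
  have hms : ∀ j ∈ single Λ m, m j = 0 := fun j hj => (Finset.mem_filter.1 hj).2
  have hend : chainsEnd m a n w (single Λ m) = fun x => ∑ j ∈ single Λ m, x (a j) ^ 2 := by
    ext x
    refine Finset.sum_congr rfl fun j hj => ?_
    rw [hms j hj, chain]
  have hainj : Set.InjOn a (single Λ m) := by
    intro j hj j' hj' e
    by_contra hne
    refine Set.disjoint_left.1 (h.disj j (single_subset hj) j' (single_subset hj') hne)
      (Or.inl rfl) ?_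
    rw [e]
    exact Or.inl rfl
  have hm1 : Measurable fun x : ℝ => ∫⁻ r, ENNReal.ofReal (1 / √(1 + x / r ^ 2))
      ∂chiLaw (δ + (single Λ m).card) :=
    Measurable.lintegral_prod_right'
      (f := fun x : ℝ × ℝ => ENNReal.ofReal (1 / √(1 + x.1 / x.2 ^ 2))) (by fun_prop)
  have hm1' := hm1.comp hγ
  simp only [Function.comp_def] at hm1'
  rw [← lintegral_const_mul _ (by fun_prop)]
  rw [lintegral_comp_of_dependsOn
    (f := fun x => (x z, chainsEnd m a n w (single Λ m) x)) (g := fun x => (g x, γ x))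
    (F := fun p q => q.1 * ENNReal.ofReal (1 / √(1 + (p.2 + q.2) / p.1 ^ 2)))
    (s := {z} ∪ chainsIdx m a n w (single Λ m)) (t := chainsIdx m a n w (long Λ m))
    (by fun_prop) (by fun_prop) ?_ ?_ ?_ (by unfold Function.uncurry; fun_prop)]
  · refine lintegral_congr fun y => ?_
    simp only
    rw [lintegral_const_mul _ (by fun_prop), mul_left_comm]
    congr 1
    rw [lintegral_comp_of_dependsOn (f := fun x => chainsEnd m a n w (single Λ m) x)
      (g := fun x => x z) (F := fun p q => ENNReal.ofReal (1 / √(1 + (p + γ y) / q ^ 2)))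
      (s := chainsIdx m a n w (single Λ m)) (t := {z})
      (by fun_prop) (by fun_prop) (dependsOn_chainsEnd _) (dependsOn_eval z) ?_
      (by unfold Function.uncurry; fun_prop)]
    · have hmx : Measurable fun q : ℝ => ∫⁻ x, ENNReal.ofReal
          (1 / √(1 + (chainsEnd m a n w (single Λ m) x + γ y) / q ^ 2)) ∂Measure.pi ν :=
        Measurable.lintegral_prod_right' (f := fun x : ℝ × (ι → ℝ) => ENNReal.ofReal
          (1 / √(1 + (chainsEnd m a n w (single Λ m) x.2 + γ y) / x.1 ^ 2))) (by fun_prop)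
      have hmx2 : Measurable fun q : ℝ => ∫⁻ x, ENNReal.ofReal
          (1 / √(q ^ 2 + chainsEnd m a n w (single Λ m) x + γ y)) ∂Measure.pi ν :=
        Measurable.lintegral_prod_right' (f := fun x : ℝ × (ι → ℝ) => ENNReal.ofReal
          (1 / √(x.1 ^ 2 + chainsEnd m a n w (single Λ m) x.2 + γ y))) (by fun_prop)
      rw [lintegral_eval (f := fun q : ℝ => ∫⁻ x, ENNReal.ofReal
          (1 / √(1 + (chainsEnd m a n w (single Λ m) x + γ y) / q ^ 2)) ∂Measure.pi ν) z hmx,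
        h.law_z]
      -- A factor q is pulled out to tilt the chi law from δ to δ+1. The squares of the one-term
      -- chains then join q², giving δ+1+d degrees of freedom. Read backwards at δ+d,
      -- `lintegral_inv_sqrt_chiLaw` removes the tilt; the two moments leave their quotient as
      -- constant.
      have e1 : ∫⁻ q, ∫⁻ x, ENNReal.ofReal
            (1 / √(1 + (chainsEnd m a n w (single Λ m) x + γ y) / q ^ 2)) ∂Measure.pi ν ∂chiLaw δ
          = ∫⁻ q, ENNReal.ofReal (q ^ (1 : ℝ)) * ∫⁻ x, ENNReal.ofReal
            (1 / √(q ^ 2 + chainsEnd m a n w (single Λ m) x + γ y)) ∂Measure.pi ν ∂chiLaw δ := by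
        refine lintegral_congr_ae ((ae_pos_chiLaw hδ).mono fun q hq => ?_)
        simp only
        rw [← lintegral_const_mul _ (by fun_prop)]
        refine lintegral_congr fun x => ?_
        rw [← ENNReal.ofReal_mul (by positivity), Real.rpow_one]
        congr 1
        have h0 := chainsEnd_nonneg (m := m) (a := a) (n := n) (w := w) (single Λ m) x
        have h1 := hγ0 y
        have : 1 + (chainsEnd m a n w (single Λ m) x + γ y) / q ^ 2
            = (q ^ 2 + chainsEnd m a n w (single Λ m) x + γ y) / q ^ 2 := by field_simp; ring
        rw [this, Real.sqrt_div (by positivity), Real.sqrt_sq hq.le]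
        field_simp
      rw [e1, lintegral_chiLaw_rpow_mul hδ (by linarith) hmx2]
      have e2 : ∀ (q : ℝ) (x : ι → ℝ), ENNReal.ofReal
          (1 / √(q ^ 2 + chainsEnd m a n w (single Λ m) x + γ y))
          = (fun r : ℝ => ENNReal.ofReal (1 / √(r ^ 2 + γ y)))
            √(q ^ 2 + ∑ j ∈ single Λ m, x (a j) ^ 2) := by
        intro q x
        simp only [hend]
        rw [Real.sq_sqrt (add_nonneg (sq_nonneg _) (Finset.sum_nonneg fun _ _ => sq_nonneg _))]
      simp only [e2]
      rw [lintegral_sqrt_sq_add_sum_sq (f := fun r => ENNReal.ofReal (1 / √(r ^ 2 + γ y)))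
        (by linarith) (single Λ m) a hainj
        (fun j hj => (h.isChain j (single_subset hj)).law_a) (by fun_prop),
        lintegral_inv_sqrt_chiLaw hD (hγ0 y), ← mul_assoc,
        ENNReal.ofReal_div_of_pos (chiMoment_pos hD (by linarith)), ENNReal.div_mul_cancel]
      · congr 2
        ring_nf
      · simpa using chiMoment_pos hD (by linarith)
      · simp
    · rw [Set.disjoint_singleton_right]
      rintro ⟨j, hj, hi⟩
      exact h.z_notMem j (single_subset hj) hi
  · intro x y hxy
    simp only [Prod.mk.injEq]
    exact ⟨hxy z (by simp), dependsOn_chainsEnd _ fun i hi => hxy i (Or.inr hi)⟩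
  · intro x y hxy
    simp only [Prod.mk.injEq]
    exact ⟨hgd hxy, hγd hxy⟩
  · rw [Set.disjoint_union_left]
    refine ⟨?_, h.disjoint_chainsIdx single_subset long_subset disjoint_single_long⟩
    rw [Set.disjoint_singleton_left]
    rintro ⟨j, hj, hi⟩
    exact h.z_notMem j (long_subset hj) hi

/-- The effect of a single long chain. -/
lemma lintegral_exp_mul_gapMean_le (hδ : 2 < δ) (h : IsChainSystem ν δ Λ m a b n w z) {D : ℝ}
    (hD : δ ≤ D) {j : κ} (hj : j ∈ long Λ m) :
    ∫⁻ x, ENNReal.ofReal (Real.exp (-chainsSum m a n w (long Λ m) x / 2)) *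
        gapMean D (chain (a j) (n j) (w j) x (m j)) ∂Measure.pi ν ≤
      ENNReal.ofReal (2 / (Real.pi * smallR δ) * (δ / (δ + 2)) * bigR δ ^ (m j + 1) *
          bigR (D - 1)) *
        ∫⁻ x, ENNReal.ofReal (Real.exp (-chainsSum m a n w (long Λ m) x / 2)) ∂Measure.pi ν := by
  have hδ0 : 0 < δ := by linarith
  have hr := smallR_pos hδ0
  have hR := bigR_pos hδ0
  have hRD := bigR_pos (by linarith : 0 < D - 1)
  have hgm := measurable_gapMean D (by linarith)
  set t := (long Λ m).erase j with ht
  have htΛ : t ⊆ Λ := (Finset.erase_subset _ _).trans long_subset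
  have hsplit : ∀ x : ι → ℝ, ENNReal.ofReal (Real.exp (-chainsSum m a n w (long Λ m) x / 2))
      = ENNReal.ofReal (Real.exp (-chainsSum m a n w t x / 2)) *
        ENNReal.ofReal (Real.exp (-chainSum (a j) (n j) (w j) (m j) x / 2)) := by
    intro x
    rw [← ENNReal.ofReal_mul (Real.exp_pos _).le, ← Real.exp_add]
    congr 2
    rw [chainsSum, ← Finset.add_sum_erase _ _ hj, chainsSum]
    ring
  have hdis : Disjoint (chainIdx (a j) (n j) (w j) (m j)) (chainsIdx m a n w t) := by
    have := h.disjoint_chainsIdx (s := {j}) (t := t)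
      (Finset.singleton_subset_iff.2 (long_subset hj)) htΛ (by simp [ht])
    refine this.mono_left ?_
    exact fun i hi => ⟨j, Finset.mem_singleton_self j, hi⟩
  -- The other long chains are independent of chain j. Their contribution is a common factor of both
  -- sides, so only chain j remains to be estimated.
  have hfac : ∀ f : ℝ → ℝ≥0∞, Measurable f →
      ∫⁻ x, ENNReal.ofReal (Real.exp (-chainsSum m a n w (long Λ m) x / 2)) *
        f (chain (a j) (n j) (w j) x (m j)) ∂Measure.pi ν =
      (∫⁻ x, ENNReal.ofReal (Real.exp (-chainsSum m a n w t x / 2)) ∂Measure.pi ν) *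
      ∫⁻ x, ENNReal.ofReal (Real.exp (-chainSum (a j) (n j) (w j) (m j) x / 2)) *
        f (chain (a j) (n j) (w j) x (m j)) ∂Measure.pi ν := by
    intro f hf
    simp only [hsplit]
    have := lintegral_comp_of_dependsOn (ν := ν)
      (f := fun x => (chainSum (a j) (n j) (w j) (m j) x, chain (a j) (n j) (w j) x (m j)))
      (g := fun x => chainsSum m a n w t x)
      (F := fun p q => ENNReal.ofReal (Real.exp (-q / 2)) *
        (ENNReal.ofReal (Real.exp (-p.1 / 2)) * f p.2))
      (by fun_prop) (by fun_prop) (s := chainIdx (a j) (n j) (w j) (m j))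
      (t := chainsIdx m a n w t)
      (fun x y hxy => by
        simp only [Prod.mk.injEq]
        exact ⟨dependsOn_chainSum _ _ _ _ hxy, dependsOn_chain _ _ _ _ hxy⟩)
      (dependsOn_chainsSum t) hdis (by unfold Function.uncurry; fun_prop)
    simp only [mul_assoc]
    rw [this, ← lintegral_mul_const _ (by fun_prop)]
    refine lintegral_congr fun y => ?_
    rw [lintegral_const_mul _ (by fun_prop)]
  have h1 := hfac 1 measurable_const
  simp only [Pi.one_apply, mul_one] at h1
  rw [hfac _ hgm, h1]
  have hch := h.isChain j (long_subset hj)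
  obtain ⟨k, hk⟩ : ∃ k, m j = k + 1 := Nat.exists_eq_succ_of_ne_zero (Finset.mem_filter.1 hj).2
  -- The lower bound on the weight of chain j turns the absolute estimate `hup` into a relative one;
  -- this puts r(δ) into the denominator of B.
  have hlow := hch.smallR_le hδ0
  have hup : ∫⁻ x, ENNReal.ofReal (Real.exp (-chainSum (a j) (n j) (w j) (m j) x / 2)) *
        gapMean D (chain (a j) (n j) (w j) x (m j)) ∂Measure.pi ν ≤
      ENNReal.ofReal (2 / Real.pi * (δ / (δ + 2)) * bigR δ ^ (m j + 1) * bigR (D - 1)) := by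
    rw [hk] at hch ⊢
    exact hch.lintegral_exp_mul_gapMean_le hδ hD
  rw [mul_left_comm]
  gcongr
  refine hup.trans ?_
  refine le_trans (le_of_eq ?_) (mul_le_mul_right hlow _)
  rw [← ENNReal.ofReal_mul (by positivity)]
  congr 1
  field_simp

end IsChainSystem

end System

/-! ### Comparison of the two expectations for a system of chains -/

section System

variable {ι κ : Type*} [Fintype ι] {ν : ι → Measure ℝ} [∀ i, IsProbabilityMeasure (ν i)] {δ : ℝ}
  {Λ : Finset κ} {m : κ → ℕ} {a b : κ → ι} {n w : κ → ℕ → ι} {z : ι}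

lemma integral_exp_eq_toReal {Ω : Type*} [MeasurableSpace Ω] {μ : Measure Ω} {f : Ω → ℝ}
    (hf : Measurable f) :
    ∫ x, Real.exp (f x) ∂μ = (∫⁻ x, ENNReal.ofReal (Real.exp (f x)) ∂μ).toReal :=
  integral_eq_lintegral_of_nonneg_ae (Filter.Eventually.of_forall fun _ => (Real.exp_pos _).le)
    (by fun_prop)

namespace IsChainSystem

/-- The expectation of `exp (-A ^ 2 / 2)`, where `A` is the form of the single chains. -/
lemma lintegral_exp_single (hδ : 0 < δ) (h : IsChainSystem ν δ Λ m a b n w z) :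
    ∫⁻ x, ENNReal.ofReal (Real.exp (-chainsForm m a b n w z (single Λ m) x ^ 2 / 2))
        ∂Measure.pi ν =
      ENNReal.ofReal (chiMoment 1 δ / chiMoment 1 (δ + (single Λ m).card)) := by
  have hD : 0 < δ + (single Λ m).card := by positivity
  have := isProbabilityMeasure_chiLaw hD
  have h1 := h.lintegral_mul_exp_chainsForm (s := single Λ m) single_subset (g := fun _ => 1)
    measurable_const (fun _ _ _ => rfl)
  have h2 := h.lintegral_mul_inv_sqrt hδ (g := fun _ => 1) measurable_const (γ := fun _ => 0)
    measurable_const (fun _ => le_rfl) (fun _ _ _ => rfl) (fun _ _ _ => rfl)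
  simp only [one_mul, add_zero, zero_div, Real.sqrt_one, div_one, ENNReal.ofReal_one,
    lintegral_const, measure_univ, mul_one] at h1 h2
  rw [h1, h2]

lemma chainsEnd_eq (x : ι → ℝ) :
    chainsEnd m a n w Λ x = chainsEnd m a n w (single Λ m) x + chainsEnd m a n w (long Λ m) x :=
  (Finset.sum_filter_add_sum_filter_not Λ _ _).symm

/-- First the coordinates b j are integrated out, then the one-term chains together with z. The
constant in front is the one that also multiplies the expectation with the one-term chains alone, so
it cancels in the ratio. -/
lemma lintegral_exp_sum_form (hδ : 0 < δ) (h : IsChainSystem ν δ Λ m a b n w z) :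
    ∫⁻ x, ENNReal.ofReal (Real.exp (-chainsSum m a n w (long Λ m) x / 2)) *
        ENNReal.ofReal (Real.exp (-chainsForm m a b n w z Λ x ^ 2 / 2)) ∂Measure.pi ν =
      ENNReal.ofReal (chiMoment 1 δ / chiMoment 1 (δ + (single Λ m).card)) *
        ∫⁻ x, ENNReal.ofReal (Real.exp (-chainsSum m a n w (long Λ m) x / 2)) *
          ∫⁻ r, ENNReal.ofReal (1 / √(1 + chainsEnd m a n w (long Λ m) x / r ^ 2))
            ∂chiLaw (δ + (single Λ m).card) ∂Measure.pi ν := by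
  have hdep : DependsOn (fun x => ENNReal.ofReal (Real.exp (-chainsSum m a n w (long Λ m) x / 2)))
      (chainsIdx m a n w (long Λ m)) := by
    intro x y hxy
    have := dependsOn_chainsSum (long Λ m) hxy
    simp only [this]
  rw [h.lintegral_mul_exp_chainsForm subset_rfl (by fun_prop)
    (hdep.mono (chainsIdx_mono long_subset)), ← h.lintegral_mul_inv_sqrt hδ (by fun_prop)
    (by fun_prop) (chainsEnd_nonneg _) hdep (dependsOn_chainsEnd _)]
  exact lintegral_congr fun x => by rw [chainsEnd_eq]

lemma indepFun_single_long (h : IsChainSystem ν δ Λ m a b n w z) :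
    IndepFun (chainsForm m a b n w z (single Λ m)) (chainsSum m a n w (long Λ m))
      (Measure.pi ν) := by
  refine indepFun_of_dependsOn (by fun_prop) (by fun_prop) (dependsOn_chainsForm _)
    (dependsOn_chainsSum _) ?_
  rw [Set.disjoint_union_left]
  refine ⟨h.disjoint_chainsIdx single_subset long_subset disjoint_single_long, ?_⟩
  rw [Set.disjoint_left]
  rintro i (⟨j, hj, rfl⟩ | hi) ⟨j', hj', hi'⟩
  · exact h.b_notMem j (single_subset hj) j' (long_subset hj') hi'
  · rw [Set.mem_singleton_iff.1 hi] at hi'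
    exact h.z_notMem j' (long_subset hj') hi'

lemma lintegral_exp_sum_single (hδ : 0 < δ) (h : IsChainSystem ν δ Λ m a b n w z) :
    ∫⁻ x, ENNReal.ofReal (Real.exp (-chainsSum m a n w (long Λ m) x / 2)) *
        ENNReal.ofReal (Real.exp (-chainsForm m a b n w z (single Λ m) x ^ 2 / 2)) ∂Measure.pi ν =
      ENNReal.ofReal (chiMoment 1 δ / chiMoment 1 (δ + (single Λ m).card)) *
        ∫⁻ x, ENNReal.ofReal (Real.exp (-chainsSum m a n w (long Λ m) x / 2)) ∂Measure.pi ν := by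
  rw [← h.lintegral_exp_single hδ]
  have := lintegral_comp_of_indepFun (by fun_prop) (by fun_prop) h.indepFun_single_long
    (F := fun p q => ENNReal.ofReal (Real.exp (-q / 2)) * ENNReal.ofReal (Real.exp (-p ^ 2 / 2)))
    (by unfold Function.uncurry; fun_prop)
  rw [this, ← lintegral_const_mul _ (by fun_prop)]
  refine lintegral_congr fun y => ?_
  rw [lintegral_const_mul _ (by fun_prop), mul_comm]

/-- The difference between the two expectations, divided by their common factor. -/
lemma lintegral_gap_le (hδ : 2 < δ) (h : IsChainSystem ν δ Λ m a b n w z) {D : ℝ} (hD : δ ≤ D) :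
    ∫⁻ x, ENNReal.ofReal (Real.exp (-chainsSum m a n w (long Λ m) x / 2)) *
        ∫⁻ r, ENNReal.ofReal (gapFun (chainsEnd m a n w (long Λ m) x / r ^ 2)) ∂chiLaw D
          ∂Measure.pi ν ≤
      ENNReal.ofReal (2 / (Real.pi * smallR δ) * (δ / (δ + 2)) *
        (∑ j ∈ long Λ m, bigR δ ^ (m j + 1)) * bigR (D - 1)) *
        ∫⁻ x, ENNReal.ofReal (Real.exp (-chainsSum m a n w (long Λ m) x / 2)) ∂Measure.pi ν := by
  have hgm := measurable_gapMean D (by linarith)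
  have hr := smallR_pos (by linarith : 0 < δ)
  have hR := bigR_pos (by linarith : 0 < δ)
  have hRD := bigR_pos (by linarith : 0 < D - 1)
  -- Subadditivity of `gapFun` separates the contributions of the chains.
  calc _ ≤ ∫⁻ x, ∑ j ∈ long Λ m,
        ENNReal.ofReal (Real.exp (-chainsSum m a n w (long Λ m) x / 2)) *
        gapMean D (chain (a j) (n j) (w j) x (m j)) ∂Measure.pi ν := by
        refine lintegral_mono fun x => ?_
        rw [← Finset.mul_sum]
        gcongr
        unfold gapMean
        rw [← lintegral_finsetSum _ fun j _ => by fun_prop]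
        refine lintegral_mono fun r => ?_
        rw [← ENNReal.ofReal_sum_of_nonneg fun j _ => gapFun_nonneg (by positivity)]
        refine ENNReal.ofReal_le_ofReal ?_
        rw [chainsEnd, Finset.sum_div]
        exact gapFun_sum_le _ _ fun j _ => by positivity
    _ = ∑ j ∈ long Λ m, ∫⁻ x,
        ENNReal.ofReal (Real.exp (-chainsSum m a n w (long Λ m) x / 2)) *
        gapMean D (chain (a j) (n j) (w j) x (m j)) ∂Measure.pi ν :=
        lintegral_finsetSum _ fun j _ => by fun_prop
    _ ≤ ∑ j ∈ long Λ m, ENNReal.ofReal (2 / (Real.pi * smallR δ) * (δ / (δ + 2)) *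
          bigR δ ^ (m j + 1) * bigR (D - 1)) *
        ∫⁻ x, ENNReal.ofReal (Real.exp (-chainsSum m a n w (long Λ m) x / 2)) ∂Measure.pi ν :=
        Finset.sum_le_sum fun j hj => h.lintegral_exp_mul_gapMean_le hδ hD hj
    _ = _ := by
        have : 0 < δ := by linarith
        rw [← Finset.sum_mul, ← ENNReal.ofReal_sum_of_nonneg fun j _ => by positivity,
          Finset.mul_sum, Finset.sum_mul]

lemma integral_exp_sum_pos :
    0 < ∫ x, Real.exp (-chainsSum m a n w (long Λ m) x / 2) ∂Measure.pi ν := by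
  refine integral_exp_pos (Integrable.of_bound (C := 1) (by fun_prop) ?_)
  refine Filter.Eventually.of_forall fun x => ?_
  rw [Real.norm_of_nonneg (Real.exp_pos _).le, Real.exp_le_one_iff]
  have := chainsSum_nonneg (m := m) (a := a) (n := n) (w := w) (long Λ m) x
  linarith

lemma chiMoment_ratio_pos (hδ : 0 < δ) (d : ℕ) : 0 < chiMoment 1 δ / chiMoment 1 (δ + d) :=
  div_pos (chiMoment_pos hδ (by linarith)) (chiMoment_pos (by positivity) (by positivity))

lemma integral_exp_single (hδ : 0 < δ) (h : IsChainSystem ν δ Λ m a b n w z) :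
    ∫ x, Real.exp (-chainsForm m a b n w z (single Λ m) x ^ 2 / 2) ∂Measure.pi ν =
      chiMoment 1 δ / chiMoment 1 (δ + (single Λ m).card) := by
  rw [integral_exp_eq_toReal (by fun_prop), h.lintegral_exp_single hδ,
    ENNReal.toReal_ofReal (chiMoment_ratio_pos hδ _).le]

lemma integral_exp_sum_single (hδ : 0 < δ) (h : IsChainSystem ν δ Λ m a b n w z) :
    ∫ x, Real.exp (-(1 / 2) * (chainsSum m a n w (long Λ m) x +
        chainsForm m a b n w z (single Λ m) x ^ 2)) ∂Measure.pi ν =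
      chiMoment 1 δ / chiMoment 1 (δ + (single Λ m).card) *
        ∫ x, Real.exp (-chainsSum m a n w (long Λ m) x / 2) ∂Measure.pi ν := by
  rw [integral_exp_eq_toReal (by fun_prop), integral_exp_eq_toReal (by fun_prop),
    ← ENNReal.toReal_ofReal (chiMoment_ratio_pos hδ (single Λ m).card).le, ← ENNReal.toReal_mul,
    ← h.lintegral_exp_sum_single hδ]
  congr 1
  refine lintegral_congr fun x => ?_
  rw [← ENNReal.ofReal_mul (Real.exp_pos _).le, ← Real.exp_add]
  congr 2; ring

/-- The relative error of omitting the long chains from the form. -/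
theorem one_sub_ratio_mem_Icc (hδ : 2 < δ) (h : IsChainSystem ν δ Λ m a b n w z) :
    1 - (∫ x, Real.exp (-(1 / 2) * (chainsSum m a n w (long Λ m) x +
          chainsForm m a b n w z Λ x ^ 2)) ∂Measure.pi ν) /
        (∫ x, Real.exp (-(1 / 2) * (chainsSum m a n w (long Λ m) x +
          chainsForm m a b n w z (single Λ m) x ^ 2)) ∂Measure.pi ν) ∈
      Set.Icc 0 (2 / (Real.pi * smallR δ) * (δ / (δ + 2)) *
        (∑ j ∈ long Λ m, bigR δ ^ (m j + 1)) * bigR (δ + (single Λ m).card - 1)) := by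
  have hδ0 : 0 < δ := by linarith
  set D : ℝ := δ + (single Λ m).card with hDdef
  have hD : δ ≤ D := by simp [hDdef]
  have hDpos : 0 < D := by linarith
  have := isProbabilityMeasure_chiLaw hDpos
  have hr := smallR_pos hδ0
  have hR := bigR_pos hδ0
  have hRD := bigR_pos (by linarith : 0 < D - 1)
  have hK := chiMoment_ratio_pos hδ0 (single Λ m).card
  rw [h.integral_exp_sum_single hδ0]
  have hnum : ∫ x, Real.exp (-(1 / 2) * (chainsSum m a n w (long Λ m) x +
          chainsForm m a b n w z Λ x ^ 2)) ∂Measure.pi ν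
      = chiMoment 1 δ / chiMoment 1 D *
        (∫⁻ x, ENNReal.ofReal (Real.exp (-chainsSum m a n w (long Λ m) x / 2)) *
          ∫⁻ r, ENNReal.ofReal (1 / √(1 + chainsEnd m a n w (long Λ m) x / r ^ 2))
            ∂chiLaw D ∂Measure.pi ν).toReal := by
    rw [integral_exp_eq_toReal (by fun_prop), ← ENNReal.toReal_ofReal hK.le, ← ENNReal.toReal_mul,
      ← h.lintegral_exp_sum_form hδ0]
    congr 1
    refine lintegral_congr fun x => ?_
    rw [← ENNReal.ofReal_mul (Real.exp_pos _).le, ← Real.exp_add]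
    congr 2; ring
  rw [hnum]
  set Q := ∫⁻ x, ENNReal.ofReal (Real.exp (-chainsSum m a n w (long Λ m) x / 2)) *
          ∫⁻ r, ENNReal.ofReal (1 / √(1 + chainsEnd m a n w (long Λ m) x / r ^ 2))
            ∂chiLaw D ∂Measure.pi ν with hQ
  set g := ∫⁻ x, ENNReal.ofReal (Real.exp (-chainsSum m a n w (long Λ m) x / 2)) *
        ∫⁻ r, ENNReal.ofReal (gapFun (chainsEnd m a n w (long Λ m) x / r ^ 2)) ∂chiLaw D
          ∂Measure.pi ν with hg
  set P := ∫⁻ x, ENNReal.ofReal (Real.exp (-chainsSum m a n w (long Λ m) x / 2)) ∂Measure.pi ν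
    with hP
  have hm : Measurable fun γ : ℝ => ∫⁻ r, ENNReal.ofReal (1 / √(1 + γ / r ^ 2)) ∂chiLaw D :=
    Measurable.lintegral_prod_right'
      (f := fun x : ℝ × ℝ => ENNReal.ofReal (1 / √(1 + x.1 / x.2 ^ 2))) (by fun_prop)
  have hm' := hm.comp (measurable_chainsEnd (m := m) (a := a) (n := n) (w := w) (long Λ m))
  simp only [Function.comp_def] at hm'
  -- The weight splits pointwise, 1/√(1+y) + gap(y) = 1. The relative error is therefore g/P, with
  -- no approximation up to this point.
  have hsum : Q + g = P := by
    rw [hQ, hg, ← lintegral_add_left (by fun_prop)]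
    refine lintegral_congr fun x => ?_
    rw [← mul_add, ← lintegral_add_left (by fun_prop)]
    have : ∀ r : ℝ, ENNReal.ofReal (1 / √(1 + chainsEnd m a n w (long Λ m) x / r ^ 2)) +
        ENNReal.ofReal (gapFun (chainsEnd m a n w (long Λ m) x / r ^ 2)) = 1 := by
      intro r
      have h0 := chainsEnd_nonneg (m := m) (a := a) (n := n) (w := w) (long Λ m) x
      rw [← ENNReal.ofReal_add (by positivity) (gapFun_nonneg (by positivity)), gapFun]
      simp
    rw [lintegral_congr this, lintegral_one, measure_univ, mul_one]
  have hgle := h.lintegral_gap_le hδ hD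
  rw [← hg, ← hP] at hgle
  have hPle : P ≤ 1 := by
    calc P ≤ ∫⁻ _, 1 ∂Measure.pi ν := by
          refine lintegral_mono fun x => ?_
          rw [ENNReal.ofReal_le_one, Real.exp_le_one_iff]
          have := chainsSum_nonneg (m := m) (a := a) (n := n) (w := w) (long Λ m) x
          linarith
      _ = 1 := by simp
  have hPtop : P ≠ ⊤ := ne_top_of_le_ne_top ENNReal.one_ne_top hPle
  have hQtop : Q ≠ ⊤ := ne_top_of_le_ne_top hPtop (by rw [← hsum]; exact le_self_add)
  have hgtop : g ≠ ⊤ := ne_top_of_le_ne_top hPtop (by rw [← hsum]; exact le_add_self)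
  have hPreal : ∫ x, Real.exp (-chainsSum m a n w (long Λ m) x / 2) ∂Measure.pi ν = P.toReal :=
    integral_exp_eq_toReal (by fun_prop)
  have hPpos : 0 < P.toReal := hPreal ▸ integral_exp_sum_pos
  have hsumR : Q.toReal + g.toReal = P.toReal := by rw [← hsum, ENNReal.toReal_add hQtop hgtop]
  have hB : 0 ≤ 2 / (Real.pi * smallR δ) * (δ / (δ + 2)) *
        (∑ j ∈ long Λ m, bigR δ ^ (m j + 1)) * bigR (D - 1) := by
    have := Real.pi_pos
    positivity
  have hgR := ENNReal.toReal_mono (ENNReal.mul_ne_top ENNReal.ofReal_ne_top hPtop) hgle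
  rw [ENNReal.toReal_mul, ENNReal.toReal_ofReal hB] at hgR
  rw [hPreal, mul_div_mul_left _ _ hK.ne']
  have e : 1 - Q.toReal / P.toReal = g.toReal / P.toReal := by
    rw [← hsumR] at hPpos ⊢
    field_simp
    ring
  rw [e]
  exact ⟨by positivity, by rwa [div_le_iff₀ hPpos]⟩

end IsChainSystem

end System

/-! ### Graphs formed by minimal paths -/

section PathGraph

variable {V : Type*} [Fintype V] {H : SimpleGraph V} {q p : V}

lemma length_eq_ell_add_one (hqp : q ≠ p) (w : H.Path q p) : w.1.length = ell w + 1 := by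
  have h0 : w.1.length ≠ 0 := fun h => hqp (SimpleGraph.Walk.eq_of_length_eq_zero h)
  simp only [ell, interiorVertices, List.length_dropLast, List.length_tail,
    SimpleGraph.Walk.length_support]
  omega

lemma interiorVertices_getElem {w : H.Path q p} {i : ℕ} (hi : i < (interiorVertices w).length) :
    (interiorVertices w)[i] = w.1.getVert (i + 1) := by
  simp only [interiorVertices, List.getElem_dropLast, List.getElem_tail]
  exact SimpleGraph.Walk.support_getElem_eq_getVert _ _

lemma getVert_mem_interiorVertices {w : H.Path q p} {k : ℕ} (h1 : 1 ≤ k) (hk : k ≤ ell w) :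
    w.1.getVert k ∈ interiorVertices w := by
  obtain ⟨i, rfl⟩ : ∃ i, k = i + 1 := ⟨k - 1, by omega⟩
  have hi : i < (interiorVertices w).length := hk
  rw [← interiorVertices_getElem hi]
  exact List.getElem_mem hi

lemma getVert_ne_start (hqp : q ≠ p) {w : H.Path q p} {k : ℕ} (h1 : 1 ≤ k) (hk : k ≤ ell w + 1) :
    w.1.getVert k ≠ q := by
  rw [Ne, w.2.getVert_eq_start_iff (by rw [length_eq_ell_add_one hqp]; exact hk)]
  omega

lemma getVert_ne_end (hqp : q ≠ p) {w : H.Path q p} {k : ℕ} (hk : k ≤ ell w) :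
    w.1.getVert k ≠ p := by
  rw [Ne, w.2.getVert_eq_end_iff (by rw [length_eq_ell_add_one hqp]; omega),
    length_eq_ell_add_one hqp]
  omega

lemma getVert_ell_add_one (hqp : q ≠ p) (w : H.Path q p) : w.1.getVert (ell w + 1) = p := by
  rw [← length_eq_ell_add_one hqp, SimpleGraph.Walk.getVert_length]

lemma adj_getVert (hqp : q ≠ p) (w : H.Path q p) {k : ℕ} (hk : k ≤ ell w) :
    H.Adj (w.1.getVert k) (w.1.getVert (k + 1)) :=
  w.1.adj_getVert_succ (by rw [length_eq_ell_add_one hqp]; omega)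

lemma one_le_ell (hqp : q ≠ p) (hadj : ¬ H.Adj q p) (w : H.Path q p) : 1 ≤ ell w := by
  by_contra h
  have h0 : ell w = 0 := by omega
  have := adj_getVert hqp w (Nat.zero_le _)
  rw [SimpleGraph.Walk.getVert_zero, ← h0, getVert_ell_add_one hqp] at this
  exact hadj this

variable [LinearOrder V]

namespace IsPathOrder

lemma getVert_lt (h : IsPathOrder H q p) {w : H.Path q p} (hw : w ∈ minimalPaths H q p) {j k : ℕ}
    (h1 : 1 ≤ j) (hjk : j < k) (hk : k ≤ ell w) : w.1.getVert j < w.1.getVert k := by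
  obtain ⟨i, rfl⟩ : ∃ i, j = i + 1 := ⟨j - 1, by omega⟩
  obtain ⟨l, rfl⟩ : ∃ l, k = l + 1 := ⟨k - 1, by omega⟩
  have hl : l < (interiorVertices w).length := hk
  have hi : i < (interiorVertices w).length := by omega
  rw [← interiorVertices_getElem hi, ← interiorVertices_getElem hl]
  exact List.pairwise_iff_getElem.1 (h.along w hw) i l hi hl (by omega)

lemma getVert_lt_start (h : IsPathOrder H q p) {w : H.Path q p} {k : ℕ} (h1 : 1 ≤ k)
    (hk : k ≤ ell w) : w.1.getVert k < q :=
  lt_of_le_of_ne (h.le_q _ (getVert_ne_end h.q_lt_p.ne hk))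
    (getVert_ne_start h.q_lt_p.ne h1 (by omega))

/-- Distinct paths occupy separated blocks of the numbering, so an interior vertex determines both
its path and its place on it. -/
lemma path_unique (h : IsPathOrder H q p) {w w' : H.Path q p} (hw : w ∈ minimalPaths H q p)
    (hw' : w' ∈ minimalPaths H q p) {k k' : ℕ} (h1 : 1 ≤ k) (hk : k ≤ ell w) (h1' : 1 ≤ k')
    (hk' : k' ≤ ell w') (e : w.1.getVert k = w'.1.getVert k') : w = w' ∧ k = k' := by
  have hww : w = w' := by
    by_contra hne
    have m := getVert_mem_interiorVertices h1 hk
    have m' := getVert_mem_interiorVertices h1' hk'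
    rcases h.blocks w hw w' hw' hne with hb | hb
    · exact (hb _ m _ m').ne e
    · exact (hb _ m _ m').ne' e
  subst hww
  refine ⟨rfl, w.2.getVert_injOn ?_ ?_ e⟩ <;>
  · simp only [Set.mem_ofPred_eq, length_eq_ell_add_one h.q_lt_p.ne]; omega

lemma exists_getVert (h : IsPathOrder H q p) (hu : IsUnionOfMinimalPaths H q p) {v : V}
    (hv : v < q) : ∃ w ∈ minimalPaths H q p, ∃ k, 1 ≤ k ∧ k ≤ ell w ∧ w.1.getVert k = v := by
  rcases hu.1 v with rfl | rfl | ⟨w, hw, hm⟩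
  · exact absurd hv (lt_irrefl _)
  · exact absurd (hv.trans h.q_lt_p) (lt_irrefl _)
  · obtain ⟨k, hk, hkl⟩ := SimpleGraph.Walk.mem_support_iff_exists_getVert.1 hm
    rw [length_eq_ell_add_one h.q_lt_p.ne] at hkl
    refine ⟨w, hw, k, ?_, ?_, hk⟩
    · by_contra h0
      obtain rfl : k = 0 := by omega
      rw [SimpleGraph.Walk.getVert_zero] at hk
      exact hv.ne hk.symm
    · by_contra h0
      obtain rfl : k = ell w + 1 := by omega
      rw [getVert_ell_add_one h.q_lt_p.ne] at hk
      exact (hv.trans h.q_lt_p).ne hk.symm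

/-- Every edge lies on a minimal path, and by `path_unique` an edge at an interior vertex lies on
the path of that vertex. -/
lemma eq_of_adj_getVert (h : IsPathOrder H q p) (hu : IsUnionOfMinimalPaths H q p)
    {w : H.Path q p} (hw : w ∈ minimalPaths H q p) {k : ℕ} (h1 : 1 ≤ k) (hk : k ≤ ell w) {u : V}
    (ha : H.Adj (w.1.getVert k) u) : u = w.1.getVert (k - 1) ∨ u = w.1.getVert (k + 1) := by
  obtain ⟨w', hw', he⟩ := hu.2 s(w.1.getVert k, u) ha
  obtain ⟨i, hi, e⟩ := w'.1.mk_mem_edges_iff_exists.1 he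
  rw [length_eq_ell_add_one h.q_lt_p.ne] at hi
  have hq := (h.getVert_lt_start h1 hk)
  have key : ∀ j, j ≤ ell w' + 1 → w'.1.getVert j = w.1.getVert k → w = w' ∧ k = j := by
    intro j hj ej
    refine h.path_unique hw hw' h1 hk ?_ ?_ ej.symm
    · by_contra h0
      obtain rfl : j = 0 := by omega
      rw [SimpleGraph.Walk.getVert_zero] at ej
      exact hq.ne ej.symm
    · by_contra h0
      obtain rfl : j = ell w' + 1 := by omega
      rw [getVert_ell_add_one h.q_lt_p.ne] at ej
      exact (hq.trans h.q_lt_p).ne ej.symm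
  rcases Sym2.eq_iff.1 e with ⟨e1, e2⟩ | ⟨e1, e2⟩
  · obtain ⟨rfl, rfl⟩ := key i (by omega) e1
    exact Or.inr e2.symm
  · obtain ⟨rfl, rfl⟩ := key (i + 1) (by omega) e2
    exact Or.inl e1.symm

lemma eq_of_adj_getVert_of_lt (h : IsPathOrder H q p) (hu : IsUnionOfMinimalPaths H q p)
    {w : H.Path q p} (hw : w ∈ minimalPaths H q p) {k : ℕ} (h1 : 1 ≤ k) (hk : k ≤ ell w) {u : V}
    (ha : H.Adj (w.1.getVert k) u) (hlt : w.1.getVert k < u) :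
    u = w.1.getVert (k + 1) ∨ (k = 1 ∧ u = q) := by
  rcases h.eq_of_adj_getVert hu hw h1 hk ha with e | e
  · rcases Nat.lt_or_ge 1 k with h2 | h2
    · exact absurd hlt (e ▸ (h.getVert_lt hw (by omega) (by omega) hk).not_gt)
    · obtain rfl : k = 1 := by omega
      exact Or.inr ⟨rfl, by simpa using e⟩
  · exact Or.inl e

/-- The only later neighbours of an interior vertex are its successor and, for the first one, q.
This is what prevents fill-in outside the column of q. -/
lemma eq_of_adj_of_lt (h : IsPathOrder H q p) (hu : IsUnionOfMinimalPaths H q p) {r u v : V}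
    (hr : r < q) (hru : r < u) (hau : H.Adj r u) (huq : u ≠ q) (hrv : r < v) (hav : H.Adj r v)
    (hvq : v ≠ q) : u = v := by
  obtain ⟨w, hw, k, h1, hk, rfl⟩ := h.exists_getVert hu hr
  rcases h.eq_of_adj_getVert_of_lt hu hw h1 hk hau hru with e | e
  · rcases h.eq_of_adj_getVert_of_lt hu hw h1 hk hav hrv with e' | e'
    · rw [e, e']
    · exact absurd e'.2 hvq
  · exact absurd e.2 huq

lemma adj_getVert_start_iff (h : IsPathOrder H q p) (hu : IsUnionOfMinimalPaths H q p)
    {w : H.Path q p} (hw : w ∈ minimalPaths H q p) {k : ℕ} (h1 : 1 ≤ k) (hk : k ≤ ell w) :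
    H.Adj (w.1.getVert k) q ↔ k = 1 := by
  constructor
  · intro ha
    rcases h.eq_of_adj_getVert_of_lt hu hw h1 hk ha (h.getVert_lt_start h1 hk) with e | e
    · exact absurd e.symm (getVert_ne_start h.q_lt_p.ne (by omega) (by omega))
    · exact e.1
  · rintro rfl
    have := (adj_getVert h.q_lt_p.ne w (Nat.zero_le _)).symm
    simpa using this

lemma getVert_lt_succ (h : IsPathOrder H q p) {w : H.Path q p} (hw : w ∈ minimalPaths H q p) {k : ℕ}
    (h1 : 1 ≤ k) (hk : k ≤ ell w) : w.1.getVert k < w.1.getVert (k + 1) := by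
  rcases hk.lt_or_eq with hk' | rfl
  · exact h.getVert_lt hw h1 (by omega) hk'
  · rw [getVert_ell_add_one h.q_lt_p.ne]
    exact (h.getVert_lt_start h1 hk).trans h.q_lt_p

/-- From the second interior vertex on, only the successor is a later neighbour, so the diagonal
entries that enter the chains have δ+1 degrees of freedom. The first interior vertex also sees q,
but its diagonal entry occurs in no chain. -/
lemma nu_getVert (h : IsPathOrder H q p) (hu : IsUnionOfMinimalPaths H q p) {w : H.Path q p}
    (hw : w ∈ minimalPaths H q p) {k : ℕ} (h1 : 2 ≤ k) (hk : k ≤ ell w) :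
    nu H (w.1.getVert k) = 1 := by
  rw [nu, Finset.card_eq_one]
  refine ⟨w.1.getVert (k + 1), ?_⟩
  ext u
  simp only [Finset.mem_filter, Finset.mem_univ, true_and, Finset.mem_singleton]
  constructor
  · rintro ⟨hlt, ha⟩
    rcases h.eq_of_adj_getVert_of_lt hu hw (by omega) hk ha hlt with e | e
    · exact e
    · omega
  · rintro rfl
    exact ⟨h.getVert_lt_succ hw (by omega) hk, adj_getVert h.q_lt_p.ne w hk⟩

lemma eq_end_of_start_lt (h : IsPathOrder H q p) {v : V} (hv : q < v) : v = p := by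
  by_contra hne
  exact absurd (h.le_q v hne) (not_le.2 hv)

lemma nu_start (h : IsPathOrder H q p) (hadj : ¬ H.Adj q p) : nu H q = 0 := by
  rw [nu, Finset.card_eq_zero, Finset.filter_eq_empty_iff]
  rintro u - ⟨hlt, ha⟩
  rw [h.eq_end_of_start_lt hlt] at ha
  exact hadj ha

end IsPathOrder

end PathGraph

/-! ### The completed upper triangular matrix -/

section Psi

variable {V : Type*} [Fintype V] [LinearOrder V] {G H : SimpleGraph V} {q p : V}

/-- The position `(i, j)` if it is free, and the diagonal position `(i, i)` otherwise. -/
def freeIdx (G : SimpleGraph V) (i j : V) : FreeIdx G :=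
  if h : i = j ∨ (i < j ∧ G.Adj i j) then ⟨(i, j), h⟩ else ⟨(i, i), Or.inl rfl⟩

lemma freeIdx_val {i j : V} (h : i = j ∨ (i < j ∧ G.Adj i j)) : (freeIdx G i j).1 = (i, j) :=
  congrArg Subtype.val (dif_pos h)

lemma freeIdx_self_val (i : V) : (freeIdx G i i).1 = (i, i) := freeIdx_val (Or.inl rfl)

lemma freeIdx_adj_val {i j : V} (hij : i < j) (h : G.Adj i j) : (freeIdx G i j).1 = (i, j) :=
  freeIdx_val (Or.inr ⟨hij, h⟩)

lemma freeIdx_eq (ij : FreeIdx G) : freeIdx G ij.1.1 ij.1.2 = ij :=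
  Subtype.ext (freeIdx_val ij.2)

lemma psi_of_free (x : FreeIdx G → ℝ) {i j : V} (h : i = j ∨ (i < j ∧ G.Adj i j)) :
    psi G x i j = x (freeIdx G i j) := by
  rw [psi, dif_pos h]
  exact congrArg x (dif_pos h).symm

lemma psi_self (x : FreeIdx G → ℝ) (i : V) : psi G x i i = x (freeIdx G i i) :=
  psi_of_free x (Or.inl rfl)

lemma psi_adj (x : FreeIdx G → ℝ) {i j : V} (hij : i < j) (h : G.Adj i j) :
    psi G x i j = x (freeIdx G i j) :=
  psi_of_free x (Or.inr ⟨hij, h⟩)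

lemma psi_of_gt (x : FreeIdx G → ℝ) {i j : V} (hij : j < i) : psi G x i j = 0 := by
  rw [psi, dif_neg, if_neg hij.not_gt]
  rintro (h | h)
  · exact hij.ne' h
  · exact hij.not_gt h.1

lemma psi_missing (x : FreeIdx G → ℝ) {i j : V} (hij : i < j) (h : ¬ G.Adj i j) :
    psi G x i j = -(∑ r ∈ Finset.univ.filter (· < i), psi G x r i * psi G x r j) /
      x (freeIdx G i i) := by
  have h' : ¬ (i = j ∨ (i < j ∧ G.Adj i j)) := by
    rintro (h1 | h1)
    · exact hij.ne h1
    · exact h h1.2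
  rw [psi, dif_neg h', if_pos hij, Finset.sum_subtype (Finset.univ.filter (· < i)) (p := (· < i))
    (by simp)]
  exact congrArg (fun t => _ / x t) (dif_pos (Or.inl rfl)).symm

/-- A product ψ_rv ψ_rj in the completion formula can only survive if r is adjacent to both v and j.
These would be two distinct later neighbours of r other than q; otherwise one factor vanishes by
induction. -/
lemma psi_eq_zero (hord : IsPathOrder H q p) (hu : IsUnionOfMinimalPaths H q p)
    (x : FreeIdx H → ℝ) {v j : V} (hv : v < q) (hvj : v < j) (hj : j ≠ q)
    (ha : ¬ H.Adj v j) : psi H x v j = 0 := by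
  induction v using WellFoundedLT.induction generalizing j with
  | ind v ih =>
    rw [psi_missing x hvj ha, Finset.sum_eq_zero, neg_zero, zero_div]
    intro r hr
    have hr : r < v := by simpa using hr
    by_cases h1 : H.Adj r v
    · by_cases h2 : H.Adj r j
      · exact absurd (hord.eq_of_adj_of_lt hu (hr.trans hv) hr h1 hv.ne (hr.trans hvj) h2 hj) hvj.ne
      · rw [ih r hr (hr.trans hv) (hr.trans hvj) hj h2, mul_zero]
    · rw [ih r hr (hr.trans hv) hr hv.ne h1, zero_mul]

/-- By `psi_eq_zero` only an earlier neighbour of the vertex contributes to the sum, and this is its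
predecessor on the path. -/
lemma psi_getVert_start_succ (hord : IsPathOrder H q p) (hu : IsUnionOfMinimalPaths H q p)
    (x : FreeIdx H → ℝ) {w : H.Path q p} (hw : w ∈ minimalPaths H q p)
    {k : ℕ} (h1 : 1 ≤ k) (hk : k < ell w) :
    psi H x (w.1.getVert (k + 1)) q =
      -(x (freeIdx H (w.1.getVert k) (w.1.getVert (k + 1))) * psi H x (w.1.getVert k) q) /
        x (freeIdx H (w.1.getVert (k + 1)) (w.1.getVert (k + 1))) := by
  have hlt := hord.getVert_lt_succ hw h1 hk.le
  have hlq := hord.getVert_lt_start (w := w) (k := k + 1) (by omega) (by omega)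
  rw [psi_missing x hlq, Finset.sum_eq_single (w.1.getVert k),
    psi_adj x hlt (adj_getVert hord.q_lt_p.ne w hk.le)]
  · intro r hr hne
    have hr : r < w.1.getVert (k + 1) := by simpa using hr
    rw [psi_eq_zero hord hu x (hr.trans hlq) hr hlq.ne, zero_mul]
    intro ha
    rcases hord.eq_of_adj_getVert hu hw (by omega) (by omega) ha.symm with e | e
    · exact hne (by simpa using e)
    · refine absurd hr (e ▸ (hord.getVert_lt_succ hw (by omega) (by omega)).not_gt)
  · intro h
    exact absurd (by simpa using hlt) h
  · rw [hord.adj_getVert_start_iff hu hw (by omega) (by omega)]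
    omega

/-- The entry ψ_rp with r < q is nonzero only if r is adjacent to p, hence only if r is the last
interior vertex of a path. -/
lemma psi_start_end (hord : IsPathOrder H q p) (hu : IsUnionOfMinimalPaths H q p)
    (hadj : ¬ H.Adj q p) (x : FreeIdx H → ℝ) :
    psi H x q p = -(∑ w ∈ minimalPaths H q p, psi H x (w.1.getVert (ell w)) q *
      psi H x (w.1.getVert (ell w)) p) / x (freeIdx H q q) := by
  have hqp := hord.q_lt_p.ne
  have hl := one_le_ell hqp hadj
  rw [psi_missing x hord.q_lt_p hadj]
  congr 2
  symm
  refine Finset.sum_of_injOn (fun w : H.Path q p => w.1.getVert (ell w)) ?_ ?_ ?_ fun _ _ => rfl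
  · intro w hw w' hw' e
    exact (hord.path_unique hw hw' (hl w) le_rfl (hl w') le_rfl e).1
  · intro w _
    simpa using hord.getVert_lt_start (hl w) le_rfl
  · intro r hr hn
    have hr : r < q := by simpa using hr
    rw [psi_eq_zero hord hu x hr (hr.trans hord.q_lt_p) hqp.symm, mul_zero]
    intro ha
    obtain ⟨w, hw, k, h1, hk, rfl⟩ := hord.exists_getVert hu hr
    refine hn ⟨w, hw, ?_⟩
    rcases hord.eq_of_adj_getVert_of_lt hu hw h1 hk ha (hr.trans hord.q_lt_p) with e | e
    · have := (w.2.getVert_eq_end_iff (by rw [length_eq_ell_add_one hqp]; omega)).1 e.symm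
      rw [length_eq_ell_add_one hqp] at this
      simp only
      congr 1
      omega
    · exact absurd e.2 hqp.symm

/-- The chain of the path `w`: its terms are the entries `psi (k_w, q)`. -/
lemma chain_eq_psi (hord : IsPathOrder H q p) (hu : IsUnionOfMinimalPaths H q p)
    (hadj : ¬ H.Adj q p) (x : FreeIdx H → ℝ) {w : H.Path q p}
    (hw : w ∈ minimalPaths H q p) {k : ℕ} (hk : k < ell w) :
    chain (freeIdx H (w.1.getVert 1) q)
      (fun k => freeIdx H (w.1.getVert (k + 1)) (w.1.getVert (k + 2)))
      (fun k => freeIdx H (w.1.getVert (k + 2)) (w.1.getVert (k + 2))) x k =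
      psi H x (w.1.getVert (k + 1)) q := by
  induction k with
  | zero =>
    have hl := one_le_ell hord.q_lt_p.ne hadj w
    rw [chain, psi_adj x (hord.getVert_lt_start le_rfl hl)
      ((hord.adj_getVert_start_iff hu hw le_rfl hl).2 rfl)]
  | succ k ih =>
    rw [chain, ih (by omega),
      psi_getVert_start_succ hord hu x hw (k := k + 1) (by omega) (by omega)]

lemma sum_missing_eq (hord : IsPathOrder H q p) (hu : IsUnionOfMinimalPaths H q p)
    (hadj : ¬ H.Adj q p) (x : FreeIdx H → ℝ) :
    ∑ ij ∈ Finset.univ.filter (fun ij : V × V => (ij.1 < ij.2 ∧ ¬ H.Adj ij.1 ij.2) ∧ ij ≠ (q, p)),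
        psi H x ij.1 ij.2 ^ 2 =
      ∑ w ∈ minimalPaths H q p, ∑ k ∈ Finset.range (ell w - 1),
        psi H x (w.1.getVert (k + 2)) q ^ 2 := by
  rw [Finset.sum_sigma']
  symm
  -- The missing pairs with a possibly nonzero entry are those of q with an interior vertex number
  -- k+2 of a path: the first interior vertex is adjacent to q, and all other columns vanish.
  refine Finset.sum_of_injOn (fun wk : (_ : H.Path q p) × ℕ => (wk.1.1.getVert (wk.2 + 2), q))
    ?_ ?_ ?_ fun _ _ => rfl
  · rintro ⟨w, k⟩ hw ⟨w', k'⟩ hw' e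
    simp only [Finset.coe_sigma, Set.mem_sigma_iff, Finset.mem_coe, Finset.mem_range] at hw hw'
    obtain ⟨rfl, ek⟩ := hord.path_unique hw.1 hw'.1 (k := k + 2) (k' := k' + 2) (by omega)
      (by omega) (by omega) (by omega) (Prod.ext_iff.1 e).1
    simpa using ek
  · rintro ⟨w, k⟩ hw
    simp only [Finset.coe_sigma, Set.mem_sigma_iff, Finset.mem_coe, Finset.mem_range] at hw
    have hlt := hord.getVert_lt_start (w := w) (k := k + 2) (by omega) (by omega)
    simp only [Finset.coe_filter, Finset.mem_univ, true_and, Set.mem_ofPred_eq, hlt,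
      hord.adj_getVert_start_iff hu hw.1 (k := k + 2) (by omega) (by omega)]
    refine ⟨by omega, fun e => hlt.ne (Prod.ext_iff.1 e).1⟩
  · rintro ⟨i, j⟩ hij hn
    simp only [Finset.mem_filter, Finset.mem_univ, true_and] at hij
    obtain ⟨⟨hij, ha⟩, hne⟩ := hij
    have hiq : i < q := by
      by_contra h
      rcases (not_lt.1 h).eq_or_lt with rfl | h
      · exact hne (by rw [hord.eq_end_of_start_lt hij])
      · have hi := hord.eq_end_of_start_lt h
        have hj := hord.eq_end_of_start_lt (h.trans hij)
        exact hij.ne (hi.trans hj.symm)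
    by_cases hj : j = q
    · subst hj
      obtain ⟨w, hw, k, h1, hk, rfl⟩ := hord.exists_getVert hu hiq
      refine absurd ⟨⟨w, k - 2⟩, ?_, ?_⟩ hn
      · have : k ≠ 1 := fun h => ha ((hord.adj_getVert_start_iff hu hw h1 hk).2 h)
        simp only [Finset.coe_sigma, Set.mem_sigma_iff, Finset.mem_coe, Finset.mem_range]
        exact ⟨hw, by omega⟩
      · have : k ≠ 1 := fun h => ha ((hord.adj_getVert_start_iff hu hw h1 hk).2 h)
        simp only
        congr 2
        omega
    · rw [psi_eq_zero hord hu x hiq hij hj ha]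
      simp

end Psi

/-! ### The chains of a graph formed by minimal paths -/

section PathChains

variable {V : Type*} [Fintype V] [LinearOrder V] {G H : SimpleGraph V} {q p : V} {δ : ℝ}

/-- The law of the free entry `ψ_ij`. -/
def entryLaw (G : SimpleGraph V) (δ : ℝ) (ij : FreeIdx G) : Measure ℝ :=
  if ij.1.1 = ij.1.2 then chiLaw (δ + nu G ij.1.1) else gaussianReal 0 1

lemma psiLaw_eq_pi (G : SimpleGraph V) (δ : ℝ) : psiLaw G δ = Measure.pi (entryLaw G δ) := rfl

lemma isProbabilityMeasure_entryLaw (hδ : 0 < δ) (ij : FreeIdx G) :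
    IsProbabilityMeasure (entryLaw G δ ij) := by
  unfold entryLaw
  split_ifs
  · exact isProbabilityMeasure_chiLaw (by positivity)
  · infer_instance

lemma entryLaw_self (i : V) : entryLaw G δ (freeIdx G i i) = chiLaw (δ + nu G i) := by
  rw [entryLaw, freeIdx_self_val, if_pos rfl]

lemma entryLaw_adj {i j : V} (hij : i < j) (h : G.Adj i j) :
    entryLaw G δ (freeIdx G i j) = gaussianReal 0 1 := by
  rw [entryLaw, freeIdx_adj_val hij h, if_neg hij.ne]

/-- The position `(1_w, q)`. -/
def startIdx (w : H.Path q p) : FreeIdx H := freeIdx H (w.1.getVert 1) q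

/-- The position `(ℓ_w, p)`. -/
def endIdx (w : H.Path q p) : FreeIdx H := freeIdx H (w.1.getVert (ell w)) p

/-- The position of the edge of `w` between the interior vertices number `k + 1` and `k + 2`. -/
def edgeIdx (w : H.Path q p) (k : ℕ) : FreeIdx H :=
  freeIdx H (w.1.getVert (k + 1)) (w.1.getVert (k + 2))

/-- The diagonal position of the interior vertex number `k + 2` of `w`. -/
def diagIdx (w : H.Path q p) (k : ℕ) : FreeIdx H :=
  freeIdx H (w.1.getVert (k + 2)) (w.1.getVert (k + 2))

lemma startIdx_val (hord : IsPathOrder H q p)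
    (hu : IsUnionOfMinimalPaths H q p)
    (hadj : ¬ H.Adj q p)
    {w : H.Path q p} (hw : w ∈ minimalPaths H q p) :
    (startIdx w).1 = (w.1.getVert 1, q) :=
  have hl := one_le_ell hord.q_lt_p.ne hadj w
  freeIdx_adj_val (hord.getVert_lt_start le_rfl hl)
    ((hord.adj_getVert_start_iff hu hw le_rfl hl).2 rfl)

lemma adj_getVert_ell (hord : IsPathOrder H q p) (hadj : ¬ H.Adj q p)
    (w : H.Path q p) :
    w.1.getVert (ell w) < p ∧ H.Adj (w.1.getVert (ell w)) p := by
  have hl := one_le_ell hord.q_lt_p.ne hadj w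
  refine ⟨(hord.getVert_lt_start hl le_rfl).trans hord.q_lt_p, ?_⟩
  have := adj_getVert hord.q_lt_p.ne w le_rfl
  rwa [getVert_ell_add_one hord.q_lt_p.ne] at this

lemma endIdx_val (hord : IsPathOrder H q p) (hadj : ¬ H.Adj q p)
    (w : H.Path q p) : (endIdx w).1 = (w.1.getVert (ell w), p) :=
  freeIdx_adj_val (adj_getVert_ell hord hadj w).1 (adj_getVert_ell hord hadj w).2

lemma edgeIdx_val (hord : IsPathOrder H q p)
    {w : H.Path q p} (hw : w ∈ minimalPaths H q p) {k : ℕ} (hk : k < ell w - 1) :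
    (edgeIdx w k).1 = (w.1.getVert (k + 1), w.1.getVert (k + 2)) :=
  freeIdx_adj_val (hord.getVert_lt_succ hw (by omega) (by omega))
    (adj_getVert hord.q_lt_p.ne w (by omega))

/-- Columns tell the steps of a chain apart and separate it from the entries (ℓ_w, p); rows, in the
next lemma, tell different paths apart and separate them from the entry (q, q). -/
lemma snd_of_mem_chainIdx (hord : IsPathOrder H q p)
    (hu : IsUnionOfMinimalPaths H q p)
    (hadj : ¬ H.Adj q p)
    {w : H.Path q p} (hw : w ∈ minimalPaths H q p) {m : ℕ}
    (hm : m ≤ ell w - 1) {i : FreeIdx H} (hi : i ∈ chainIdx (startIdx w) (edgeIdx w) (diagIdx w) m) :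
    i.1.2 = q ∨ ∃ k, 2 ≤ k ∧ k < m + 2 ∧ i.1.2 = w.1.getVert k := by
  rcases hi with rfl | ⟨k, hk, rfl | rfl⟩
  · exact Or.inl (by rw [startIdx_val hord hu hadj hw])
  · exact Or.inr ⟨k + 2, by omega, by omega, by rw [edgeIdx_val hord hw (by omega)]⟩
  · exact Or.inr ⟨k + 2, by omega, by omega, by rw [diagIdx, freeIdx_self_val]⟩

lemma fst_of_mem_chainIdx (hord : IsPathOrder H q p)
    (hu : IsUnionOfMinimalPaths H q p)
    (hadj : ¬ H.Adj q p)
    {w : H.Path q p} (hw : w ∈ minimalPaths H q p) {i : FreeIdx H}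
    (hi : i ∈ chainIdx (startIdx w) (edgeIdx w) (diagIdx w) (ell w - 1)) :
    ∃ k, 1 ≤ k ∧ k ≤ ell w ∧ i.1.1 = w.1.getVert k := by
  rcases hi with rfl | ⟨k, hk, rfl | rfl⟩
  · exact ⟨1, le_rfl, one_le_ell hord.q_lt_p.ne hadj w, by rw [startIdx_val hord hu hadj hw]⟩
  · exact ⟨k + 1, by omega, by omega, by rw [edgeIdx_val hord hw (by omega)]⟩
  · exact ⟨k + 2, by omega, by omega, by rw [diagIdx, freeIdx_self_val]⟩

lemma isChain_path (hord : IsPathOrder H q p)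
    (hu : IsUnionOfMinimalPaths H q p)
    (hadj : ¬ H.Adj q p)
    {w : H.Path q p} (hw : w ∈ minimalPaths H q p) :
    IsChain (entryLaw H δ) δ (startIdx w) (edgeIdx w) (diagIdx w) (ell w - 1) := by
  have hl := one_le_ell hord.q_lt_p.ne hadj w
  -- Both new coordinates of step k lie in the column of vertex k+2, while the earlier ones lie in
  -- the column of q or of a vertex of smaller number.
  have fresh : ∀ k < ell w - 1, ∀ i : FreeIdx H, i.1.2 = w.1.getVert (k + 2) →
      i ∉ chainIdx (startIdx w) (edgeIdx w) (diagIdx w) k := by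
    intro k hk i hi hmem
    rcases snd_of_mem_chainIdx hord hu hadj hw (by omega) hmem with e | ⟨j, h2, hj, e⟩
    · exact (hord.getVert_lt_start (w := w) (k := k + 2) (by omega) (by omega)).ne (hi ▸ e)
    · exact (hord.getVert_lt hw (j := j) (k := k + 2) (by omega) hj (by omega)).ne
        (e.symm.trans hi)
  refine ⟨?_, fun k hk => ?_, fun k hk => ?_, fun k hk e => ?_, fun k hk => ?_, fun k hk => ?_⟩
  · exact entryLaw_adj (hord.getVert_lt_start le_rfl hl)
      ((hord.adj_getVert_start_iff hu hw le_rfl hl).2 rfl)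
  · exact entryLaw_adj (hord.getVert_lt_succ hw (by omega) (by omega))
      (adj_getVert hord.q_lt_p.ne w (by omega))
  · rw [diagIdx, entryLaw_self, hord.nu_getVert hu hw (by omega) (by omega), Nat.cast_one]
  · have e1 := congrArg (fun i : FreeIdx H => i.1.1) e
    simp only [edgeIdx_val hord hw hk, diagIdx, freeIdx_self_val] at e1
    exact (hord.getVert_lt_succ hw (k := k + 1) (by omega) (by omega)).ne e1
  · exact fresh k hk _ (by rw [edgeIdx_val hord hw hk])
  · exact fresh k hk _ (by rw [diagIdx, freeIdx_self_val])

/-- The minimal paths give a system of independent chains. -/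
lemma isChainSystem_minimalPaths (hord : IsPathOrder H q p)
    (hu : IsUnionOfMinimalPaths H q p)
    (hadj : ¬ H.Adj q p) :
    IsChainSystem (entryLaw H δ) δ (minimalPaths H q p) (fun w => ell w - 1) startIdx endIdx
      edgeIdx diagIdx (freeIdx H q q) where
  isChain w hw := isChain_path hord hu hadj hw
  disj w hw w' hw' hne := by
    rw [Set.disjoint_left]
    intro i hi hi'
    obtain ⟨k, h1, hk, e⟩ := fst_of_mem_chainIdx hord hu hadj hw hi
    obtain ⟨k', h1', hk', e'⟩ := fst_of_mem_chainIdx hord hu hadj hw' hi'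
    exact hne (hord.path_unique hw hw' h1 hk h1' hk' (e.symm.trans e')).1
  law_b w _ := entryLaw_adj (adj_getVert_ell hord hadj w).1 (adj_getVert_ell hord hadj w).2
  b_inj w hw w' hw' e := by
    have e1 := congrArg (fun i : FreeIdx H => i.1.1) e
    simp only [endIdx_val hord hadj] at e1
    exact (hord.path_unique hw hw' (one_le_ell hord.q_lt_p.ne hadj w) le_rfl
      (one_le_ell hord.q_lt_p.ne hadj w') le_rfl e1).1
  b_notMem w hw w' hw' hi := by
    have hl := one_le_ell hord.q_lt_p.ne hadj w'
    rcases snd_of_mem_chainIdx hord hu hadj hw' le_rfl hi with e | ⟨k, h2, hk, e⟩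
    · rw [endIdx_val hord hadj] at e
      exact hord.q_lt_p.ne' e
    · rw [endIdx_val hord hadj] at e
      exact getVert_ne_end hord.q_lt_p.ne (w := w') (k := k) (by omega) e.symm
  law_z := by rw [entryLaw_self, hord.nu_start hadj, Nat.cast_zero, add_zero]
  z_notMem w hw hi := by
    obtain ⟨k, h1, hk, e⟩ := fst_of_mem_chainIdx hord hu hadj hw hi
    rw [freeIdx_self_val] at e
    exact (hord.getVert_lt_start h1 hk).ne e.symm
  z_ne_b w _ e := by
    have e1 := congrArg (fun i : FreeIdx H => i.1.2) e
    simp only [endIdx_val hord hadj, freeIdx_self_val] at e1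
    exact hord.q_lt_p.ne' e1

lemma single_minimalPaths (hord : IsPathOrder H q p) (hadj : ¬ H.Adj q p) :
    IsChainSystem.single (minimalPaths H q p) (fun w => ell w - 1) = pathsOfLengthTwo H q p := by
  refine Finset.filter_congr fun w _ => ?_
  have := one_le_ell hord.q_lt_p.ne hadj w
  simp only
  omega

lemma long_minimalPaths (hord : IsPathOrder H q p) (hadj : ¬ H.Adj q p) :
    IsChainSystem.long (minimalPaths H q p) (fun w => ell w - 1) = pathsTwoPlus H q p := by
  refine Finset.filter_congr fun w _ => ?_
  have := one_le_ell hord.q_lt_p.ne hadj w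
  simp only
  omega

lemma chain_path (hord : IsPathOrder H q p) (hu : IsUnionOfMinimalPaths H q p) (hadj : ¬ H.Adj q p)
    (x : FreeIdx H → ℝ) {w : H.Path q p} (hw : w ∈ minimalPaths H q p) :
    chain (startIdx w) (edgeIdx w) (diagIdx w) x (ell w - 1) = psi H x (w.1.getVert (ell w)) q := by
  have hl := one_le_ell hord.q_lt_p.ne hadj w
  have := chain_eq_psi hord hu hadj x hw (k := ell w - 1) (by omega)
  rwa [Nat.sub_add_cancel hl] at this

lemma psi_start_end_eq (hord : IsPathOrder H q p)
    (hu : IsUnionOfMinimalPaths H q p)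
    (hadj : ¬ H.Adj q p)
    (x : FreeIdx H → ℝ) :
    psi H x q p = -chainsForm (fun w => ell w - 1) startIdx endIdx edgeIdx diagIdx (freeIdx H q q)
      (minimalPaths H q p) x := by
  rw [psi_start_end hord hu hadj, chainsForm, neg_div, Finset.sum_div]
  congr 1
  refine Finset.sum_congr rfl fun w hw => ?_
  rw [chain_path hord hu hadj x hw, endIdx,
    psi_adj x (adj_getVert_ell hord hadj w).1 (adj_getVert_ell hord hadj w).2]

lemma termA_eq (hord : IsPathOrder H q p) (hu : IsUnionOfMinimalPaths H q p) (hadj : ¬ H.Adj q p)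
    (x : FreeIdx H → ℝ) :
    termA H q p x = chainsForm (fun w => ell w - 1) startIdx endIdx edgeIdx diagIdx (freeIdx H q q)
      (IsChainSystem.single (minimalPaths H q p) (fun w => ell w - 1)) x := by
  rw [termA, chainsForm, single_minimalPaths hord hadj]
  refine Finset.sum_congr rfl fun w hw => ?_
  have h1 : ell w = 1 := (Finset.mem_filter.1 hw).2
  rw [chain_path hord hu hadj x (Finset.mem_filter.1 hw).1, endIdx, psi_self,
    psi_adj x (adj_getVert_ell hord hadj w).1 (adj_getVert_ell hord hadj w).2, h1]

lemma sum_missing_eq_chainsSum (hord : IsPathOrder H q p)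
    (hu : IsUnionOfMinimalPaths H q p)
    (hadj : ¬ H.Adj q p)
    (x : FreeIdx H → ℝ) :
    ∑ ij ∈ Finset.univ.filter (fun ij : V × V => (ij.1 < ij.2 ∧ ¬ H.Adj ij.1 ij.2) ∧ ij ≠ (q, p)),
        psi H x ij.1 ij.2 ^ 2 =
      chainsSum (fun w => ell w - 1) startIdx edgeIdx diagIdx
        (IsChainSystem.long (minimalPaths H q p) (fun w => ell w - 1)) x := by
  rw [sum_missing_eq hord hu hadj, chainsSum, IsChainSystem.long, Finset.sum_filter]
  refine Finset.sum_congr rfl fun w hw => ?_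
  split_ifs with h
  · refine Finset.sum_congr rfl fun k hk => ?_
    have hk := Finset.mem_range.1 hk
    exact congrArg (· ^ 2) (chain_eq_psi hord hu hadj x hw (k := k + 1) (by omega)).symm
  · rw [not_not.1 h, Finset.range_zero, Finset.sum_empty]

end PathChains

/-! ### The claims about the expectations, for the graph with the edge removed -/

section RemoveEdge

variable {V : Type*} [Fintype V] [LinearOrder V] {G : SimpleGraph V} {q p : V} {δ : ℝ}

lemma not_removeEdge_adj (G : SimpleGraph V) (q p : V) : ¬ (removeEdge G q p).Adj q p := by
  simp [removeEdge, SimpleGraph.deleteEdges_adj]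

lemma removeEdge_adj_iff (hqp : q < p) {i j : V} (hij : i < j) :
    (removeEdge G q p).Adj i j ↔ G.Adj i j ∧ (i, j) ≠ (q, p) := by
  have : s(i, j) = s(q, p) ↔ (i, j) = (q, p) := by
    rw [Sym2.eq_iff, Prod.mk.injEq, or_iff_left]
    rintro ⟨rfl, rfl⟩
    exact hij.not_gt hqp
  rw [removeEdge, SimpleGraph.deleteEdges_adj, Set.mem_singleton_iff, this]

lemma missing_removeEdge (he : G.Adj q p) (hqp : q < p) :
    (Finset.univ.filter fun ij : V × V => ij.1 < ij.2 ∧ ¬ G.Adj ij.1 ij.2) =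
      Finset.univ.filter (fun ij : V × V =>
        (ij.1 < ij.2 ∧ ¬ (removeEdge G q p).Adj ij.1 ij.2) ∧ ij ≠ (q, p)) := by
  ext ⟨i, j⟩
  simp only [Finset.mem_filter, Finset.mem_univ, true_and]
  constructor
  · rintro ⟨hij, h⟩
    rw [removeEdge_adj_iff hqp hij]
    refine ⟨⟨hij, fun h' => h h'.1⟩, ?_⟩
    rintro e
    obtain ⟨rfl, rfl⟩ := Prod.ext_iff.1 e
    exact h he
  · rintro ⟨⟨hij, h⟩, h'⟩
    rw [removeEdge_adj_iff hqp hij] at h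
    exact ⟨hij, fun h1 => h ⟨h1, h'⟩⟩

lemma sum_missing_removeEdge (he : G.Adj q p) (hqp : q < p) (f : V → V → ℝ) :
    ∑ ij ∈ Finset.univ.filter (fun ij : V × V => ij.1 < ij.2 ∧ ¬ (removeEdge G q p).Adj ij.1 ij.2),
        f ij.1 ij.2 =
      (∑ ij ∈ Finset.univ.filter (fun ij : V × V => ij.1 < ij.2 ∧ ¬ G.Adj ij.1 ij.2),
        f ij.1 ij.2) + f q p := by
  rw [missing_removeEdge he hqp, ← Finset.sum_filter_add_sum_filter_not
    (Finset.univ.filter fun ij : V × V => ij.1 < ij.2 ∧ ¬ (removeEdge G q p).Adj ij.1 ij.2)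
    (fun ij => ij ≠ (q, p)), Finset.filter_filter]
  congr 1
  rw [Finset.sum_eq_single (q, p)]
  · rintro ij h1 h2
    simp only [Finset.mem_filter, not_not] at h1
    exact absurd h1.2 h2
  · intro h
    refine absurd ?_ h
    simp [not_removeEdge_adj, hqp]

lemma missingSum_eq (hord : IsPathOrder (removeEdge G q p) q p)
    (hu : IsUnionOfMinimalPaths (removeEdge G q p) q p)
    (he : G.Adj q p)
    (x : FreeIdx (removeEdge G q p) → ℝ) :
    missingSum G q p x =
      chainsSum (fun w => ell w - 1) startIdx edgeIdx diagIdx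
        (IsChainSystem.long (minimalPaths (removeEdge G q p) q p) (fun w => ell w - 1)) x := by
  rw [missingSum, missing_removeEdge he hord.q_lt_p,
    sum_missing_eq_chainsSum hord hu (not_removeEdge_adj G q p)]

/-- The relative error of replacing `ψ_e` by `A` is nonnegative and at most `boundB`. -/
theorem one_sub_expectation_ratio_mem_Icc (hord : IsPathOrder (removeEdge G q p) q p)
    (hu : IsUnionOfMinimalPaths (removeEdge G q p) q p)
    (he : G.Adj q p)
    (hδ : 2 < δ) :
    1 - (∫ x, Real.exp (-(1 / 2) *
            (missingSum G q p x + psi (removeEdge G q p) x q p ^ 2))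
              ∂(psiLaw (removeEdge G q p) δ)) /
          (∫ x, Real.exp (-(1 / 2) *
            (missingSum G q p x + termA (removeEdge G q p) q p x ^ 2))
              ∂(psiLaw (removeEdge G q p) δ))
        ∈ Set.Icc 0 (boundB (removeEdge G q p) q p δ) := by
  have hadj := not_removeEdge_adj G q p
  have := isProbabilityMeasure_entryLaw (G := removeEdge G q p) (δ := δ) (by linarith)
  have key := IsChainSystem.one_sub_ratio_mem_Icc hδ
    (isChainSystem_minimalPaths (δ := δ) hord hu hadj)
  simp only [missingSum_eq hord hu he, termA_eq hord hu hadj, psi_start_end_eq hord hu hadj, neg_sq,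
    psiLaw_eq_pi, boundB]
  have hB : ∑ w ∈ pathsTwoPlus (removeEdge G q p) q p, bigR δ ^ (ell w - 1 + 1) =
      ∑ w ∈ pathsTwoPlus (removeEdge G q p) q p, bigR δ ^ ell w :=
    Finset.sum_congr rfl fun w _ => by
      rw [Nat.sub_add_cancel (one_le_ell hord.q_lt_p.ne hadj w)]
  beta_reduce at key
  rw [long_minimalPaths hord hadj, single_minimalPaths hord hadj, hB] at key
  rwa [long_minimalPaths hord hadj, single_minimalPaths hord hadj]

theorem indepFun_termA_missingSum (hord : IsPathOrder (removeEdge G q p) q p)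
    (hu : IsUnionOfMinimalPaths (removeEdge G q p) q p)
    (he : G.Adj q p)
    (hδ : 2 < δ) :
    IndepFun (termA (removeEdge G q p) q p) (missingSum G q p) (psiLaw (removeEdge G q p) δ) := by
  have hadj := not_removeEdge_adj G q p
  have := isProbabilityMeasure_entryLaw (G := removeEdge G q p) (δ := δ) (by linarith)
  have h1 := funext (termA_eq hord hu hadj)
  have h2 := funext (missingSum_eq hord hu he)
  rw [h1, h2, psiLaw_eq_pi]
  exact (isChainSystem_minimalPaths (δ := δ) hord hu hadj).indepFun_single_long

theorem integral_exp_termA (hord : IsPathOrder (removeEdge G q p) q p)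
    (hu : IsUnionOfMinimalPaths (removeEdge G q p) q p)
    (hδ : 2 < δ) :
    ∫ x, Real.exp (-(termA (removeEdge G q p) q p x ^ 2) / 2) ∂(psiLaw (removeEdge G q p) δ) =
      Real.Gamma ((δ + (pathsOfLengthTwo (removeEdge G q p) q p).card) / 2) *
          Real.Gamma ((δ + 1) / 2) /
        (Real.Gamma (δ / 2) *
          Real.Gamma ((δ + (pathsOfLengthTwo (removeEdge G q p) q p).card + 1) / 2)) := by
  have hadj := not_removeEdge_adj G q p
  have hδ0 : 0 < δ := by linarith
  have := isProbabilityMeasure_entryLaw (G := removeEdge G q p) hδ0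
  have key := (isChainSystem_minimalPaths (δ := δ) hord hu hadj).integral_exp_single hδ0
  simp only [termA_eq hord hu hadj, psiLaw_eq_pi]
  rw [single_minimalPaths hord hadj] at key ⊢
  rw [key, chiMoment, chiMoment]
  have h1 : Real.Gamma (δ / 2) ≠ 0 := (Real.Gamma_pos_of_pos (by positivity)).ne'
  have h2 : Real.Gamma ((δ + (pathsOfLengthTwo (removeEdge G q p) q p).card + 1) / 2) ≠ 0 :=
    (Real.Gamma_pos_of_pos (by positivity)).ne'
  have h3 : (2 : ℝ) ^ ((1 : ℝ) / 2) ≠ 0 := by positivity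
  field_simp

end RemoveEdge

/-! ### The Cholesky decomposition -/

section Cholesky

variable {V : Type*} [Fintype V] [LinearOrder V] {G : SimpleGraph V} {M N : Matrix V V ℝ}

open scoped Matrix

/-- Upper triangular matrices with positive diagonal. -/
structure IsPosUpper (M : Matrix V V ℝ) : Prop where
  upper : ∀ ⦃i j⦄, j < i → M i j = 0
  pos : ∀ i, 0 < M i i

namespace IsPosUpper

lemma gram_apply (h : ∀ ⦃i j⦄, j < i → M i j = 0) (i j : V) :
    (Mᵀ * M) i j = ∑ r ∈ Finset.univ.filter (· < i), M r i * M r j + M i i * M i j := by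
  rw [Matrix.mul_apply, ← Finset.sum_filter_add_sum_filter_not Finset.univ (· < i)]
  simp only [Matrix.transpose_apply]
  congr 1
  rw [Finset.sum_eq_single i]
  · intro r hr hne
    have hr : i ≤ r := by simpa using hr
    rw [h (lt_of_le_of_ne hr hne.symm), zero_mul]
  · intro h'
    simp at h'

lemma det_eq (h : IsPosUpper M) : M.det = ∏ i, M i i :=
  Matrix.det_of_isUpperTriangular fun _ _ hij => h.upper hij

lemma det_pos (h : IsPosUpper M) : 0 < M.det :=
  h.det_eq ▸ Finset.prod_pos fun i _ => h.pos i

lemma posDef_gram (h : IsPosUpper M) : (Mᵀ * M).PosDef := by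
  rw [← Matrix.conjTranspose_eq_transpose_of_trivial]
  refine Matrix.PosDef.conjTranspose_mul_self M (Matrix.mulVec_injective_of_isUnit ?_)
  rw [Matrix.isUnit_iff_isUnit_det]
  exact h.det_pos.ne'.isUnit

/-- Uniqueness row by row: once the earlier rows agree, row i of the Gram matrix determines M_ii²,
hence M_ii > 0, and then the rest of the row. -/
lemma eq_of_gram_eq (hM : IsPosUpper M) (hN : IsPosUpper N) (h : Mᵀ * M = Nᵀ * N) : M = N := by
  suffices ∀ i j, M i j = N i j from Matrix.ext this
  intro i
  induction i using WellFoundedLT.induction with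
  | ind i ih =>
    have key : ∀ j, M i i * M i j = N i i * N i j := by
      intro j
      have e := congrFun (congrFun h i) j
      rw [gram_apply hM.upper, gram_apply hN.upper] at e
      have : ∑ r ∈ Finset.univ.filter (· < i), M r i * M r j =
          ∑ r ∈ Finset.univ.filter (· < i), N r i * N r j :=
        Finset.sum_congr rfl fun r hr => by
          have hr : r < i := by simpa using hr
          rw [ih r hr, ih r hr]
      linarith
    have hd : M i i = N i i := (mul_self_inj (hM.pos i).le (hN.pos i).le).1 (key i)
    intro j
    have := key j
    rw [← hd] at this
    exact mul_left_cancel₀ (hM.pos i).ne' this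

end IsPosUpper

/-- Existence of the Cholesky decomposition. -/
theorem exists_isPosUpper_gram_eq {S : Matrix V V ℝ} (hS : S.PosDef) :
    ∃ M : Matrix V V ℝ, IsPosUpper M ∧ Mᵀ * M = S := by
  let _ : LocallyFiniteOrder V := Fintype.toLocallyFiniteOrder
  let _ : LocallyFiniteOrderBot V := LocallyFiniteOrderBot.ofIic' V
    (fun a => Finset.univ.filter (· ≤ a)) (by simp)
  set L := LDL.lower hS with hL
  set D := LDL.diagEntries hS with hD
  have hLt : ∀ ⦃i j⦄, i < j → L i j = 0 := by
    have : (LDL.lowerInv hS).BlockTriangular OrderDual.toDual :=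
      fun i j hij => LDL.lowerInv_triangular hS hij
    intro i j hij
    exact Matrix.blockTriangular_inv_of_blockTriangular this hij
  have hLu : IsUnit (LDL.lowerInv hS) := isUnit_of_invertible _
  have hLd : ∀ i, L i i ≠ 0 := by
    have h1 : L.det = ∏ i, L i i := Matrix.det_of_isLowerTriangular L fun i j hij => hLt hij
    have h2 : L.det ≠ 0 := by
      rw [hL, LDL.lower]
      exact ((Matrix.isUnit_iff_isUnit_det _).1
        ((Matrix.isUnit_nonsing_inv_iff).2 hLu)).ne_zero
    rw [h1, Finset.prod_ne_zero_iff] at h2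
    exact fun i => h2 i (Finset.mem_univ i)
  have hDpos : ∀ i, 0 < D i := by
    have : (LDL.diag hS).PosDef := by
      rw [LDL.diag_eq_lowerInv_conj]
      exact hS.mul_mul_conjTranspose_same (Matrix.vecMul_injective_of_isUnit hLu)
    intro i
    have := this.diag_pos (i := i)
    rwa [LDL.diag, Matrix.diagonal_apply_eq] at this
  -- The transpose of L√D, with each row multiplied by the sign of L_ii. Only L_ii ≠ 0 is known, and
  -- the sign makes the diagonal positive without changing the Gram matrix.
  refine ⟨Matrix.of fun i j => |L i i| / L i i * √(D i) * L j i, ⟨fun i j hij => ?_, fun i => ?_⟩, ?_⟩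
  · simp [hLt hij]
  · have h1 : |L i i| / L i i * √(D i) * L i i = |L i i| * √(D i) := by
      field_simp [hLd i]
    rw [Matrix.of_apply, h1]
    exact mul_pos (abs_pos.2 (hLd i)) (Real.sqrt_pos.2 (hDpos i))
  · rw [← LDL.lower_conj_diag hS]
    ext i j
    rw [Matrix.mul_apply, Matrix.mul_apply]
    refine Finset.sum_congr rfl fun r _ => ?_
    rw [LDL.diag, Matrix.mul_diagonal]
    simp only [Matrix.transpose_apply, Matrix.of_apply, Matrix.conjTranspose_apply, star_trivial]
    rw [← hL, ← hD]
    have h1 : (|L r r| / L r r) ^ 2 = 1 := by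
      rw [div_pow, sq_abs, div_self (pow_ne_zero 2 (hLd r))]
    have h2 : √(D r) ^ 2 = D r := Real.sq_sqrt (hDpos r).le
    calc _ = (|L r r| / L r r) ^ 2 * √(D r) ^ 2 * (L i r * L j r) := by ring
      _ = _ := by rw [h1, h2]; ring

/-- The completed matrix `ψ`. -/
def psiMatrix (G : SimpleGraph V) (x : FreeIdx G → ℝ) : Matrix V V ℝ := Matrix.of (psi G x)

/-- The free entries of `ψᵗ ψ`. -/
def gramEntries (G : SimpleGraph V) (x : FreeIdx G → ℝ) : FreeIdx G → ℝ :=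
  fun ij => ((psiMatrix G x)ᵀ * psiMatrix G x) ij.1.1 ij.1.2

/-- The free entries with positive diagonal entries. -/
def posDiag (G : SimpleGraph V) : Set (FreeIdx G → ℝ) := {x | ∀ i, 0 < x (freeIdx G i i)}

lemma psiMatrix_upper (x : FreeIdx G → ℝ) ⦃i j : V⦄ (hij : j < i) : psiMatrix G x i j = 0 :=
  psi_of_gt x hij

lemma isPosUpper_psiMatrix {x : FreeIdx G → ℝ} (hx : x ∈ posDiag G) :
    IsPosUpper (psiMatrix G x) where
  upper := psiMatrix_upper x
  pos i := by
    have := hx i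
    rwa [psiMatrix, Matrix.of_apply, psi_self]

lemma gram_psiMatrix (x : FreeIdx G → ℝ) (i j : V) :
    ((psiMatrix G x)ᵀ * psiMatrix G x) i j =
      ∑ r ∈ Finset.univ.filter (· < i), psi G x r i * psi G x r j +
        x (freeIdx G i i) * psi G x i j := by
  rw [IsPosUpper.gram_apply (psiMatrix_upper x)]
  simp only [psiMatrix, Matrix.of_apply, psi_self]

lemma gram_psiMatrix_missing {x : FreeIdx G → ℝ} (hx : x ∈ posDiag G) {i j : V} (hij : i < j)
    (h : ¬ G.Adj i j) : ((psiMatrix G x)ᵀ * psiMatrix G x) i j = 0 := by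
  rw [gram_psiMatrix, psi_missing x hij h, mul_div_cancel₀ _ (hx i).ne', add_neg_cancel]

lemma symMatrix_free (k : FreeIdx G → ℝ) (ij : FreeIdx G) :
    symMatrix G k ij.1.1 ij.1.2 = k ij := by
  rw [symMatrix, Matrix.of_apply]
  exact dif_pos ij.2

lemma symMatrix_missing (k : FreeIdx G → ℝ) {i j : V} (hij : i < j) (h : ¬ G.Adj i j) :
    symMatrix G k i j = 0 := by
  rw [symMatrix, Matrix.of_apply, dif_neg, dif_neg]
  · exact fun h' => hij.not_gt h'.1
  · rintro (h' | h')
    · exact hij.ne h'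
    · exact h h'.2

lemma symMatrix_symm (k : FreeIdx G → ℝ) (i j : V) : symMatrix G k i j = symMatrix G k j i := by
  rcases lt_trichotomy i j with hij | rfl | hij
  · simp only [symMatrix, Matrix.of_apply, hij.ne, hij.ne', hij, hij.not_gt, false_or, true_and,
      false_and, dite_false]
  · rfl
  · simp only [symMatrix, Matrix.of_apply, hij.ne, hij.ne', hij, hij.not_gt, false_or, true_and,
      false_and, dite_false]

lemma symMatrix_gramEntries {x : FreeIdx G → ℝ} (hx : x ∈ posDiag G) :
    symMatrix G (gramEntries G x) = (psiMatrix G x)ᵀ * psiMatrix G x := by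
  have hsymm : ∀ i j, ((psiMatrix G x)ᵀ * psiMatrix G x) i j =
      ((psiMatrix G x)ᵀ * psiMatrix G x) j i := by
    intro i j
    simp only [Matrix.mul_apply, Matrix.transpose_apply]
    exact Finset.sum_congr rfl fun _ _ => mul_comm _ _
  have key : ∀ i j, i ≤ j → symMatrix G (gramEntries G x) i j =
      ((psiMatrix G x)ᵀ * psiMatrix G x) i j := by
    intro i j hij
    by_cases h : i = j ∨ (i < j ∧ G.Adj i j)
    · exact symMatrix_free (gramEntries G x) ⟨(i, j), h⟩
    · have hlt : i < j := lt_of_le_of_ne hij fun e => h (Or.inl e)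
      have ha : ¬ G.Adj i j := fun a => h (Or.inr ⟨hlt, a⟩)
      rw [symMatrix_missing _ hlt ha, gram_psiMatrix_missing hx hlt ha]
  ext i j
  rcases le_total i j with h | h
  · exact key i j h
  · rw [symMatrix_symm, hsymm, key j i h]

/-- The vanishing of the Gram entry at a missing edge is the completion formula solved for M_ij, so
the free entries of M determine M. This gives surjectivity of the Cholesky map. -/
lemma psi_entries_eq (hM : IsPosUpper M)
    (h : ∀ i j, i < j → ¬ G.Adj i j → (Mᵀ * M) i j = 0) (i j : V) :
    psi G (fun ij => M ij.1.1 ij.1.2) i j = M i j := by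
  induction i using WellFoundedLT.induction generalizing j with
  | ind i ih =>
    rcases lt_trichotomy i j with hij | rfl | hij
    · by_cases ha : G.Adj i j
      · rw [psi_adj _ hij ha, freeIdx_adj_val hij ha]
      · have e := h i j hij ha
        rw [IsPosUpper.gram_apply hM.upper] at e
        rw [psi_missing _ hij ha, freeIdx_self_val, div_eq_iff (hM.pos i).ne']
        have : ∑ r ∈ Finset.univ.filter (· < i), psi G (fun ij => M ij.1.1 ij.1.2) r i *
            psi G (fun ij => M ij.1.1 ij.1.2) r j =
            ∑ r ∈ Finset.univ.filter (· < i), M r i * M r j :=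
          Finset.sum_congr rfl fun r hr => by
            have hr : r < i := by simpa using hr
            rw [ih r hr, ih r hr]
        rw [this]
        linarith
    · rw [psi_self, freeIdx_self_val]
    · rw [psi_of_gt _ hij, hM.upper hij]

lemma image_gramEntries :
    gramEntries G '' posDiag G = {k | (symMatrix G k).PosDef} := by
  ext k
  constructor
  · rintro ⟨x, hx, rfl⟩
    rw [Set.mem_ofPred_eq, symMatrix_gramEntries hx]
    exact (isPosUpper_psiMatrix hx).posDef_gram
  · intro hk
    obtain ⟨M, hM, hMk⟩ := exists_isPosUpper_gram_eq (hk : (symMatrix G k).PosDef)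
    have hpsi : psiMatrix G (fun ij => M ij.1.1 ij.1.2) = M := by
      ext i j
      exact psi_entries_eq hM (fun i j hij ha => by rw [hMk, symMatrix_missing k hij ha]) i j
    refine ⟨fun ij => M ij.1.1 ij.1.2, fun i => ?_, ?_⟩
    · change 0 < M (freeIdx G i i).1.1 (freeIdx G i i).1.2
      rw [freeIdx_self_val]
      exact hM.pos i
    · ext ij
      rw [gramEntries, hpsi, hMk, symMatrix_free]

lemma injOn_gramEntries : Set.InjOn (gramEntries G) (posDiag G) := by
  intro x hx y hy e
  have h := (isPosUpper_psiMatrix hx).eq_of_gram_eq (isPosUpper_psiMatrix hy)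
    (by rw [← symMatrix_gramEntries hx, ← symMatrix_gramEntries hy, e])
  ext ij
  have := congrFun (congrFun h ij.1.1) ij.1.2
  simp only [psiMatrix, Matrix.of_apply] at this
  rwa [psi_of_free x ij.2, psi_of_free y ij.2, freeIdx_eq] at this

end Cholesky

/-! ### The Jacobian of the Cholesky decomposition -/

section Jacobian

variable {V : Type*} [Fintype V] [LinearOrder V] {G : SimpleGraph V}

lemma prod_freeIdx {M : Type*} [CommMonoid M] (f : FreeIdx G → M) :
    ∏ ij, f ij = ∏ i, (f (freeIdx G i i) *
      ∏ j ∈ Finset.univ.filter (fun j => i < j ∧ G.Adj i j), f (freeIdx G i j)) := by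
  have h1 : ∏ ij, f ij = ∏ ij ∈ Finset.univ.filter
      (fun ij : V × V => ij.1 = ij.2 ∨ (ij.1 < ij.2 ∧ G.Adj ij.1 ij.2)),
        f (freeIdx G ij.1 ij.2) := by
    rw [Finset.prod_subtype _ (p := fun ij : V × V => ij.1 = ij.2 ∨ (ij.1 < ij.2 ∧ G.Adj ij.1 ij.2))
      (by simp)]
    exact Fintype.prod_congr _ _ fun ij => congrArg f (freeIdx_eq ij).symm
  rw [h1, Finset.prod_filter, Fintype.prod_prod_type]
  refine Fintype.prod_congr _ _ fun i => ?_
  have h2 : ∀ j, (if i = j ∨ (i < j ∧ G.Adj i j) then f (freeIdx G i j) else 1) =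
      (if i = j then f (freeIdx G i j) else 1) *
        (if i < j ∧ G.Adj i j then f (freeIdx G i j) else 1) := by
    intro j
    by_cases e : i = j
    · subst e; simp
    · simp [e]
  rw [Fintype.prod_congr _ _ h2, Finset.prod_mul_distrib, Finset.prod_ite_eq, Finset.prod_filter,
    if_pos (Finset.mem_univ i)]

lemma psi_congr {x y : FreeIdx G → ℝ} {i : V} (h : ∀ ij : FreeIdx G, ij.1.1 ≤ i → x ij = y ij)
    (j : V) : psi G x i j = psi G y i j := by
  induction i using WellFoundedLT.induction generalizing j with
  | ind i ih =>
    by_cases hf : i = j ∨ (i < j ∧ G.Adj i j)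
    · rw [psi_of_free x hf, psi_of_free y hf, h _ (by rw [freeIdx_val hf])]
    · by_cases hij : i < j
      · have ha : ¬ G.Adj i j := fun a => hf (Or.inr ⟨hij, a⟩)
        rw [psi_missing x hij ha, psi_missing y hij ha, h _ (by rw [freeIdx_self_val])]
        congr 2
        refine Finset.sum_congr rfl fun r hr => ?_
        have hr : r < i := by simpa using hr
        have hr' : ∀ ij : FreeIdx G, ij.1.1 ≤ r → x ij = y ij := fun ij hij => h ij (hij.trans hr.le)
        rw [ih r hr hr', ih r hr hr']
      · have : j < i := lt_of_le_of_ne (not_lt.1 hij) fun e => hf (Or.inl e.symm)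
        rw [psi_of_gt x this, psi_of_gt y this]

lemma differentiableAt_psi {x : FreeIdx G → ℝ} (hx : x ∈ posDiag G) (i j : V) :
    DifferentiableAt ℝ (fun x => psi G x i j) x := by
  induction i using WellFoundedLT.induction generalizing j with
  | ind i ih =>
    by_cases hf : i = j ∨ (i < j ∧ G.Adj i j)
    · simp only [psi_of_free _ hf]
      fun_prop
    · by_cases hij : i < j
      · have ha : ¬ G.Adj i j := fun a => hf (Or.inr ⟨hij, a⟩)
        simp only [psi_missing _ hij ha]
        simp only [div_eq_mul_inv]
        have h2 : DifferentiableAt ℝ (fun x : FreeIdx G → ℝ => x (freeIdx G i i)) x := by fun_prop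
        refine DifferentiableAt.fun_mul (DifferentiableAt.fun_neg ?_) (h2.fun_inv (hx i).ne')
        refine DifferentiableAt.fun_sum fun r hr => ?_
        have hr : r < i := by simpa using hr
        exact (ih r hr i).mul (ih r hr j)
      · have : j < i := lt_of_le_of_ne (not_lt.1 hij) fun e => hf (Or.inl e.symm)
        simp only [psi_of_gt _ this]
        fun_prop

/-- The part of the entry `(i, j)` of `ψᵗ ψ` that involves only the rows before `i`. -/
def gramRest (G : SimpleGraph V) (ij : FreeIdx G) (x : FreeIdx G → ℝ) : ℝ :=
  ∑ r ∈ Finset.univ.filter (· < ij.1.1), psi G x r ij.1.1 * psi G x r ij.1.2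

lemma gramEntries_apply (x : FreeIdx G → ℝ) (ij : FreeIdx G) :
    gramEntries G x ij = gramRest G ij x + x (freeIdx G ij.1.1 ij.1.1) * x ij := by
  rw [gramEntries, gram_psiMatrix, psi_of_free x ij.2, freeIdx_eq, gramRest]

lemma gramRest_congr {ij : FreeIdx G} {x y : FreeIdx G → ℝ}
    (h : ∀ kl : FreeIdx G, kl.1.1 < ij.1.1 → x kl = y kl) :
    gramRest G ij x = gramRest G ij y := by
  refine Finset.sum_congr rfl fun r hr => ?_
  have hr : r < ij.1.1 := by simpa using hr
  have h' : ∀ kl : FreeIdx G, kl.1.1 ≤ r → x kl = y kl := fun kl hkl => h kl (hkl.trans_lt hr)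
  rw [psi_congr h', psi_congr h']

lemma differentiableAt_gramEntries {x : FreeIdx G → ℝ} (hx : x ∈ posDiag G) :
    DifferentiableAt ℝ (gramEntries G) x := by
  rw [differentiableAt_pi]
  intro ij
  simp only [gramEntries_apply, gramRest]
  refine DifferentiableAt.add (DifferentiableAt.fun_sum fun r _ => ?_) (by fun_prop)
  exact (differentiableAt_psi hx _ _).mul (differentiableAt_psi hx _ _)

/-- Reduces the entries of the Jacobian matrix to one-variable derivatives, so that the completed
entries never have to be differentiated explicitly. -/
lemma hasDerivAt_gramEntries_line {x : FreeIdx G → ℝ} (hx : x ∈ posDiag G) (v : FreeIdx G → ℝ)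
    (ij : FreeIdx G) :
    HasDerivAt (fun t : ℝ => gramEntries G (x + t • v) ij) (fderiv ℝ (gramEntries G) x v ij) 0 :=
  hasDerivAt_pi.1 ((differentiableAt_gramEntries hx).hasFDerivAt.hasLineDerivAt v) ij

/-- Entry (i, j) of ψᵗψ involves the rows before i, the diagonal entry x_ii and x_ij. In the
lexicographic order x_ii opens row i, so nothing after (i, j) occurs and the Jacobian matrix is
triangular. -/
lemma fderiv_gramEntries_of_lt {x : FreeIdx G → ℝ} (hx : x ∈ posDiag G) {ij kl : FreeIdx G}
    (h : toLex ij.1 < toLex kl.1) :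
    fderiv ℝ (gramEntries G) x (Pi.single kl 1) ij = 0 := by
  refine (hasDerivAt_gramEntries_line hx (Pi.single kl 1) ij).unique ?_
  have e : (fun t : ℝ => gramEntries G (x + t • (Pi.single kl 1 : FreeIdx G → ℝ)) ij) =
      fun _ => gramEntries G x ij := by
    have hv : ∀ (t : ℝ) (m : FreeIdx G), m ≠ kl → (x + t • (Pi.single kl 1 : FreeIdx G → ℝ)) m = x m := by
      intro t m hm
      simp [Pi.single_eq_of_ne hm]
    ext t
    rw [gramEntries_apply, gramEntries_apply, hv t ij, hv t (freeIdx G ij.1.1 ij.1.1),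
      gramRest_congr (y := x)]
    · intro m hm
      refine hv t m ?_
      rintro rfl
      rcases (Prod.Lex.lt_iff).1 h with h | h
      · exact (h.trans hm).false
      · exact hm.ne' h.1
    · rintro rfl
      rw [freeIdx_self_val] at h
      have hle : ij.1.1 ≤ ij.1.2 := by
        rcases ij.2 with e | e
        · exact e.le
        · exact e.1.le
      rcases (Prod.Lex.lt_iff).1 h with h | h
      · exact lt_irrefl _ h
      · exact h.2.not_ge hle
    · rintro rfl
      exact lt_irrefl _ h
  rw [e]
  exact hasDerivAt_const _ _

lemma fderiv_gramEntries_self {x : FreeIdx G → ℝ} (hx : x ∈ posDiag G) (ij : FreeIdx G) :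
    fderiv ℝ (gramEntries G) x (Pi.single ij 1) ij =
      (if ij.1.1 = ij.1.2 then 2 else 1) * x (freeIdx G ij.1.1 ij.1.1) := by
  refine (hasDerivAt_gramEntries_line hx (Pi.single ij 1) ij).unique ?_
  have hv : ∀ (t : ℝ) (m : FreeIdx G), m ≠ ij → (x + t • (Pi.single ij 1 : FreeIdx G → ℝ)) m = x m := by
    intro t m hm
    simp [Pi.single_eq_of_ne hm]
  have hs : ∀ t : ℝ, (x + t • (Pi.single ij 1 : FreeIdx G → ℝ)) ij = x ij + t := by
    intro t
    simp
  have hr : ∀ t : ℝ, gramRest G ij (x + t • (Pi.single ij 1 : FreeIdx G → ℝ)) = gramRest G ij x := by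
    intro t
    refine gramRest_congr fun m hm => hv t m ?_
    rintro rfl
    exact lt_irrefl _ hm
  by_cases hd : ij.1.1 = ij.1.2
  · have he : freeIdx G ij.1.1 ij.1.1 = ij := by
      conv_rhs => rw [← freeIdx_eq ij, ← hd]
    simp only [gramEntries_apply, hr, he, hs, if_pos hd]
    have := (((hasDerivAt_id (0 : ℝ)).const_add (x ij)).mul
      ((hasDerivAt_id (0 : ℝ)).const_add (x ij))).const_add (gramRest G ij x)
    convert this using 1
    · ext t
      simp only [id_eq, Pi.mul_apply]
    · simp only [id_eq]
      ring
  · have he : freeIdx G ij.1.1 ij.1.1 ≠ ij := by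
      intro e
      have := congrArg (fun m : FreeIdx G => m.1.2) e
      rw [freeIdx_self_val] at this
      exact hd this
    simp only [gramEntries_apply, hr, hv _ _ he, hs, if_neg hd, one_mul]
    have := (((hasDerivAt_id (0 : ℝ)).const_add (x ij)).const_mul
      (x (freeIdx G ij.1.1 ij.1.1))).const_add (gramRest G ij x)
    simpa using this

/-- The determinant is the product of the diagonal derivatives: row i contributes 2x_ii from its
diagonal position and x_ii from each of its ν_i edges. -/
lemma det_fderiv_gramEntries {x : FreeIdx G → ℝ} (hx : x ∈ posDiag G) :
    (fderiv ℝ (gramEntries G) x).det = ∏ i, (2 * x (freeIdx G i i) ^ (nu G i + 1)) := by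
  let _ : LinearOrder (FreeIdx G) := LinearOrder.lift' (fun ij => toLex ij.1)
    fun a b e => Subtype.ext (toLex.injective e)
  rw [ContinuousLinearMap.det, ← LinearMap.det_toMatrix', Matrix.det_of_isLowerTriangular]
  · simp only [LinearMap.toMatrix'_apply]
    rw [Fintype.prod_congr _ _ fun ij => ?_, prod_freeIdx (f := fun ij : FreeIdx G =>
      (if ij.1.1 = ij.1.2 then 2 else 1) * x (freeIdx G ij.1.1 ij.1.1))]
    swap
    · rw [ContinuousLinearMap.coe_coe]
      convert fderiv_gramEntries_self hx ij
      rfl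
    refine Fintype.prod_congr _ _ fun i => ?_
    rw [freeIdx_self_val, if_pos rfl, pow_succ', nu]
    rw [Finset.prod_congr rfl (g := fun _ => x (freeIdx G i i)), Finset.prod_const, mul_assoc]
    intro j hj
    have hj : i < j ∧ G.Adj i j := by simpa using hj
    rw [freeIdx_adj_val hj.1 hj.2, if_neg hj.1.ne, one_mul]
  · intro ij kl h
    rw [LinearMap.toMatrix'_apply]
    have := fderiv_gramEntries_of_lt hx (ij := ij) (kl := kl) h
    rw [ContinuousLinearMap.coe_coe]
    convert this
    rfl

end Jacobian

/-! ### The normalizing constant as an expectation -/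

lemma pi_withDensity {ι : Type*} [Fintype ι] {ν : ι → Measure ℝ} [∀ i, IsProbabilityMeasure (ν i)]
    {f : ι → ℝ → ℝ} (hf : ∀ i, Measurable (f i)) (hf0 : ∀ i z, 0 ≤ f i z)
    (hν : ∀ i, ν i = volume.withDensity fun z => ENNReal.ofReal (f i z)) :
    Measure.pi ν = volume.withDensity fun x : ι → ℝ => ENNReal.ofReal (∏ i, f i (x i)) := by
  have hint : ∀ i, Integrable (f i) := fun i => by
    refine ⟨(hf i).aestronglyMeasurable, ?_⟩
    rw [hasFiniteIntegral_iff_ofReal (Filter.Eventually.of_forall (hf0 i)),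
      ← setLIntegral_univ, ← withDensity_apply _ MeasurableSet.univ, ← hν i, measure_univ]
    exact ENNReal.one_lt_top
  refine Measure.pi_eq fun s hs => ?_
  rw [withDensity_apply _ (MeasurableSet.univ_pi hs), volume_pi, Measure.restrict_pi_pi,
    ← ofReal_integral_eq_lintegral_ofReal, integral_fintype_prod_eq_prod,
    ENNReal.ofReal_prod_of_nonneg fun i _ => integral_nonneg (hf0 i)]
  · refine Finset.prod_congr rfl fun i _ => ?_
    rw [hν i, withDensity_apply _ (hs i), ofReal_integral_eq_lintegral_ofReal
      (hint i).restrict (Filter.Eventually.of_forall (hf0 i))]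
  · exact Integrable.fintype_prod_dep fun i => (hint i).restrict
  · exact Filter.Eventually.of_forall fun x => Finset.prod_nonneg fun i _ => hf0 i _

section NormConst

open scoped Matrix

variable {V : Type*} [Fintype V] [LinearOrder V] {G : SimpleGraph V} {δ : ℝ}

/-- The density of `entryLaw`. -/
def entryPDF (G : SimpleGraph V) (δ : ℝ) (ij : FreeIdx G) : ℝ → ℝ :=
  if ij.1.1 = ij.1.2 then chiPDF (δ + nu G ij.1.1) else gaussianPDFReal 0 1

/-- The factor contributed by a free entry to the normalizing constant. -/
def entryConst (G : SimpleGraph V) (δ : ℝ) (ij : FreeIdx G) : ℝ :=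
  if ij.1.1 = ij.1.2 then
    (2 : ℝ) ^ ((δ + nu G ij.1.1) / 2) * Real.Gamma ((δ + nu G ij.1.1) / 2)
  else √(2 * Real.pi)

lemma entryConst_pos (hδ : 0 < δ) (ij : FreeIdx G) : 0 < entryConst G δ ij := by
  unfold entryConst
  split_ifs
  · have := Real.Gamma_pos_of_pos (show 0 < (δ + nu G ij.1.1) / 2 by positivity)
    positivity
  · have := Real.pi_pos
    positivity

lemma prod_entryConst :
    ∏ ij, entryConst G δ ij = ∏ i, ((2 : ℝ) ^ ((δ + nu G i) / 2) * Real.Gamma ((δ + nu G i) / 2) *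
      √(2 * Real.pi) ^ nu G i) := by
  rw [prod_freeIdx]
  refine Fintype.prod_congr _ _ fun i => ?_
  rw [entryConst, freeIdx_self_val, if_pos rfl, nu,
    Finset.prod_congr rfl (g := fun _ => √(2 * Real.pi)), Finset.prod_const]
  intro j hj
  have hj : i < j ∧ G.Adj i j := by simpa using hj
  rw [entryConst, freeIdx_adj_val hj.1 hj.2, if_neg hj.1.ne]

lemma measurable_entryPDF (ij : FreeIdx G) : Measurable (entryPDF G δ ij) := by
  unfold entryPDF
  split_ifs
  · fun_prop
  · exact measurable_gaussianPDFReal 0 1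

lemma entryPDF_nonneg (hδ : 0 < δ) (ij : FreeIdx G) (z : ℝ) : 0 ≤ entryPDF G δ ij z := by
  unfold entryPDF
  split_ifs
  · exact chiPDF_nonneg (by positivity) z
  · exact gaussianPDFReal_nonneg 0 1 z

lemma psiLaw_eq_withDensity (hδ : 0 < δ) :
    psiLaw G δ = volume.withDensity fun x : FreeIdx G → ℝ =>
      ENNReal.ofReal (∏ ij, entryPDF G δ ij (x ij)) := by
  have := isProbabilityMeasure_entryLaw (G := G) hδ
  rw [psiLaw_eq_pi]
  refine pi_withDensity (measurable_entryPDF) (entryPDF_nonneg hδ) fun ij => ?_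
  unfold entryLaw entryPDF
  split_ifs
  · exact chiLaw_eq_withDensity
  · rw [gaussianReal_of_var_ne_zero 0 one_ne_zero]
    rfl

lemma sum_psi_sq (x : FreeIdx G → ℝ) :
    ∑ i, ∑ j, psi G x i j ^ 2 = ∑ ij, x ij ^ 2 +
      ∑ ij ∈ Finset.univ.filter (fun ij : V × V => ij.1 < ij.2 ∧ ¬ G.Adj ij.1 ij.2),
        psi G x ij.1 ij.2 ^ 2 := by
  have h1 : ∑ ij, x ij ^ 2 = ∑ ij ∈ Finset.univ.filter
      (fun ij : V × V => ij.1 = ij.2 ∨ (ij.1 < ij.2 ∧ G.Adj ij.1 ij.2)),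
        psi G x ij.1 ij.2 ^ 2 := by
    rw [Finset.sum_subtype _ (p := fun ij : V × V => ij.1 = ij.2 ∨ (ij.1 < ij.2 ∧ G.Adj ij.1 ij.2))
      (by simp)]
    exact Fintype.sum_congr _ _ fun ij => by rw [psi_of_free x ij.2, freeIdx_eq]
  rw [h1, Finset.sum_filter, Finset.sum_filter, ← Finset.sum_add_distrib, ← Fintype.sum_prod_type']
  refine Fintype.sum_congr _ _ fun ⟨i, j⟩ => ?_
  rcases lt_trichotomy i j with h | rfl | h
  · by_cases ha : G.Adj i j <;> simp [h, ha, h.ne]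
  · simp
  · simp [h.ne', h.not_gt, psi_of_gt x h]

lemma measurableSet_posDiag : MeasurableSet (posDiag G) := by
  have : posDiag G = ⋂ i, {x : FreeIdx G → ℝ | 0 < x (freeIdx G i i)} := by
    ext x; simp [posDiag]
  rw [this]
  exact MeasurableSet.iInter fun i => measurableSet_lt measurable_const (measurable_pi_apply _)

lemma prod_entryPDF_eq_zero {x : FreeIdx G → ℝ} (hx : x ∉ posDiag G) :
    ∏ ij, entryPDF G δ ij (x ij) = 0 := by
  obtain ⟨i, hi⟩ : ∃ i, ¬ 0 < x (freeIdx G i i) := by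
    by_contra! h
    exact hx h
  refine Finset.prod_eq_zero (Finset.mem_univ (freeIdx G i i)) ?_
  rw [entryPDF, freeIdx_self_val, if_pos rfl, chiPDF, if_neg hi]

/-- The exponent of the chi density, δ+ν_i-1, is the sum of ν_i+1 from the Jacobian and δ-2 from the
determinant power; this is why ψ_ii has δ+ν_i degrees of freedom. -/
lemma entryConst_mul_entryPDF_self (hδ : 0 < δ) {i : V} {z : ℝ} (hz : 0 < z) :
    entryConst G δ (freeIdx G i i) * entryPDF G δ (freeIdx G i i) z =
      2 * z ^ (nu G i + 1) * z ^ (δ - 2) * Real.exp (-(1 / 2) * z ^ 2) := by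
  have hk : 0 < (δ + nu G i) / 2 := by positivity
  rw [entryConst, entryPDF, freeIdx_self_val, if_pos rfl, if_pos rfl, chiPDF, if_pos hz]
  have h1 : (2 : ℝ) ^ (1 - (δ + nu G i) / 2) = 2 / (2 : ℝ) ^ ((δ + nu G i) / 2) := by
    rw [Real.rpow_sub two_pos, Real.rpow_one]
  have h2 : z ^ (δ + nu G i - 1) = z ^ (nu G i + 1) * z ^ (δ - 2) := by
    rw [← Real.rpow_natCast, ← Real.rpow_add hz]
    congr 1; push_cast; ring
  have h3 := (Real.Gamma_pos_of_pos hk).ne'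
  rw [h1, h2]
  have h4 : (2 : ℝ) ^ ((δ + nu G i) / 2) ≠ 0 := by positivity
  field_simp

lemma entryConst_mul_entryPDF_adj {i j : V} (hij : i < j) (h : G.Adj i j) (z : ℝ) :
    entryConst G δ (freeIdx G i j) * entryPDF G δ (freeIdx G i j) z =
      Real.exp (-(1 / 2) * z ^ 2) := by
  have h1 : √(2 * Real.pi) ≠ 0 := by have := Real.pi_pos; positivity
  rw [entryConst, entryPDF, freeIdx_adj_val hij h, if_neg hij.ne, if_neg hij.ne, gaussianPDFReal]
  simp only [NNReal.coe_one, mul_one, sub_zero]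
  rw [mul_inv_cancel_left₀ h1]
  congr 1; ring

lemma prod_entryConst_mul_prod_entryPDF (hδ : 0 < δ) {x : FreeIdx G → ℝ} (hx : x ∈ posDiag G) :
    (∏ ij, entryConst G δ ij) * ∏ ij, entryPDF G δ ij (x ij) =
      (∏ i, (2 * x (freeIdx G i i) ^ (nu G i + 1))) * (∏ i, x (freeIdx G i i) ^ (δ - 2)) *
        Real.exp (-(1 / 2) * ∑ ij, x ij ^ 2) := by
  rw [← Finset.prod_mul_distrib, Finset.mul_sum, Real.exp_sum, prod_freeIdx, prod_freeIdx,
    ← Finset.prod_mul_distrib, ← Finset.prod_mul_distrib]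
  refine Fintype.prod_congr _ _ fun i => ?_
  rw [entryConst_mul_entryPDF_self hδ (hx i), ← mul_assoc]
  congr 1
  refine Finset.prod_congr rfl fun j hj => ?_
  have hj : i < j ∧ G.Adj i j := by simpa using hj
  exact entryConst_mul_entryPDF_adj hj.1 hj.2 _

/-- The normalizing constant of the `G`-Wishart distribution as an expectation. -/
theorem normConst_one_eq (hδ : 2 < δ) :
    normConst G δ 1 = (∏ ij, entryConst G δ ij) * ∫ x, Real.exp (-(1 / 2) *
      ∑ ij ∈ Finset.univ.filter (fun ij : V × V => ij.1 < ij.2 ∧ ¬ G.Adj ij.1 ij.2),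
        psi G x ij.1 ij.2 ^ 2) ∂psiLaw G δ := by
  have hδ0 : 0 < δ := by linarith
  have hmeas : Measurable fun x : FreeIdx G → ℝ =>
      ENNReal.ofReal (∏ ij, entryPDF G δ ij (x ij)) := by
    have := measurable_entryPDF (G := G) (δ := δ)
    fun_prop
  rw [normConst, ← image_gramEntries, integral_image_eq_integral_abs_det_fderiv_smul volume
    measurableSet_posDiag
    (fun x hx => (differentiableAt_gramEntries hx).hasFDerivAt.hasFDerivWithinAt)
    injOn_gramEntries, psiLaw_eq_withDensity hδ0,
    integral_withDensity_eq_integral_toReal_smul hmeas (by simp), ← integral_const_mul]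
  -- Off `posDiag` some chi density vanishes, so the expectation is an integral over `posDiag`, the
  -- domain of the Cholesky map.
  refine Eq.trans ?_ (setIntegral_eq_integral_of_forall_compl_eq_zero (s := posDiag G) ?_)
  · refine setIntegral_congr_fun measurableSet_posDiag fun x hx => ?_
    have hpos : ∀ i, 0 < x (freeIdx G i i) := hx
    have hdet : ((psiMatrix G x)ᵀ * psiMatrix G x).det ^ ((δ - 2) / 2) =
        ∏ i, x (freeIdx G i i) ^ (δ - 2) := by
      have h1 : ((psiMatrix G x)ᵀ * psiMatrix G x).det = (∏ i, x (freeIdx G i i)) ^ (2 : ℝ) := by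
        rw [Matrix.det_mul, Matrix.det_transpose, (isPosUpper_psiMatrix hx).det_eq, Real.rpow_two,
          sq]
        simp only [psiMatrix, Matrix.of_apply, psi_self]
      rw [h1, ← Real.rpow_mul (Finset.prod_nonneg fun i _ => (hpos i).le), mul_div_cancel₀ _ two_ne_zero,
        ← Real.finsetProd_rpow _ _ fun i _ => (hpos i).le]
    have htr : ((psiMatrix G x)ᵀ * psiMatrix G x).trace = ∑ i, ∑ j, psi G x i j ^ 2 := by
      rw [Matrix.trace, Finset.sum_comm]
      refine Fintype.sum_congr _ _ fun i => ?_
      rw [Matrix.diag_apply, Matrix.mul_apply]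
      exact Fintype.sum_congr _ _ fun j => by
        rw [Matrix.transpose_apply, psiMatrix, Matrix.of_apply, sq]
    simp only [smul_eq_mul]
    rw [symMatrix_gramEntries hx, Matrix.mul_one, hdet, htr, sum_psi_sq, det_fderiv_gramEntries hx,
      ENNReal.toReal_ofReal (Finset.prod_nonneg fun _ _ => entryPDF_nonneg hδ0 _ _),
      abs_of_nonneg (Finset.prod_nonneg fun i _ =>
        mul_nonneg zero_le_two (pow_nonneg (hpos i).le _)), ← mul_assoc (∏ ij, entryConst G δ ij),
      prod_entryConst_mul_prod_entryPDF hδ0 hx, mul_add, Real.exp_add]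
    ring
  · intro x hx
    rw [prod_entryPDF_eq_zero hx]
    simp

end NormConst

/-! ### Comparison of the normalizing constants of `G` and `G^{-e}` -/

lemma map_pi_comp {ι κ : Type*} [Fintype ι] [Fintype κ] {ν : ι → Measure ℝ}
    [∀ i, IsProbabilityMeasure (ν i)] {e : κ → ι} (he : Function.Injective e) :
    (Measure.pi ν).map (fun x j => x (e j)) = Measure.pi fun j => ν (e j) := by
  have h1 : iIndepFun (fun i (x : ι → ℝ) => x i) (Measure.pi ν) :=
    iIndepFun_pi (X := fun _ z => z) fun i => measurable_id.aemeasurable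
  have h2 := h1.precomp he
  have h3 := (iIndepFun_iff_map_fun_eq_pi_map fun j => (measurable_pi_apply (e j)).aemeasurable).1 h2
  rw [h3]
  congr 1
  ext1 j
  exact (measurePreserving_eval ν (e j)).map_eq

section Compare

variable {V : Type*} [Fintype V] [LinearOrder V] {G H : SimpleGraph V} {q p : V} {δ : ℝ}

@[fun_prop]
lemma measurable_psi (i j : V) : Measurable fun x : FreeIdx G → ℝ => psi G x i j := by
  induction i using WellFoundedLT.induction generalizing j with
  | ind i ih =>
    by_cases hf : i = j ∨ (i < j ∧ G.Adj i j)
    · simp only [psi_of_free _ hf]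
      fun_prop
    · by_cases hij : i < j
      · have ha : ¬ G.Adj i j := fun a => hf (Or.inr ⟨hij, a⟩)
        simp only [psi_missing _ hij ha]
        refine Measurable.div (Measurable.neg ?_) (by fun_prop)
        refine Finset.measurable_fun_sum _ fun r hr => ?_
        have hr : r < i := by simpa using hr
        exact (ih r hr i).mul (ih r hr j)
      · have : j < i := lt_of_le_of_ne (not_lt.1 hij) fun e => hf (Or.inl e.symm)
        simp only [psi_of_gt _ this]
        fun_prop

@[fun_prop]
lemma measurable_missingSum : Measurable (missingSum G q p) := by
  unfold missingSum
  fun_prop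

lemma psi_eq_psi {x : FreeIdx G → ℝ} {y : FreeIdx H → ℝ} {i : V}
    (hadj : ∀ k ≤ i, ∀ l, k < l → (G.Adj k l ↔ H.Adj k l))
    (h : ∀ k ≤ i, ∀ l, x (freeIdx G k l) = y (freeIdx H k l)) (j : V) :
    psi G x i j = psi H y i j := by
  induction i using WellFoundedLT.induction generalizing j with
  | ind i ih =>
    rcases lt_trichotomy i j with hij | rfl | hij
    · by_cases ha : G.Adj i j
      · rw [psi_adj x hij ha, psi_adj y hij ((hadj i le_rfl j hij).1 ha), h i le_rfl]
      · have ha' : ¬ H.Adj i j := fun a => ha ((hadj i le_rfl j hij).2 a)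
        rw [psi_missing x hij ha, psi_missing y hij ha', h i le_rfl]
        congr 2
        refine Finset.sum_congr rfl fun r hr => ?_
        have hr : r < i := by simpa using hr
        have h1 := fun k (hk : k ≤ r) => hadj k (hk.trans hr.le)
        have h2 := fun k (hk : k ≤ r) => h k (hk.trans hr.le)
        rw [ih r hr h1 h2, ih r hr h1 h2]
    · rw [psi_self, psi_self, h i le_rfl]
    · rw [psi_of_gt x hij, psi_of_gt y hij]

lemma adj_removeEdge_of_lt (hqp : q < p) {k : V} (hk : k < q) (l : V) (hkl : k < l) :
    G.Adj k l ↔ (removeEdge G q p).Adj k l := by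
  rw [removeEdge_adj_iff hqp hkl, and_iff_left]
  exact fun e => hk.ne (Prod.ext_iff.1 e).1

lemma nu_removeEdge_of_ne (hqp : q < p) {k : V} (hk : k ≠ q) :
    nu (removeEdge G q p) k = nu G k := by
  unfold nu
  congr 1
  refine Finset.filter_congr fun l _ => and_congr_right fun hkl => ?_
  rw [removeEdge_adj_iff hqp hkl, and_iff_left]
  exact fun e => hk (Prod.ext_iff.1 e).1

lemma nu_start_of_adj (hord : IsPathOrder (removeEdge G q p) q p)
    (he : G.Adj q p) : nu G q = 1 := by
  rw [nu, Finset.card_eq_one]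
  refine ⟨p, ?_⟩
  ext u
  simp only [Finset.mem_filter, Finset.mem_univ, true_and, Finset.mem_singleton]
  exact ⟨fun h => hord.eq_end_of_start_lt h.1, fun h => h ▸ ⟨hord.q_lt_p, he⟩⟩

lemma freeIdx_val_of_not {i j : V} (h : ¬ (i = j ∨ (i < j ∧ G.Adj i j))) :
    (freeIdx G i j).1 = (i, i) :=
  congrArg Subtype.val (dif_neg h)

lemma freeIdx_removeEdge_val (hqp : q < p) {k : V} (hk : k < q) (l : V) :
    (freeIdx (removeEdge G q p) k l).1 = (freeIdx G k l).1 := by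
  by_cases h : k = l ∨ (k < l ∧ G.Adj k l)
  · have h' : k = l ∨ (k < l ∧ (removeEdge G q p).Adj k l) :=
      h.imp_right fun h => ⟨h.1, (adj_removeEdge_of_lt hqp hk l h.1).1 h.2⟩
    rw [freeIdx_val h, freeIdx_val h']
  · have h' : ¬ (k = l ∨ (k < l ∧ (removeEdge G q p).Adj k l)) := fun h' =>
      h (h'.imp_right fun h => ⟨h.1, (adj_removeEdge_of_lt hqp hk l h.1).2 h.2⟩)
    rw [freeIdx_val_of_not h, freeIdx_val_of_not h']

lemma entryLaw_removeEdge (hqp : q < p) {k : V} (hk : k < q) (l : V) :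
    entryLaw (removeEdge G q p) δ (freeIdx (removeEdge G q p) k l) =
      entryLaw G δ (freeIdx G k l) := by
  have h1 : (freeIdx G k l).1.1 = k := by
    by_cases h : k = l ∨ (k < l ∧ G.Adj k l)
    · rw [freeIdx_val h]
    · rw [freeIdx_val_of_not h]
  rw [entryLaw, entryLaw, freeIdx_removeEdge_val hqp hk, h1, nu_removeEdge_of_ne hqp hk.ne]

lemma lt_of_missing (hord : IsPathOrder (removeEdge G q p) q p) (he : G.Adj q p)
    {i j : V} (hij : i < j) (h : ¬ G.Adj i j) : i < q := by
  by_contra hi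
  rcases (not_lt.1 hi).eq_or_lt with rfl | hi
  · exact h (hord.eq_end_of_start_lt hij ▸ he)
  · have h1 := hord.eq_end_of_start_lt hi
    have h2 := hord.eq_end_of_start_lt (hi.trans hij)
    exact hij.ne (h1.trans h2.symm)

lemma sum_psi_missing_eq (hord : IsPathOrder (removeEdge G q p) q p) (he : G.Adj q p)
    {x : FreeIdx G → ℝ} {y : FreeIdx (removeEdge G q p) → ℝ}
    (h : ∀ k < q, ∀ l, x (freeIdx G k l) = y (freeIdx (removeEdge G q p) k l)) :
    ∑ ij ∈ Finset.univ.filter (fun ij : V × V => ij.1 < ij.2 ∧ ¬ G.Adj ij.1 ij.2),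
        psi G x ij.1 ij.2 ^ 2 = missingSum G q p y := by
  refine Finset.sum_congr rfl fun ij hij => ?_
  have hij : ij.1 < ij.2 ∧ ¬ G.Adj ij.1 ij.2 := by simpa using hij
  have hq := lt_of_missing hord he hij.1 hij.2
  rw [psi_eq_psi (fun k hk l => adj_removeEdge_of_lt hord.q_lt_p (hk.trans_lt hq) l)
    fun k hk l => h k (hk.trans_lt hq) l]

/-- All missing edges of G start in rows before q. There G and G^{-e} have the same free positions,
and the numbers ν agree because they differ only at q. Both sides are thus the integral of one
function against the same marginal law. -/
lemma integral_exp_sum_psi_missing (hord : IsPathOrder (removeEdge G q p) q p) (he : G.Adj q p)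
    (hδ : 0 < δ) :
    ∫ x, Real.exp (-(1 / 2) *
      ∑ ij ∈ Finset.univ.filter (fun ij : V × V => ij.1 < ij.2 ∧ ¬ G.Adj ij.1 ij.2),
        psi G x ij.1 ij.2 ^ 2) ∂psiLaw G δ =
      ∫ y, Real.exp (-(1 / 2) * missingSum G q p y) ∂psiLaw (removeEdge G q p) δ := by
  have hqp := hord.q_lt_p
  have hG := isProbabilityMeasure_entryLaw (G := G) hδ
  have hH := isProbabilityMeasure_entryLaw (G := removeEdge G q p) hδ
  let T := {ij : FreeIdx (removeEdge G q p) // ij.1.1 < q}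
  let e : T → FreeIdx G := fun ij => freeIdx G ij.1.1.1 ij.1.1.2
  have hev : ∀ ij : T, (e ij).1 = ij.1.1 := fun ij => by
    rw [← freeIdx_removeEdge_val hqp ij.2, freeIdx_eq]
  have hinj : Function.Injective e := fun a b hab => by
    refine Subtype.ext (Subtype.ext ?_)
    rw [← hev, ← hev, hab]
  -- The rows from q on are filled with 0, which does not affect the missing entries.
  let ext : (T → ℝ) → FreeIdx (removeEdge G q p) → ℝ :=
    fun t ij => if h : ij.1.1 < q then t ⟨ij, h⟩ else 0
  have hext : Measurable ext := measurable_pi_lambda _ fun ij => by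
    by_cases h : ij.1.1 < q
    · simp only [ext, dif_pos h]; fun_prop
    · simp only [ext, dif_neg h]; fun_prop
  have hk : ∀ k < q, ∀ l, (freeIdx (removeEdge G q p) k l).1.1 < q := by
    intro k hk l
    by_cases h : k = l ∨ (k < l ∧ (removeEdge G q p).Adj k l)
    · rw [freeIdx_val h]; exact hk
    · rw [freeIdx_val_of_not h]; exact hk
  have hFm : Measurable fun t => Real.exp (-(1 / 2) * missingSum G q p (ext t)) := by fun_prop
  have h1 : ∀ x : FreeIdx G → ℝ,
      ∑ ij ∈ Finset.univ.filter (fun ij : V × V => ij.1 < ij.2 ∧ ¬ G.Adj ij.1 ij.2),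
        psi G x ij.1 ij.2 ^ 2 = missingSum G q p (ext fun ij => x (e ij)) := by
    intro x
    refine sum_psi_missing_eq hord he fun k hkq l => ?_
    simp only [ext, dif_pos (hk k hkq l), e]
    rw [freeIdx_removeEdge_val hqp hkq, freeIdx_eq]
  have h2 : ∀ y, missingSum G q p y = missingSum G q p (ext fun ij => y ij.1) := by
    intro y
    refine Finset.sum_congr rfl fun ij hij => ?_
    have hij : ij.1 < ij.2 ∧ ¬ G.Adj ij.1 ij.2 := by simpa using hij
    have hq := lt_of_missing hord he hij.1 hij.2
    rw [psi_congr (y := ext fun ij => y ij.1)]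
    intro kl hkl
    simp only [ext, dif_pos (hkl.trans_lt hq)]
  simp only [h1, psiLaw_eq_pi]
  have h3 : (fun y => Real.exp (-(1 / 2) * missingSum G q p y)) =
      fun y => Real.exp (-(1 / 2) * missingSum G q p (ext fun ij => y ij.1)) :=
    funext fun y => by rw [h2 y]
  rw [h3, ← integral_map (φ := fun (x : FreeIdx G → ℝ) ij => x (e ij))
      (measurable_pi_lambda _ fun ij => measurable_pi_apply _).aemeasurable
      (f := fun t => Real.exp (-(1 / 2) * missingSum G q p (ext t))) hFm.aestronglyMeasurable,
    ← integral_map (φ := fun (y : FreeIdx (removeEdge G q p) → ℝ) (ij : T) => y ij.1)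
      (measurable_pi_lambda _ fun ij => measurable_pi_apply _).aemeasurable
      (f := fun t => Real.exp (-(1 / 2) * missingSum G q p (ext t))) hFm.aestronglyMeasurable,
    map_pi_comp hinj, map_pi_comp Subtype.val_injective]
  congr 2
  ext1 ij
  have := entryLaw_removeEdge (G := G) (δ := δ) hqp ij.2 ij.1.1.2
  rw [freeIdx_eq] at this
  exact this.symm

lemma integral_exp_neg_pos {μ : Measure (FreeIdx G → ℝ)} [IsProbabilityMeasure μ]
    {f : (FreeIdx G → ℝ) → ℝ} (hf : Measurable f) (hf0 : ∀ x, 0 ≤ f x) :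
    0 < ∫ x, Real.exp (-(1 / 2) * f x) ∂μ := by
  refine integral_exp_pos (Integrable.of_bound (C := 1) (by fun_prop) ?_)
  refine Filter.Eventually.of_forall fun x => ?_
  rw [Real.norm_of_nonneg (Real.exp_pos _).le, Real.exp_le_one_iff]
  have := hf0 x
  linarith

/-- The normalizing constant is positive. -/
theorem normConst_one_pos (hδ : 2 < δ) : 0 < normConst G δ 1 := by
  have hδ0 : 0 < δ := by linarith
  have := isProbabilityMeasure_entryLaw (G := G) hδ0
  rw [normConst_one_eq hδ, psiLaw_eq_pi]
  exact mul_pos (Finset.prod_pos fun ij _ => entryConst_pos hδ0 ij)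
    (integral_exp_neg_pos (by fun_prop) fun x => Finset.sum_nonneg fun _ _ => sq_nonneg _)

/-- Only the factor of q changes: ν_q is 0 in G^{-e} and 1 in G. -/
lemma prod_entryConst_removeEdge (hord : IsPathOrder (removeEdge G q p) q p) (he : G.Adj q p)
    (hδ : 0 < δ) :
    (∏ ij, entryConst (removeEdge G q p) δ ij) / ∏ ij, entryConst G δ ij =
      Real.Gamma (δ / 2) / (2 * √Real.pi * Real.Gamma ((δ + 1) / 2)) := by
  have hpi := Real.pi_pos
  rw [prod_entryConst, prod_entryConst, ← Finset.mul_prod_erase _ _ (Finset.mem_univ q),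
    ← Finset.mul_prod_erase _ _ (Finset.mem_univ q), hord.nu_start (not_removeEdge_adj G q p),
    nu_start_of_adj hord he]
  have h1 : ∏ i ∈ Finset.univ.erase q, ((2 : ℝ) ^ ((δ + nu (removeEdge G q p) i) / 2) *
      Real.Gamma ((δ + nu (removeEdge G q p) i) / 2) *
        √(2 * Real.pi) ^ nu (removeEdge G q p) i) =
      ∏ i ∈ Finset.univ.erase q, ((2 : ℝ) ^ ((δ + nu G i) / 2) *
        Real.Gamma ((δ + nu G i) / 2) * √(2 * Real.pi) ^ nu G i) :=
    Finset.prod_congr rfl fun i hi => by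
      rw [nu_removeEdge_of_ne hord.q_lt_p (Finset.ne_of_mem_erase hi)]
  have h2 : ∏ i ∈ Finset.univ.erase q, ((2 : ℝ) ^ ((δ + nu G i) / 2) *
        Real.Gamma ((δ + nu G i) / 2) * √(2 * Real.pi) ^ nu G i) ≠ 0 := by
    refine Finset.prod_ne_zero_iff.2 fun i _ => ?_
    have := Real.Gamma_pos_of_pos (show 0 < (δ + nu G i) / 2 by positivity)
    positivity
  rw [h1, mul_div_mul_right _ _ h2]
  have h3 : (2 : ℝ) ^ ((δ + (1 : ℕ)) / 2) = (2 : ℝ) ^ (δ / 2) * √2 := by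
    rw [Real.sqrt_eq_rpow, ← Real.rpow_add two_pos]
    congr 1; push_cast; ring
  have h4 : √2 * √2 = (2 : ℝ) := Real.mul_self_sqrt zero_le_two
  have h5 := (Real.Gamma_pos_of_pos (show 0 < (δ + 1) / 2 by positivity)).ne'
  have h6 : (2 : ℝ) ^ (δ / 2) ≠ 0 := by positivity
  have h7 : √Real.pi ≠ 0 := by positivity
  rw [h3, Real.sqrt_mul zero_le_two]
  simp only [Nat.cast_zero, add_zero, pow_zero, mul_one, Nat.cast_one, pow_one]
  have h8 : (2 : ℝ) ^ (δ / 2) * √2 * Real.Gamma ((δ + 1) / 2) * (√2 * √Real.pi) =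
      (2 : ℝ) ^ (δ / 2) * (2 * √Real.pi * Real.Gamma ((δ + 1) / 2)) := by
    linear_combination (2 : ℝ) ^ (δ / 2) * √Real.pi * Real.Gamma ((δ + 1) / 2) * h4
  rw [h8, mul_div_mul_left _ _ h6]

lemma integral_exp_missingSum_add_termA (hord : IsPathOrder (removeEdge G q p) q p)
    (he : G.Adj q p)
    (hu : IsUnionOfMinimalPaths (removeEdge G q p) q p)
    (hδ : 2 < δ) :
    ∫ x, Real.exp (-(1 / 2) * (missingSum G q p x + termA (removeEdge G q p) q p x ^ 2))
        ∂(psiLaw (removeEdge G q p) δ) =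
      (∫ x, Real.exp (-(termA (removeEdge G q p) q p x ^ 2) / 2) ∂(psiLaw (removeEdge G q p) δ)) *
        ∫ x, Real.exp (-(1 / 2) * missingSum G q p x) ∂(psiLaw (removeEdge G q p) δ) := by
  have hadj := not_removeEdge_adj G q p
  have hδ0 : 0 < δ := by linarith
  have := isProbabilityMeasure_entryLaw (G := removeEdge G q p) hδ0
  have hsys := isChainSystem_minimalPaths (δ := δ) hord hu hadj
  simp only [termA_eq hord hu hadj, missingSum_eq hord hu he, psiLaw_eq_pi]
  rw [hsys.integral_exp_sum_single hδ0, hsys.integral_exp_single hδ0]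
  congr 1
  refine integral_congr_ae (Filter.Eventually.of_forall fun x => ?_)
  simp only
  congr 1; ring

/-- The ratio of the normalizing constants, relative to its approximation, is the ratio of the
expectations. -/
theorem normConst_ratio_eq (hord : IsPathOrder (removeEdge G q p) q p)
    (he : G.Adj q p)
    (hu : IsUnionOfMinimalPaths (removeEdge G q p) q p)
    (hδ : 2 < δ) :
    normConst (removeEdge G q p) δ 1 / normConst G δ 1 /
        approxRatio δ (pathsOfLengthTwo (removeEdge G q p) q p).card =
      (∫ x, Real.exp (-(1 / 2) * (missingSum G q p x + psi (removeEdge G q p) x q p ^ 2))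
          ∂(psiLaw (removeEdge G q p) δ)) /
        (∫ x, Real.exp (-(1 / 2) * (missingSum G q p x + termA (removeEdge G q p) q p x ^ 2))
          ∂(psiLaw (removeEdge G q p) δ)) := by
  have hδ0 : 0 < δ := by linarith
  have hpi := Real.pi_pos
  -- The expectation of exp(-S/2) occurs on both sides, in I_G and in the factored denominator, and
  -- cancels. The ratio of the Gamma constants times E exp(-A²/2) is the approximation.
  rw [integral_exp_missingSum_add_termA hord he hu hδ, integral_exp_termA hord hu hδ,
    normConst_one_eq hδ, normConst_one_eq hδ, integral_exp_sum_psi_missing hord he hδ0,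
    mul_div_mul_comm, prod_entryConst_removeEdge hord he hδ0, approxRatio]
  have hsum : ∀ x, ∑ ij ∈ Finset.univ.filter
      (fun ij : V × V => ij.1 < ij.2 ∧ ¬ (removeEdge G q p).Adj ij.1 ij.2),
        psi (removeEdge G q p) x ij.1 ij.2 ^ 2 =
      missingSum G q p x + psi (removeEdge G q p) x q p ^ 2 := fun x =>
    sum_missing_removeEdge he hord.q_lt_p fun i j => psi (removeEdge G q p) x i j ^ 2
  simp only [hsum]
  set d := (pathsOfLengthTwo (removeEdge G q p) q p).card
  have h1 := (Real.Gamma_pos_of_pos (show 0 < δ / 2 by positivity)).ne'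
  have h2 := (Real.Gamma_pos_of_pos (show 0 < (δ + 1) / 2 by positivity)).ne'
  have h3 := (Real.Gamma_pos_of_pos (show 0 < (δ + d) / 2 by positivity)).ne'
  have h4 := (Real.Gamma_pos_of_pos (show 0 < (δ + d + 1) / 2 by positivity)).ne'
  have h5 : √Real.pi ≠ 0 := by positivity
  field_simp

end Compare

end GWishartRatio

end

theorem theorem1 {V : Type*} [Fintype V] [LinearOrder V] (G : SimpleGraph V) (q p : V)
    (he : G.Adj q p)
    (hunion : IsUnionOfMinimalPaths (removeEdge G q p) q p)
    (hdisj : MinimalPathsDisjoint (removeEdge G q p) q p)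
    (hord : IsPathOrder (removeEdge G q p) q p)
    (δ : ℝ) (hδ : 2 < δ) :
    -- the relative error of replacing `ψ_e ^ 2` by `A ^ 2` lies in `[0, B]`
    (1 - (∫ x, Real.exp (-(1 / 2) *
            (missingSum G q p x + psi (removeEdge G q p) x q p ^ 2))
              ∂(psiLaw (removeEdge G q p) δ)) /
          (∫ x, Real.exp (-(1 / 2) *
            (missingSum G q p x + termA (removeEdge G q p) q p x ^ 2))
              ∂(psiLaw (removeEdge G q p) δ))
        ∈ Set.Icc 0 (boundB (removeEdge G q p) q p δ)) ∧
    -- `A` is independent of the sum over the missing edges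
    IndepFun (termA (removeEdge G q p) q p) (missingSum G q p)
      (psiLaw (removeEdge G q p) δ) ∧
    -- the expectation of `exp (-A ^ 2 / 2)`
    (∫ x, Real.exp (-(termA (removeEdge G q p) q p x ^ 2) / 2)
        ∂(psiLaw (removeEdge G q p) δ) =
      Real.Gamma ((δ + (pathsOfLengthTwo (removeEdge G q p) q p).card) / 2) *
          Real.Gamma ((δ + 1) / 2) /
        (Real.Gamma (δ / 2) *
          Real.Gamma ((δ + (pathsOfLengthTwo (removeEdge G q p) q p).card + 1) / 2))) ∧
    -- the ratio of normalizing constants is approximated with the same relative accuracy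
    0 < normConst (removeEdge G q p) δ 1 ∧ 0 < normConst G δ 1 ∧
    (1 - normConst (removeEdge G q p) δ 1 / normConst G δ 1 /
          approxRatio δ (pathsOfLengthTwo (removeEdge G q p) q p).card
        ∈ Set.Icc 0 (boundB (removeEdge G q p) q p δ)) := by
  -- The integral of a non-integrable function is 0 by convention, so positivity of the normalizing
  -- constants also expresses their finiteness.
  refine ⟨one_sub_expectation_ratio_mem_Icc hord hunion he hδ,
    indepFun_termA_missingSum hord hunion he hδ, integral_exp_termA hord hunion hδ,
    normConst_one_pos hδ, normConst_one_pos hδ, ?_⟩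
  rw [normConst_ratio_eq hord he hunion hδ]
  exact one_sub_expectation_ratio_mem_Icc hord hunion he hδ
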